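/- For an integer $N\ge 1$, a weight $w:\mathbb R\to[0,\infty]$ and $\beta\in\{1,2,4\}$, consider the symmetric measure on configurations of $N$ unlabelled real points with density $$\prod_{i=1}^{N} w(x_i)\prod_{1\le i<j\le N}|x_j-x_i|^{\beta}$$ with respect to Lebesgue measure. It is denoted $\mathrm{OE}_N(w)$, $\mathrm{UE}_N(w)$, $\mathrm{SE}_N(w)$ for $\beta=1,2,4$ respectively. Such ensembles are considered up to normalization: for ensembles $M,M'$ of the same number of points, $M=M'$ means that the laws of the ordered points agree up to a positive finite constant factor (for finite nonzero measures, this says that the normalized probability laws agree). $M\cup M'$ is the ensemble of all points of an independent pair of configurations drawn from $M$ and $M'$ (the product measure, if these are not finite). $\mathrm{even}(M)$ is the ensemble of the 2nd largest, 4th largest, … points of $M$; $\mathrm{odd}(M)$ is that of the largest, 3rd largest, … points; for an ensemble $M$ with an even number of points, $\mathrm{alt}(M)$ is $\mathrm{even}(M)$ with probability $1/2$ and $\mathrm{odd}(M)$ with probability $1/2$. **Theorem.** Let $n\ge 2$ be an integer, let $I\subset\mathbb R$ be a possibly unbounded open interval, let $f:\mathbb R\to[0,\infty)$ be differentiable on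 $I$ and $0$ outside $I$, and let $g:\mathbb R\to[0,\infty)$ be measurable. In $(g/f)^2$ use the conventions $0/0=0$ and $c/0=\infty$ for $c>0$. Then in each of the following five pairs the two statements are equivalent: 1. $\mathrm{even}(\mathrm{OE}_{2n}(f)\cup \mathrm{OE}_{2n+1}(f))=\mathrm{UE}_{2n}(g)$ and $\mathrm{even}(\mathrm{OE}_{2n+1}(f))=\mathrm{SE}_n((g/f)^2)$; 2. $\mathrm{even}(\mathrm{OE}_{2n}(f)\cup \mathrm{OE}_{2n}(f))=\mathrm{UE}_{2n}(g)$ and $\mathrm{even}(\mathrm{OE}_{2n}(f))=\mathrm{SE}_n((g/f)^2)$; 3. $\mathrm{odd}(\mathrm{OE}_{2n}(f)\cup \mathrm{OE}_{2n}(f))=\mathrm{UE}_{2n}(g)$ and $\mathrm{odd}(\mathrm{OE}_{2n}(f))=\mathrm{SE}_n((g/f)^2)$; 4. $\mathrm{odd}(\mathrm{OE}_{2n-1}(f)\cup \mathrm{OE}_{2n}(f))=\mathrm{UE}_{2n}(g)$ and $\mathrm{odd}(\mathrm{OE}_{2n-1}(f))=\mathrm{SE}_n((g/f)^2)$; 5.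 $\mathrm{alt}(\mathrm{OE}_{2n}(f)\cup \mathrm{OE}_{2n}(f))=\mathrm{UE}_{2n}(g)$ and $\mathrm{alt}(\mathrm{OE}_{2n}(f))=\mathrm{SE}_n((g/f)^2)$. -/

import Mathlib

open MeasureTheory
open scoped ENNReal

noncomputable section

/-- The matrix-ensemble eigenvalue law on `ℝ^N` (not normalized): the measure with density
`∏ᵢ w(xᵢ) · |Δ(x)|^β`, where `Δ(x) = ∏_{i<j} (x_j - x_i)`. The eigenvalues are unlabelled, so
the law is symmetric in the coordinates. -/
def betaEnsemble (β N : ℕ) (w : ℝ → ℝ≥0∞) : Measure (Fin N → ℝ) :=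
  volume.withDensity fun x =>
    (∏ i, w (x i)) * ENNReal.ofReal ((∏ i, ∏ j ∈ Finset.Ioi i, |x j - x i|) ^ β)

/-- The orthogonal ensemble `OE_N(w)`. -/
def orthogonalEnsemble (N : ℕ) (w : ℝ → ℝ≥0∞) : Measure (Fin N → ℝ) := betaEnsemble 1 N w

/-- The unitary ensemble `UE_N(w)`. -/
def unitaryEnsemble (N : ℕ) (w : ℝ → ℝ≥0∞) : Measure (Fin N → ℝ) := betaEnsemble 2 N w

/-- The symplectic ensemble `SE_N(w)`. -/
def symplecticEnsemble (N : ℕ) (w : ℝ → ℝ≥0∞) : Measure (Fin N → ℝ) := betaEnsemble 4 N w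

/-- The random union (superposition) of two independent ensembles: all `p + q` eigenvalues
of an independent pair. -/
def ensembleUnion {p q : ℕ} (μ : Measure (Fin p → ℝ)) (ν : Measure (Fin q → ℝ)) :
    Measure (Fin (p + q) → ℝ) :=
  (μ.prod ν).map fun z => Fin.append z.1 z.2

/-- The points of `x` listed in decreasing order: `descending x k` is the `(k+1)`-st largest.
(`x ∘ Tuple.sort x` is the increasing rearrangement of `x`.) -/
def descending {N : ℕ} (x : Fin N → ℝ) : Fin N → ℝ := fun k => x (Tuple.sort x k.rev)

/-- The map to the decreasing rearrangement is measurable, so that the push-forwards below are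
the intended ones. -/
theorem measurable_descending {N : ℕ} :
    Measurable (descending : (Fin N → ℝ) → (Fin N → ℝ)) := by
  have hs : ∀ σ : Equiv.Perm (Fin N), MeasurableSet {x : Fin N → ℝ | Tuple.sort x = σ} := by
    intro σ
    have : {x : Fin N → ℝ | Tuple.sort x = σ} =
        (⋂ i, ⋂ j, {x : Fin N → ℝ | i ≤ j → x (σ i) ≤ x (σ j)}) ∩
        ⋂ i, ⋂ j, {x : Fin N → ℝ | i < j → x (σ i) = x (σ j) → σ i < σ j} := by
      ext x
      rw [Set.mem_ofPred_eq, eq_comm, Tuple.eq_sort_iff]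
      simp [Monotone]
    rw [this]
    refine MeasurableSet.inter ?_ ?_
    · refine MeasurableSet.iInter fun i => MeasurableSet.iInter fun j => ?_
      by_cases h : i ≤ j
      · simpa [h] using measurableSet_le (measurable_pi_apply (σ i)) (measurable_pi_apply (σ j))
      · simp [h]
    · refine MeasurableSet.iInter fun i => MeasurableSet.iInter fun j => ?_
      by_cases h : i < j
      · by_cases h2 : σ i < σ j
        · simp [h2]
        · have he : MeasurableSet {x : Fin N → ℝ | x (σ i) = x (σ j)} :=
            measurableSet_eq_fun (measurable_pi_apply (σ i)) (measurable_pi_apply (σ j))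
          have hc : {x : Fin N → ℝ | i < j → x (σ i) = x (σ j) → σ i < σ j} =
              {x : Fin N → ℝ | x (σ i) = x (σ j)}ᶜ := by
            ext x
            simp [h, h2]
          rw [hc]
          exact he.compl
      · simp [h]
  refine measurable_pi_lambda _ fun k => ?_
  intro s hs'
  have : (fun x : Fin N → ℝ => descending x k) ⁻¹' s =
      ⋃ σ : Equiv.Perm (Fin N), {x | Tuple.sort x = σ} ∩ {x | x (σ k.rev) ∈ s} := by
    ext x
    simp [descending]
  rw [this]
  exact MeasurableSet.iUnion fun σ => (hs σ).inter (measurable_pi_apply (σ k.rev) hs')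

/-- `even(M)`: the 2nd largest, 4th largest, … of the `N` points of `M`;
there are `m = ⌊N/2⌋` of them. -/
def evenPart {N m : ℕ} (h : m = N / 2) (μ : Measure (Fin N → ℝ)) : Measure (Fin m → ℝ) :=
  μ.map fun x i => descending x ⟨2 * i + 1, by omega⟩

/-- `odd(M)`: the largest, 3rd largest, … of the `N` points of `M`;
there are `m = ⌈N/2⌉` of them. -/
def oddPart {N m : ℕ} (h : m = (N + 1) / 2) (μ : Measure (Fin N → ℝ)) :
    Measure (Fin m → ℝ) :=
  μ.map fun x i => descending x ⟨2 * i, by omega⟩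

/-- `alt(M)`, for an ensemble with an even number of points: `even(M)` with probability `1/2`
and `odd(M)` with probability `1/2`. -/
def altPart {N m : ℕ} (h : N = 2 * m) (μ : Measure (Fin N → ℝ)) : Measure (Fin m → ℝ) :=
  (2⁻¹ : ℝ≥0∞) • evenPart (by omega) μ + (2⁻¹ : ℝ≥0∞) • oddPart (by omega) μ

/-- Equality of two ensembles of `m` unlabelled points: the laws of the ordered points agree up
to the normalization constant. -/
def SameEnsemble {m : ℕ} (μ ν : Measure (Fin m → ℝ)) : Prop :=
  ∃ c : ℝ≥0∞, c ≠ 0 ∧ c ≠ ∞ ∧ μ.map descending = c • ν.map descending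

/-- For probability laws this is equality of the laws of the ordered points. -/
theorem sameEnsemble_iff_of_isProbabilityMeasure {m : ℕ} (μ ν : Measure (Fin m → ℝ))
    [IsProbabilityMeasure μ] [IsProbabilityMeasure ν] :
    SameEnsemble μ ν ↔ μ.map descending = ν.map descending := by
  constructor
  · rintro ⟨c, -, -, h⟩
    have h1 := congrArg (fun κ => κ Set.univ) h
    have hc : c = 1 := by
      simpa [Measure.map_apply measurable_descending MeasurableSet.univ] using h1.symm
    simpa [hc] using h
  · intro h
    exact ⟨1, by simp, by simp, by simpa using h⟩

/-- A real function, nonnegative where it is used, as a weight. -/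
def weight (f : ℝ → ℝ) : ℝ → ℝ≥0∞ := fun x => ENNReal.ofReal (f x)

/-- The weight `(g/f)²`, with the conventions `0/0 = 0` and `c/0 = ∞` for `c > 0`. -/
def quotientSqWeight (g f : ℝ → ℝ) : ℝ → ℝ≥0∞ := fun x => (weight g x / weight f x) ^ 2

end

/-!
The proof compares densities of the decreasingly ordered points. Let `w` be the weight `f`, let
`vdm` be the Vandermonde product, and fix one of the five ways of selecting points.

*Densities.* The selected points of an orthogonal ensemble have at `t₁ > ⋯ > t_n` a density
proportional to `∏ w(tᵢ) * KB(t)`, where `KB(t)` (`mergedIntegral`) integrates the remaining points,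
which interlace with `t`. For the union of two independent orthogonal ensembles, summing the product
of the two Vandermonde products over all distributions of the points gives a multiple of
`|vdm y| * |vdm z|`, where `y` are the selected and `z` the remaining points (Gunson's identity,
`sum_perm_abs_vdm_mul_abs_vdm`); so the selected points have density proportional to
`∏ w(yᵢ) * |vdm y| * KA(y)`, where `KA(y)` (`interlacingIntegral`) is the integral of
`∏ w(zᵢ) * |vdm z|` over the `z` that interlace with `y`. With `h = g / f`, the two statements of a
pair therefore say that `KA` is proportional to `|vdm y| ∏ h(yᵢ)`, and that `∏ w(tᵢ) * KB(t)` is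
proportional to `|vdm t|⁴ ∏ h(tᵢ)²`, almost everywhere.

*One curve.* Both kernels are determinants of the same curve `F` in `ℝ²ⁿ`: up to constant factors,
`KA(y) = det (F(yᵢ))` and `∏ w(tᵢ) * KB(t) = det (F(tᵢ), F'(tᵢ))`; this is `HasDeterminantalForm`.
Integrating a Vandermonde determinant over a box row by row replaces the rows by integrals of the
moment curve `f(x) (1, x, x², …)` over intervals between consecutive points, and constant row
operations turn these into values of a primitive `F`. The intervals that reach `±∞` decide on the
constant of integration and on the dimension of the moment curve, which gives the five lemmas
`hasDeterminantalForm_upper`, `_lower`, `_both`, `_neither` and `_add`. The moments that occur are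
finite as soon as one of the kernels takes a finite value, by Tonelli's theorem; if neither does,
both statements of the pair are false or `f` vanishes identically.

*The equivalence* (`ae_rowDet_iff_ae_rowDet_doubled`). It remains to see that `det (F(yᵢ))` is a
multiple of `vdm y ∏ h(yᵢ)` exactly if `det (F(tᵢ), F'(tᵢ))` is a multiple of `(vdm t)⁴ ∏ h(tᵢ)²`.
From either identity holding almost everywhere one reads off a continuous version of `h`, and the
identity holds everywhere off a finite set (`exists_continuous_representative`). In one direction
pairs of points are merged (`rowDet_doubled_of_rowDet`). In the other direction it is shown that
`F / h` is a polynomial curve of degree less than `2n` (`exists_polynomial_of_doubled`), by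
induction on `n`: dividing out the plane spanned by `F(a)` and `F'(a)` leaves a curve with the same
property in dimension `2n - 2`, with `h` multiplied by `(t - a)²`. The induction starts at `n = 2`,
where the hypothesis prescribes the pairing of the tangent planes of a curve in `ℝ⁴`, that is, the
Gram function of its Plücker coordinates; it determines these coordinates
(`exists_linear_of_gram`, `exists_plucker_forms`) and thereby the curve
(`exists_polynomial_of_plucker`).

Points where `f` vanishes carry no mass on either side, once `g` vanishes at almost all of them;
the convention `c / 0 = ∞` is what forces this from the second statement of a pair
(`ae_density_iff`).
-/

/-! ### Vandermonde products and determinants of families of vectors -/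

/-- The Vandermonde product `∏_{i<j} (x_j - x_i)`. -/
def vdm {N : ℕ} (x : Fin N → ℝ) : ℝ := ∏ i, ∏ j ∈ Finset.Ioi i, (x j - x i)

lemma det_vandermonde_eq_vdm {N : ℕ} (x : Fin N → ℝ) :
    (Matrix.vandermonde x).det = vdm x := Matrix.det_vandermonde x

lemma vdm_cons {N : ℕ} (a : ℝ) (y : Fin N → ℝ) :
    vdm (Fin.cons a y : Fin (N + 1) → ℝ) = (∏ j, (y j - a)) * vdm y := by
  simp [vdm, Fin.prod_univ_succ, Fin.prod_Ioi_succ]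

lemma vdm_ne_zero_iff {N : ℕ} (x : Fin N → ℝ) : vdm x ≠ 0 ↔ Function.Injective x := by
  rw [← det_vandermonde_eq_vdm, Matrix.det_vandermonde_ne_zero_iff]

lemma vdm_comp_perm {N : ℕ} (x : Fin N → ℝ) (σ : Equiv.Perm (Fin N)) :
    vdm (x ∘ σ) = Equiv.Perm.sign σ * vdm x := by
  rw [← det_vandermonde_eq_vdm, ← det_vandermonde_eq_vdm, ← Matrix.det_permute]
  rfl

lemma continuous_vdm {N : ℕ} : Continuous (vdm : (Fin N → ℝ) → ℝ) := by
  unfold vdm; fun_prop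

/-- The determinant of a square array of row vectors. -/
def rowDet {k : ℕ} (v : Fin k → Fin k → ℝ) : ℝ := Matrix.det (Matrix.of v)

lemma rowDet_perm {k : ℕ} (v : Fin k → Fin k → ℝ) (σ : Equiv.Perm (Fin k)) :
    rowDet (fun i => v (σ i)) = Equiv.Perm.sign σ * rowDet v :=
  Matrix.det_permute σ (Matrix.of v)

lemma continuous_rowDet {k : ℕ} : Continuous (rowDet : (Fin k → Fin k → ℝ) → ℝ) := by
  unfold rowDet
  exact Continuous.matrix_det continuous_id

/-- The family `F(t₀), F'(t₀), F(t₁), F'(t₁), …`. -/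
def doubled {E : Type*} {n : ℕ} (F F' : ℝ → E) (t : Fin n → ℝ) : Fin (2 * n) → E := fun k =>
  if k.val % 2 = 0 then F (t ⟨k.val / 2, by omega⟩) else F' (t ⟨k.val / 2, by omega⟩)

lemma doubled_cons {E : Type*} {n : ℕ} (F F' : ℝ → E) (a : ℝ) (t : Fin n → ℝ) :
    doubled F F' (Fin.cons a t : Fin (n + 1) → ℝ) =
      (Fin.cons (F a) (Fin.cons (F' a) (doubled F F' t) : Fin (2 * n + 1) → E) :
        Fin (2 * n + 1 + 1) → E) := by
  have key : ∀ k : Fin (2 * n + 1 + 1), doubled F F' (Fin.cons a t : Fin (n + 1) → ℝ) k =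
      (Fin.cons (F a) (Fin.cons (F' a) (doubled F F' t) : Fin (2 * n + 1) → E) :
        Fin (2 * n + 1 + 1) → E) k := by
    intro k
    induction k using Fin.cases with
    | zero => simp [doubled]
    | succ k =>
      induction k using Fin.cases with
      | zero =>
        have h0 : ((Fin.succ 0 : Fin (2 * n + 1 + 1)) : ℕ) = 1 := rfl
        simp only [doubled, h0, Fin.cons_succ, Fin.cons_zero]
        rfl
      | succ k =>
        have h0 : ((Fin.succ (Fin.succ k) : Fin (2 * n + 1 + 1)) : ℕ) = k.val + 2 := rfl
        have h1 : (k.val + 2) % 2 = k.val % 2 := by omega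
        have h2 : (⟨(k.val + 2) / 2, by omega⟩ : Fin (n + 1)) =
            Fin.succ ⟨k.val / 2, by omega⟩ := by
          ext; simp
        simp only [doubled, h0, h1, h2, Fin.cons_succ]
  exact funext key

/-- The linear functional `x ↦ det(u, x, v₁, …, v_k)`. -/
def secondRowForm {k : ℕ} (u : Fin (k + 2) → ℝ) (v : Fin k → Fin (k + 2) → ℝ) :
    (Fin (k + 2) → ℝ) →ₗ[ℝ] ℝ where
  toFun x := rowDet (Fin.cons u (Fin.cons x v : Fin (k + 1) → _) : Fin (k + 1 + 1) → _)
  map_add' x y :=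
    ((Matrix.detRowAlternating (R := ℝ) (n := Fin (k + 2))).curryLeft u).map_vecCons_add v x y
  map_smul' c x :=
    ((Matrix.detRowAlternating (R := ℝ) (n := Fin (k + 2))).curryLeft u).map_vecCons_smul v c x

lemma secondRowForm_self {k : ℕ} (u : Fin (k + 2) → ℝ) (v : Fin k → Fin (k + 2) → ℝ) :
    secondRowForm u v u = 0 := by
  refine Matrix.det_zero_of_row_eq (i := 0) (j := 1) (by simp) ?_
  funext j
  rfl

/-- Merging two points: `det(F(a), F(b), v) / (b - a) → det(F(a), F'(a), v)` as `b → a`. -/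
lemma tendsto_rowDet_merge {k : ℕ} {F : ℝ → Fin (k + 2) → ℝ} {F' : Fin (k + 2) → ℝ} {a : ℝ}
    (hF : HasDerivAt F F' a) (v : Fin k → Fin (k + 2) → ℝ) :
    Filter.Tendsto (fun ε : ℝ => ε⁻¹ * rowDet (Fin.cons (F a)
        (Fin.cons (F (a + ε)) v : Fin (k + 1) → _) : Fin (k + 1 + 1) → _))
      (nhdsWithin 0 {0}ᶜ)
      (nhds (rowDet (Fin.cons (F a) (Fin.cons F' v : Fin (k + 1) → _) :
        Fin (k + 1 + 1) → _))) := by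
  have h := (secondRowForm (F a) v).toContinuousLinearMap.hasFDerivAt.comp_hasDerivAt a hF
  rw [hasDerivAt_iff_tendsto_slope_zero] at h
  refine h.congr fun ε => ?_
  simp only [Function.comp, LinearMap.coe_toContinuousLinearMap', secondRowForm_self, sub_zero,
    smul_eq_mul]
  rfl

/-- Dividing out a vector: if `u ≠ 0` there is a linear map `L` with kernel spanned by `u` for which
`det(u, v₁, …, v_k)` is a nonzero multiple of `det(L v₁, …, L v_k)`. -/
lemma exists_reduction {k : ℕ} (u : Fin (k + 1) → ℝ) (hu : u ≠ 0) :
    ∃ (L : (Fin (k + 1) → ℝ) →ₗ[ℝ] (Fin k → ℝ)) (κ : ℝ), κ ≠ 0 ∧ L u = 0 ∧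
      (∀ v : Fin k → Fin (k + 1) → ℝ,
        rowDet (Fin.cons u v : Fin (k + 1) → _) = κ * rowDet fun i => L (v i)) ∧
      ∀ ξ : (Fin (k + 1) → ℝ) →ₗ[ℝ] ℝ, ξ u = 0 →
        ∃ ξ' : (Fin k → ℝ) →ₗ[ℝ] ℝ, ∀ x, ξ x = ξ' (L x) := by
  have he : (Pi.single 0 1 : Fin (k + 1) → ℝ) ≠ 0 := by
    intro h; simpa using congrFun h 0
  obtain ⟨A, hA⟩ := SeparatingDual.exists_continuousLinearEquiv_apply_eq (R := ℝ) hu he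
  let T : (Fin (k + 1) → ℝ) →ₗ[ℝ] (Fin k → ℝ) := LinearMap.funLeft ℝ ℝ Fin.succ
  let A' : (Fin (k + 1) → ℝ) →ₗ[ℝ] (Fin (k + 1) → ℝ) := A.toLinearEquiv.toLinearMap
  have hdet : LinearMap.det A' ≠ 0 := (LinearEquiv.isUnit_det' A.toLinearEquiv).ne_zero
  have hmul : ∀ w : Fin (k + 1) → Fin (k + 1) → ℝ,
      rowDet (fun i => A (w i)) = LinearMap.det A' * rowDet w := by
    intro w
    have := (Pi.basisFun ℝ (Fin (k + 1))).det_comp A' w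
    rw [Pi.basisFun_det] at this
    exact this
  refine ⟨T ∘ₗ A', (LinearMap.det A')⁻¹, inv_ne_zero hdet, ?_, ?_, ?_⟩
  · funext i
    simp [T, A', hA, LinearMap.funLeft]
  · intro v
    have h1 := hmul (Fin.cons u v : Fin (k + 1) → _)
    rw [eq_inv_mul_iff_mul_eq₀ hdet, ← h1, rowDet, Matrix.det_succ_row_zero, Fin.sum_univ_succ]
    rw [Finset.sum_eq_zero]
    · simp only [Fin.val_zero, pow_zero, one_mul, Matrix.of_apply, Fin.cons_zero, hA,
        Pi.single_eq_same, add_zero, rowDet]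
      rfl
    · intro j _
      simp [hA]
  · intro ξ hξ
    refine ⟨ξ ∘ₗ A.symm.toLinearEquiv.toLinearMap ∘ₗ
      LinearMap.pi (fun i : Fin (k + 1) => (Fin.cases (motive := fun _ => (Fin k → ℝ) →ₗ[ℝ] ℝ) 0
        (fun j => LinearMap.proj j) i)), fun x => ?_⟩
    have h2 : A x = (A x 0) • (Pi.single 0 1 : Fin (k + 1) → ℝ) +
        (fun i : Fin (k + 1) => (Fin.cases (motive := fun _ => (Fin k → ℝ) →ₗ[ℝ] ℝ) 0
        (fun j => LinearMap.proj j) i) (T (A x))) := by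
      funext i
      refine Fin.cases ?_ (fun j => ?_) i
      · simp
      · simp [T, LinearMap.funLeft]
    have h3 : x = (A x 0) • u + A.symm
        (fun i : Fin (k + 1) => (Fin.cases (motive := fun _ => (Fin k → ℝ) →ₗ[ℝ] ℝ) 0
        (fun j => LinearMap.proj j) i) (T (A x))) := by
      apply A.injective
      rw [map_add, map_smul, hA, A.apply_symm_apply]
      exact h2
    conv_lhs => rw [h3]
    rw [map_add, map_smul, hξ, smul_zero, zero_add]
    rfl

/-- Dividing out two vectors. -/
lemma exists_reduction₂ {k : ℕ} (u u' : Fin (k + 2) → ℝ)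
    (h : ∃ v : Fin k → Fin (k + 2) → ℝ,
      rowDet (Fin.cons u (Fin.cons u' v : Fin (k + 1) → _) : Fin (k + 1 + 1) → _) ≠ 0) :
    ∃ (L : (Fin (k + 2) → ℝ) →ₗ[ℝ] (Fin k → ℝ)) (κ : ℝ), κ ≠ 0 ∧ L u = 0 ∧ L u' = 0 ∧
      (∀ v : Fin k → Fin (k + 2) → ℝ,
        rowDet (Fin.cons u (Fin.cons u' v : Fin (k + 1) → _) : Fin (k + 1 + 1) → _) =
          κ * rowDet fun i => L (v i)) ∧
      ∀ ξ : (Fin (k + 2) → ℝ) →ₗ[ℝ] ℝ, ξ u = 0 → ξ u' = 0 →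
        ∃ ξ' : (Fin k → ℝ) →ₗ[ℝ] ℝ, ∀ x, ξ x = ξ' (L x) := by
  obtain ⟨v₀, hv₀⟩ := h
  have hu : u ≠ 0 := by
    rintro rfl
    exact hv₀ (Matrix.det_eq_zero_of_row_eq_zero 0 fun j => rfl)
  obtain ⟨L₁, κ₁, hκ₁, hL₁, hd₁, hf₁⟩ := exists_reduction u hu
  have hu' : L₁ u' ≠ 0 := by
    intro h0
    apply hv₀
    rw [hd₁]
    refine mul_eq_zero_of_right _ (Matrix.det_eq_zero_of_row_eq_zero 0 fun j => ?_)
    simp [h0]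
  obtain ⟨L₂, κ₂, hκ₂, hL₂, hd₂, hf₂⟩ := exists_reduction (L₁ u') hu'
  refine ⟨L₂ ∘ₗ L₁, κ₁ * κ₂, mul_ne_zero hκ₁ hκ₂, by simp [hL₁], by simp [hL₂], ?_, ?_⟩
  · intro v
    have hc : (fun i => L₁ ((Fin.cons u' v : Fin (k + 1) → Fin (k + 2) → ℝ) i)) =
        (Fin.cons (L₁ u') (fun i => L₁ (v i)) : Fin (k + 1) → _) := by
      funext i
      induction i using Fin.cases <;> simp
    rw [hd₁, mul_assoc, hc, hd₂]
    rfl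
  · intro ξ h0 h1
    obtain ⟨ξ₁, hξ₁⟩ := hf₁ ξ h0
    obtain ⟨ξ₂, hξ₂⟩ := hf₂ ξ₁ (by rw [← hξ₁, h1])
    exact ⟨ξ₂, fun x => by rw [hξ₁, hξ₂]; rfl⟩

/-! ### From distinct points to doubled points -/

lemma exists_injective_mem {S : Set ℝ} (hS : S.Infinite) (k : ℕ) :
    ∃ y : Fin k → ℝ, Function.Injective y ∧ ∀ i, y i ∈ S :=
  ⟨fun i => hS.natEmbedding S i, fun _ _ h => Fin.ext
    ((hS.natEmbedding S).injective (Subtype.ext h)), fun i => (hS.natEmbedding S i).2⟩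

lemma IsOpen.infinite_of_mem {O : Set ℝ} (hO : IsOpen O) {a : ℝ} (ha : a ∈ O) : O.Infinite :=
  infinite_of_mem_nhds a (hO.mem_nhds ha)

lemma comp_cons_cons {E : Type*} {k : ℕ} (F : ℝ → E) (a b : ℝ) (y : Fin k → ℝ) :
    (fun i => F ((Fin.cons a (Fin.cons b y : Fin (k + 1) → ℝ) : Fin (k + 1 + 1) → ℝ) i)) =
      (Fin.cons (F a) (Fin.cons (F b) (fun i => F (y i)) : Fin (k + 1) → E) :
        Fin (k + 1 + 1) → E) := by
  funext i
  induction i using Fin.cases with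
  | zero => simp
  | succ i => induction i using Fin.cases <;> simp

lemma vdm_cons_cons_add {k : ℕ} (a ε : ℝ) (y : Fin k → ℝ) :
    vdm (Fin.cons a (Fin.cons (a + ε) y : Fin (k + 1) → ℝ) : Fin (k + 1 + 1) → ℝ) =
      ε * ((∏ j, (y j - a)) * (∏ j, (y j - (a + ε))) * vdm y) := by
  rw [vdm_cons, vdm_cons, Fin.prod_univ_succ]
  simp only [Fin.cons_zero, Fin.cons_succ]
  ring

lemma eventually_add_mem {O : Set ℝ} (hO : IsOpen O) {a : ℝ} (ha : a ∈ O) :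
    ∀ᶠ ε : ℝ in nhdsWithin 0 {0}ᶜ, a + ε ∈ O := by
  have h : Filter.Tendsto (fun ε : ℝ => a + ε) (nhds 0) (nhds a) := by
    simpa using (continuous_const_add a).tendsto (0 : ℝ)
  exact nhdsWithin_le_nhds (h (hO.mem_nhds ha))

lemma tendsto_prod_sub_add {k : ℕ} (a : ℝ) (y : Fin k → ℝ) :
    Filter.Tendsto (fun ε : ℝ => (∏ j, (y j - a)) * (∏ j, (y j - (a + ε))) * vdm y)
      (nhdsWithin 0 {0}ᶜ) (nhds ((∏ j, (y j - a) ^ 2) * vdm y)) := by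
  have h : Continuous fun ε : ℝ => (∏ j, (y j - a)) * (∏ j, (y j - (a + ε))) * vdm y := by
    fun_prop
  have := (h.tendsto 0).mono_left (nhdsWithin_le_nhds (s := {0}ᶜ))
  simpa [Finset.prod_mul_distrib, sq] using this

/-- The determinant formula at distinct points forces the one with a merged pair of points. -/
lemma rowDet_merge_eq {O : Set ℝ} (hO : IsOpen O) {k : ℕ} {F F' : ℝ → Fin (k + 2) → ℝ}
    {h : ℝ → ℝ} {c : ℝ} (hF : ∀ t ∈ O, HasDerivAt F (F' t) t) (hh : ContinuousOn h O)
    (hA : ∀ y : Fin (k + 2) → ℝ, (∀ i, y i ∈ O) →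
      rowDet (fun i => F (y i)) = c * vdm y * ∏ i, h (y i))
    {a : ℝ} (ha : a ∈ O) {y : Fin k → ℝ} (hy : ∀ i, y i ∈ O) :
    rowDet (Fin.cons (F a) (Fin.cons (F' a) (fun i => F (y i)) : Fin (k + 1) → _) :
      Fin (k + 1 + 1) → _) = c * h a ^ 2 * vdm y * ∏ i, ((y i - a) ^ 2 * h (y i)) := by
  have h1 := tendsto_rowDet_merge (hF a ha) (fun i => F (y i))
  have h2 : Filter.Tendsto (fun ε : ℝ => a + ε) (nhdsWithin 0 {0}ᶜ) (nhds a) := by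
    exact (by simpa using (continuous_const_add a).tendsto (0 : ℝ) :
      Filter.Tendsto (fun ε : ℝ => a + ε) (nhds 0) (nhds a)).mono_left nhdsWithin_le_nhds
  have h3 : Filter.Tendsto (fun ε : ℝ => h (a + ε)) (nhdsWithin 0 {0}ᶜ) (nhds (h a)) :=
    (hh.continuousAt (hO.mem_nhds ha)).tendsto.comp h2
  have h4 := ((tendsto_prod_sub_add a y).const_mul c).mul
    ((h3.const_mul (h a)).mul_const (∏ i, h (y i)))
  have h5 : rowDet (Fin.cons (F a) (Fin.cons (F' a) (fun i => F (y i)) : Fin (k + 1) → _) :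
      Fin (k + 1 + 1) → _) = c * ((∏ j, (y j - a) ^ 2) * vdm y) *
        (h a * h a * ∏ i, h (y i)) := by
    refine tendsto_nhds_unique (h1.congr' ?_) h4
    filter_upwards [eventually_add_mem hO ha, self_mem_nhdsWithin] with ε hε hε0
    have hε0 : ε ≠ 0 := hε0
    rw [← comp_cons_cons F, hA, vdm_cons_cons_add, Fin.prod_univ_succ, Fin.prod_univ_succ]
    · simp only [Fin.cons_zero, Fin.cons_succ]
      field_simp
    · intro i
      induction i using Fin.cases with
      | zero => simpa
      | succ i => induction i using Fin.cases with
        | zero => simpa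
        | succ i => simpa using hy i
  rw [h5, Finset.prod_mul_distrib]
  ring

/-- Sign information at distinct points passes to a merged pair of points. -/
lemma rowDet_merge_sign {O : Set ℝ} (hO : IsOpen O) {k : ℕ} {F F' : ℝ → Fin (k + 2) → ℝ}
    {s : ℝ} (hF : ∀ t ∈ O, HasDerivAt F (F' t) t)
    (hS : ∀ y : Fin (k + 2) → ℝ, (∀ i, y i ∈ O) → 0 ≤ s * rowDet (fun i => F (y i)) * vdm y)
    {a : ℝ} (ha : a ∈ O) {y : Fin k → ℝ} (hy : ∀ i, y i ∈ O) :
    0 ≤ s * rowDet (Fin.cons (F a) (Fin.cons (F' a) (fun i => F (y i)) : Fin (k + 1) → _) :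
      Fin (k + 1 + 1) → _) * vdm y := by
  by_cases hay : ∃ j, y j = a
  · obtain ⟨j, hj⟩ := hay
    have : rowDet (Fin.cons (F a) (Fin.cons (F' a) (fun i => F (y i)) : Fin (k + 1) → _) :
        Fin (k + 1 + 1) → _) = 0 := by
      refine Matrix.det_zero_of_row_eq (i := 0) (j := j.succ.succ)
        (Fin.succ_ne_zero _).symm ?_
      funext l
      simp [hj]
    simp [this]
  push Not at hay
  have h1 := tendsto_rowDet_merge (hF a ha) (fun i => F (y i))
  have h2 := (h1.const_mul s).mul (tendsto_prod_sub_add a y)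
  have h3 := ge_of_tendsto h2 (b := 0) (by
    filter_upwards [eventually_add_mem hO ha, self_mem_nhdsWithin] with ε hε hε0
    have hε0 : ε ≠ 0 := hε0
    have h4 := hS (Fin.cons a (Fin.cons (a + ε) y : Fin (k + 1) → ℝ) : Fin (k + 1 + 1) → ℝ) (by
      intro i
      induction i using Fin.cases with
      | zero => simpa
      | succ i => induction i using Fin.cases with
        | zero => simpa
        | succ i => simpa using hy i)
    rw [comp_cons_cons F, vdm_cons_cons_add] at h4
    have h5 := mul_nonneg (sq_nonneg ε⁻¹) h4
    refine h5.trans_eq ?_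
    field_simp)
  have h6 : 0 < ∏ j, (y j - a) ^ 2 :=
    Finset.prod_pos fun j _ => sq_pos_of_ne_zero (sub_ne_zero.2 (hay j))
  have h7 := nonneg_of_mul_nonneg_left (b := ∏ j, (y j - a) ^ 2) (a := s * rowDet
    (Fin.cons (F a) (Fin.cons (F' a) (fun i => F (y i)) : Fin (k + 1) → _) :
      Fin (k + 1 + 1) → _) * vdm y) (by rw [mul_assoc, mul_comm (vdm y)]; exact h3) h6
  exact h7

lemma HasDerivAt.linearMap_comp {k l : ℕ} {F : ℝ → Fin k → ℝ} {F' : Fin k → ℝ} {t : ℝ}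
    (hF : HasDerivAt F F' t) (L : (Fin k → ℝ) →ₗ[ℝ] (Fin l → ℝ)) :
    HasDerivAt (fun x => L (F x)) (L F') t :=
  L.toContinuousLinearMap.hasFDerivAt.comp_hasDerivAt t hF

lemma linearMap_doubled {k l n : ℕ} (L : (Fin k → ℝ) →ₗ[ℝ] (Fin l → ℝ)) (F F' : ℝ → Fin k → ℝ)
    (t : Fin n → ℝ) :
    (fun i => L (doubled F F' t i)) = doubled (fun x => L (F x)) (fun x => L (F' x)) t := by
  funext i
  unfold doubled
  split_ifs <;> rfl

/-- The sign of the doubled determinants is that of the determinants at distinct points. -/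
lemma rowDet_doubled_sign {O : Set ℝ} (hO : IsOpen O) {n : ℕ} {F F' : ℝ → Fin (2 * n) → ℝ}
    {s : ℝ} (hF : ∀ t ∈ O, HasDerivAt F (F' t) t)
    (hS : ∀ y : Fin (2 * n) → ℝ, (∀ i, y i ∈ O) → 0 ≤ s * rowDet (fun i => F (y i)) * vdm y)
    {t : Fin n → ℝ} (ht : ∀ i, t i ∈ O) : 0 ≤ s * rowDet (doubled F F' t) := by
  induction n generalizing s with
  | zero =>
    have := hS (fun i => i.elim0) (fun i => i.elim0)
    have h0 : vdm (fun i : Fin (2 * 0) => (i.elim0 : ℝ)) = 1 := rfl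
    rw [h0, mul_one] at this
    convert this using 3
    funext i; exact i.elim0
  | succ n ih =>
    obtain ⟨a, t, rfl⟩ : ∃ a t', t = (Fin.cons a t' : Fin (n + 1) → ℝ) :=
      ⟨t 0, Fin.tail t, (Fin.cons_self_tail t).symm⟩
    rw [doubled_cons]
    have ha : a ∈ O := by simpa using ht 0
    by_cases hv : ∃ v : Fin (2 * n) → Fin (2 * n + 2) → ℝ, rowDet (Fin.cons (F a)
        (Fin.cons (F' a) v : Fin (2 * n + 1) → _) : Fin (2 * n + 1 + 1) → _) ≠ 0
    · obtain ⟨L, κ, hκ, hLa, hLa', hd, -⟩ := exists_reduction₂ (k := 2 * n) (F a) (F' a) hv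
      have h1 := @ih (fun x => L (F x)) (fun x => L (F' x)) (s * κ)
        (fun t ht => (hF t ht).linearMap_comp L) (fun y hy => by
          have h2 := rowDet_merge_sign (k := 2 * n) hO hF hS ha hy
          rw [hd] at h2
          rwa [mul_assoc s]) t (fun i => by simpa using ht i.succ)
      have h3 := hd (doubled F F' t)
      rw [linearMap_doubled] at h3
      rw [mul_assoc, ← h3] at h1
      exact h1
    · push Not at hv
      have h3 := hv (doubled F F' t)
      refine le_of_eq (mul_eq_zero_of_right s h3).symm

/-- The determinant formula at distinct points implies the formula at doubled points. One pair of
points is merged at a time: dividing out `F(a)` and `F'(a)` leaves a curve to which the formula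
applies with `(t - a)² h(t)` in the place of `h(t)`. -/
theorem rowDet_doubled_of_rowDet {O : Set ℝ} (hO : IsOpen O) {n : ℕ}
    {F F' : ℝ → Fin (2 * n) → ℝ} {h : ℝ → ℝ} {c : ℝ} (hc : c ≠ 0)
    (hF : ∀ t ∈ O, HasDerivAt F (F' t) t) (hh : ContinuousOn h O) (hpos : ∀ t ∈ O, h t ≠ 0)
    (hA : ∀ y : Fin (2 * n) → ℝ, (∀ i, y i ∈ O) →
      rowDet (fun i => F (y i)) = c * vdm y * ∏ i, h (y i))
    {t : Fin n → ℝ} (ht : ∀ i, t i ∈ O) :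
    rowDet (doubled F F' t) = c * vdm t ^ 4 * ∏ i, h (t i) ^ 2 := by
  induction n generalizing c O h with
  | zero =>
    have := hA (fun i => i.elim0) (fun i => i.elim0)
    have h0 : vdm (fun i : Fin (2 * 0) => (i.elim0 : ℝ)) = 1 := rfl
    have h1 : vdm t = 1 := rfl
    have h2 : ∏ i : Fin (2 * 0), h (i.elim0) = 1 := rfl
    rw [h0, h2] at this
    rw [h1, one_pow, Finset.univ_eq_empty, Finset.prod_empty, ← this]
    congr 1
    funext i; exact i.elim0
  | succ n ih =>
    obtain ⟨a, t, rfl⟩ : ∃ a t', t = (Fin.cons a t' : Fin (n + 1) → ℝ) :=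
      ⟨t 0, Fin.tail t, (Fin.cons_self_tail t).symm⟩
    have ha : a ∈ O := by simpa using ht 0
    rw [doubled_cons]
    have hv : ∃ v : Fin (2 * n) → Fin (2 * n + 2) → ℝ, rowDet (Fin.cons (F a)
        (Fin.cons (F' a) v : Fin (2 * n + 1) → _) : Fin (2 * n + 1 + 1) → _) ≠ 0 := by
      obtain ⟨y, hy, hyO⟩ := exists_injective_mem
        ((hO.infinite_of_mem ha).sdiff (Set.finite_singleton a)) (2 * n)
      refine ⟨fun i => F (y i), ?_⟩
      rw [rowDet_merge_eq (k := 2 * n) hO hF hh hA ha fun i => (hyO i).1]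
      refine mul_ne_zero (mul_ne_zero (mul_ne_zero hc (pow_ne_zero _ (hpos a ha)))
        ((vdm_ne_zero_iff y).2 hy)) (Finset.prod_ne_zero_iff.2 fun i _ => ?_)
      exact mul_ne_zero (pow_ne_zero _ (sub_ne_zero.2 fun h => (hyO i).2 h))
        (hpos _ (hyO i).1)
    obtain ⟨L, κ, hκ, hLa, hLa', hd, -⟩ := exists_reduction₂ (k := 2 * n) (F a) (F' a) hv
    have h3 := hd (doubled F F' t)
    rw [linearMap_doubled] at h3
    -- The new `h` vanishes at `a`, so that `a` has to be removed from `O`.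
    have hO' : IsOpen (O \ {a}) := hO.sdiff isClosed_singleton
    by_cases hat : ∃ i, t i = a
    · obtain ⟨i, hi⟩ := hat
      have hz : vdm (Fin.cons a t : Fin (n + 1) → ℝ) = 0 := by
        rw [vdm_cons, Finset.prod_eq_zero (Finset.mem_univ i) (by simp [hi]), zero_mul]
      rw [hz]
      refine h3.trans ?_
      rw [rowDet, Matrix.det_eq_zero_of_row_eq_zero
        (⟨2 * i.val, by omega⟩ : Fin (2 * n)) (fun j => ?_)]
      · simp
      · simp [doubled, hi, hLa]
    push Not at hat
    have h1 := @ih (O \ {a}) hO' (fun x => L (F x)) (fun x => L (F' x))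
      (fun x => (x - a) ^ 2 * h x) (κ⁻¹ * (c * h a ^ 2))
      (mul_ne_zero (inv_ne_zero hκ) (mul_ne_zero hc (pow_ne_zero _ (hpos a ha))))
      (fun t ht => (hF t ht.1).linearMap_comp L)
      ((by fun_prop : Continuous fun x : ℝ => (x - a) ^ 2).continuousOn.mul
        (hh.mono Set.sdiff_subset))
      (fun t ht => mul_ne_zero (pow_ne_zero _ (sub_ne_zero.2 fun h => ht.2 h)) (hpos t ht.1))
      (fun y hy => by
        have h2 := rowDet_merge_eq (k := 2 * n) hO hF hh hA ha fun i => (hy i).1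
        rw [hd] at h2
        field_simp
        rw [mul_comm, h2])
      t (fun i => ⟨by simpa using ht i.succ, hat i⟩)
    refine h3.trans ?_
    rw [h1, vdm_cons, Fin.prod_univ_succ]
    simp only [Fin.cons_zero, Fin.cons_succ, mul_pow, Finset.prod_mul_distrib,
      Finset.prod_pow]
    field_simp

/-! ### The tangent planes of a curve in four-space -/

open Matrix in
/-- A curve `θ` in `ℝ^{r+1}` whose Gram function, for a nondegenerate symmetric form `J`, is that of
a spanning curve `z` in `ℝ^r` with a nondegenerate symmetric form `D`, is a linear image of `z`: the
component of `θ` orthogonal to the image is isotropic, and it lies on a nondegenerate line. -/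
lemma exists_linear_of_gram {r : ℕ} {J : Matrix (Fin (r + 1)) (Fin (r + 1)) ℝ}
    {D : Matrix (Fin r) (Fin r) ℝ} (hJs : Jᵀ = J) (hJ : J.det ≠ 0) (hD : D.det ≠ 0)
    {S : Set ℝ} {θ : ℝ → Fin (r + 1) → ℝ} {z : ℝ → Fin r → ℝ}
    (hG : ∀ s ∈ S, ∀ t ∈ S, θ s ⬝ᵥ (J *ᵥ θ t) = z s ⬝ᵥ (D *ᵥ z t))
    {p : Fin r → ℝ} (hp : ∀ i, p i ∈ S) (hZ : (Matrix.of fun i => z (p i)).det ≠ 0) :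
    ∃ W : Matrix (Fin (r + 1)) (Fin r) ℝ, (∀ t ∈ S, θ t = W *ᵥ z t) ∧ Wᵀ * J * W = D := by
  set Z : Matrix (Fin r) (Fin r) ℝ := Matrix.of fun i => z (p i) with hZdef
  set Θ : Matrix (Fin r) (Fin (r + 1)) ℝ := Matrix.of fun i => θ (p i) with hΘdef
  have hZu : IsUnit Z.det := isUnit_iff_ne_zero.2 hZ
  have hΘJΘ : Θ * J * Θᵀ = Z * D * Zᵀ := by
    ext i j
    have := hG _ (hp i) _ (hp j)
    rw [Matrix.mul_assoc, Matrix.mul_assoc]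
    simpa [Matrix.mul_apply, dotProduct, mulVec, hΘdef, hZdef] using this
  have hΘt : ∀ t ∈ S, Θ *ᵥ (J *ᵥ θ t) = Z *ᵥ (D *ᵥ z t) := by
    intro t ht
    funext i
    exact hG _ (hp i) _ ht
  set W : Matrix (Fin (r + 1)) (Fin r) ℝ := (Z⁻¹ * Θ)ᵀ with hW
  have hWt : Wᵀ = Z⁻¹ * Θ := by rw [hW, transpose_transpose]
  have hWJW : Wᵀ * J * W = D := by
    rw [hWt, hW, transpose_mul]
    calc Z⁻¹ * Θ * J * (Θᵀ * Z⁻¹ᵀ) = Z⁻¹ * (Θ * J * Θᵀ) * Z⁻¹ᵀ := by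
          simp only [Matrix.mul_assoc]
      _ = (Z⁻¹ * Z) * D * (Z⁻¹ * Z)ᵀ := by
          rw [hΘJΘ, transpose_mul]; simp only [Matrix.mul_assoc]
      _ = D := by rw [nonsing_inv_mul _ hZu]; simp
  refine ⟨W, fun t ht => ?_, hWJW⟩
  have h1 : Wᵀ *ᵥ (J *ᵥ θ t) = D *ᵥ z t := by
    rw [hWt, ← mulVec_mulVec, hΘt t ht, mulVec_mulVec, nonsing_inv_mul _ hZu, one_mulVec]
  have h2 : Wᵀ *ᵥ (J *ᵥ (W *ᵥ z t)) = D *ᵥ z t := by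
    rw [mulVec_mulVec, mulVec_mulVec, hWJW]
  set δ := θ t - W *ᵥ z t with hδ
  have h3 : Wᵀ *ᵥ (J *ᵥ δ) = 0 := by
    rw [hδ, mulVec_sub, mulVec_sub, h1, h2, sub_self]
  -- `δ` is orthogonal to the image of `W` and to itself.
  have hW0 : ∀ x : Fin r → ℝ, (W *ᵥ x) ⬝ᵥ (J *ᵥ δ) = 0 := by
    intro x
    rw [dotProduct_comm, dotProduct_mulVec, ← mulVec_transpose, h3, zero_dotProduct]
  have hsymm : ∀ x y, x ⬝ᵥ (J *ᵥ y) = y ⬝ᵥ (J *ᵥ x) := by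
    intro x y
    rw [dotProduct_mulVec, ← mulVec_transpose, hJs, dotProduct_comm]
  have h4 : δ ⬝ᵥ (J *ᵥ δ) = 0 := by
    have e1 : θ t ⬝ᵥ (J *ᵥ δ) = 0 := by
      rw [hδ, mulVec_sub, dotProduct_sub, hG t ht t ht, hsymm, ← h1]
      have := hW0 (z t)
      rw [sub_eq_zero, dotProduct_comm (W *ᵥ z t), dotProduct_mulVec (J *ᵥ θ t),
        ← mulVec_transpose, dotProduct_comm]
    conv_lhs => rw [hδ]
    rw [sub_dotProduct, e1, hW0, sub_zero]
  by_contra hne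
  have hδ0 : δ ≠ 0 := sub_ne_zero.2 hne
  let T : ((Fin r → ℝ) × ℝ) →ₗ[ℝ] (Fin (r + 1) → ℝ) :=
    LinearMap.coprod W.mulVecLin (LinearMap.toSpanSingleton ℝ _ δ)
  have hT : ∀ x y, T (x, y) = W *ᵥ x + y • δ := fun x y => by simp [T]
  have hinj : Function.Injective T := by
    rw [← LinearMap.ker_eq_bot, LinearMap.ker_eq_bot']
    rintro ⟨x, y⟩ hxy
    rw [hT] at hxy
    have h5 : D *ᵥ x = 0 := by
      have := congrArg (fun v => Wᵀ *ᵥ (J *ᵥ v)) hxy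
      simp only [mulVec_add, mulVec_smul, h3, smul_zero, add_zero, mulVec_zero] at this
      rwa [mulVec_mulVec, mulVec_mulVec, hWJW] at this
    have hx : x = 0 := by
      by_contra hx0
      exact hD (exists_mulVec_eq_zero_iff.1 ⟨x, hx0, h5⟩)
    subst hx
    rw [mulVec_zero, zero_add, smul_eq_zero] at hxy
    rw [hxy.resolve_right hδ0]
    rfl
  have hsurj : Function.Surjective T := by
    rwa [← LinearMap.injective_iff_surjective_of_finrank_eq_finrank]
    simp
  have h6 : J *ᵥ δ = 0 := by
    rw [← dotProduct_self_eq_zero]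
    obtain ⟨⟨x, y⟩, hxy⟩ := hsurj (J *ᵥ δ)
    rw [hT] at hxy
    nth_rewrite 1 [← hxy]
    rw [add_dotProduct, hW0, smul_dotProduct, h4]
    simp
  exact hJ (exists_mulVec_eq_zero_iff.1 ⟨δ, hδ0, h6⟩)

/-- The three-term relation between the coordinates of a vector of a plane and the Plücker
coordinates of the plane, and its first-order consequence: if `φ` moves in the plane to first order,
then it also satisfies the relation with the derivatives of the Plücker coordinates. -/
lemma plucker_deriv {O : Set ℝ} (hO : IsOpen O) {φ₁ φ₂ φ₃ ψ₁ ψ₂ ψ₃ H P₂₃ P₁₃ P₁₂ : ℝ → ℝ}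
    (h₁ : ∀ t ∈ O, HasDerivAt φ₁ (ψ₁ t) t) (h₂ : ∀ t ∈ O, HasDerivAt φ₂ (ψ₂ t) t)
    (h₃ : ∀ t ∈ O, HasDerivAt φ₃ (ψ₃ t) t) (hH : ∀ t ∈ O, H t ≠ 0)
    (h23 : ∀ t ∈ O, φ₂ t * ψ₃ t - φ₃ t * ψ₂ t = H t * P₂₃ t)
    (h13 : ∀ t ∈ O, φ₁ t * ψ₃ t - φ₃ t * ψ₁ t = H t * P₁₃ t)
    (h12 : ∀ t ∈ O, φ₁ t * ψ₂ t - φ₂ t * ψ₁ t = H t * P₁₂ t) {t : ℝ} (ht : t ∈ O)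
    {Q₂₃ Q₁₃ Q₁₂ : ℝ} (hQ23 : HasDerivAt P₂₃ Q₂₃ t) (hQ13 : HasDerivAt P₁₃ Q₁₃ t)
    (hQ12 : HasDerivAt P₁₂ Q₁₂ t) :
    φ₁ t * P₂₃ t - φ₂ t * P₁₃ t + φ₃ t * P₁₂ t = 0 ∧
      φ₁ t * Q₂₃ - φ₂ t * Q₁₃ + φ₃ t * Q₁₂ = 0 := by
  have hrel : ∀ t ∈ O, φ₁ t * P₂₃ t - φ₂ t * P₁₃ t + φ₃ t * P₁₂ t = 0 := by
    intro t ht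
    apply mul_left_cancel₀ (hH t ht)
    linear_combination (-φ₁ t) * h23 t ht + φ₂ t * h13 t ht - φ₃ t * h12 t ht
  have hrel' : ψ₁ t * P₂₃ t - ψ₂ t * P₁₃ t + ψ₃ t * P₁₂ t = 0 := by
    apply mul_left_cancel₀ (hH t ht)
    linear_combination (-ψ₁ t) * h23 t ht + ψ₂ t * h13 t ht - ψ₃ t * h12 t ht
  refine ⟨hrel t ht, ?_⟩
  have hd := (((h₁ t ht).mul hQ23).sub ((h₂ t ht).mul hQ13)).add ((h₃ t ht).mul hQ12)
  have hz : HasDerivAt (φ₁ * P₂₃ - φ₂ * P₁₃ + φ₃ * P₁₂) 0 t := by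
    refine (hasDerivAt_const t (0 : ℝ)).congr_of_eventuallyEq ?_
    filter_upwards [hO.mem_nhds ht] with s hs
    exact hrel s hs
  have := hd.unique hz
  linear_combination this - hrel'

/-- The Plücker coordinate `φ_i φ_j' - φ_j φ_i'` of the tangent line of a curve. -/
def plucker (φ φ' : ℝ → Fin 4 → ℝ) (i j : Fin 4) (t : ℝ) : ℝ :=
  φ t i * φ' t j - φ t j * φ' t i

lemma hasDerivAt_binary_quartic (a b w₀ w₁ w₂ t : ℝ) :
    HasDerivAt (fun t : ℝ => (t - a) * (t - b) *
        (w₀ * (t - a) ^ 2 + w₁ * ((t - a) * (t - b)) + w₂ * (t - b) ^ 2))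
      (((t - b) + (t - a)) * (w₀ * (t - a) ^ 2 + w₁ * ((t - a) * (t - b)) + w₂ * (t - b) ^ 2) +
        (t - a) * (t - b) * (2 * w₀ * (t - a) + w₁ * ((t - a) + (t - b)) + 2 * w₂ * (t - b)))
      t := by
  have hX : HasDerivAt (fun t : ℝ => t - a) 1 t := (hasDerivAt_id t).sub_const a
  have hY : HasDerivAt (fun t : ℝ => t - b) 1 t := (hasDerivAt_id t).sub_const b
  refine ((hX.mul hY).mul ((((hX.pow 2).const_mul w₀).add ((hX.mul hY).const_mul w₁)).add
    ((hY.pow 2).const_mul w₂))).congr_deriv ?_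
  simp only [Pi.mul_apply, Pi.pow_apply, Pi.add_apply, Nat.cast_ofNat]
  ring

lemma hasDerivAt_const_mul_pow_four (a c t : ℝ) :
    HasDerivAt (fun t : ℝ => c * (t - a) ^ 4) (4 * c * (t - a) ^ 3) t := by
  have hX : HasDerivAt (fun t : ℝ => t - a) 1 t := (hasDerivAt_id t).sub_const a
  refine ((hX.pow 4).const_mul c).congr_deriv ?_
  push_cast
  ring

/-- If the tangent planes of a curve in `ℝ⁴`, in the basis given by the position and velocity at two
points `a` and `b`, pair like the tangent planes of the rational normal curve, then the Plücker
coordinates are the quartic forms in `X = t - a`, `Y = t - b` displayed in the conclusion.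

The hypothesis at `s = a` and `s = b` gives `p₂₃` and `p₀₁`. The remaining four coordinates, divided
by `H X Y`, have the Gram function of `(X², XY, Y²)`, hence depend linearly on that curve; all their
coefficients but `k, α, β, γ, ε` vanish, as the derivatives of the relations at `a` and `b` show. -/
lemma exists_plucker_forms {O : Set ℝ} (hO : IsOpen O) {φ φ' : ℝ → Fin 4 → ℝ} {H : ℝ → ℝ}
    {c a b : ℝ} (hF : ∀ i, ∀ t ∈ O, HasDerivAt (fun t => φ t i) (φ' t i) t)
    (hH : ∀ t ∈ O, H t ≠ 0) (ha : a ∈ O) (hb : b ∈ O) (hab : a ≠ b)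
    (ha0 : φ a = ![1, 0, 0, 0]) (ha1 : φ' a = ![0, 1, 0, 0])
    (hb0 : φ b = ![0, 0, 1, 0]) (hb1 : φ' b = ![0, 0, 0, 1])
    (hB : ∀ s ∈ O, ∀ t ∈ O, plucker φ φ' 0 1 s * plucker φ φ' 2 3 t
      - plucker φ φ' 0 2 s * plucker φ φ' 1 3 t + plucker φ φ' 0 3 s * plucker φ φ' 1 2 t
      + plucker φ φ' 1 2 s * plucker φ φ' 0 3 t - plucker φ φ' 1 3 s * plucker φ φ' 0 2 t
      + plucker φ φ' 2 3 s * plucker φ φ' 0 1 t = c * (s - t) ^ 4 * H s * H t) :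
    ∃ c₁ c₂ k α β γ ε : ℝ, c₁ ≠ 0 ∧ c₂ ≠ 0 ∧ k ≠ 0 ∧ α ≠ 0 ∧ α * ε = -4 * (c₁ * c₂) ∧
      (∀ t ∈ O, plucker φ φ' 2 3 t = H t * (c₁ * (t - a) ^ 4)) ∧
      (∀ t ∈ O, plucker φ φ' 0 1 t = H t * (c₂ * (t - b) ^ 4)) ∧
      (∀ t ∈ O, plucker φ φ' 1 3 t = H t * ((t - a) * (t - b) *
        (0 * (t - a) ^ 2 + k * ((t - a) * (t - b)) + 0 * (t - b) ^ 2))) ∧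
      (∀ t ∈ O, plucker φ φ' 1 2 t = H t * ((t - a) * (t - b) *
        (α * (t - a) ^ 2 + β * ((t - a) * (t - b)) + 0 * (t - b) ^ 2))) ∧
      (∀ t ∈ O, plucker φ φ' 0 3 t = H t * ((t - a) * (t - b) *
        (0 * (t - a) ^ 2 + γ * ((t - a) * (t - b)) + ε * (t - b) ^ 2))) := by
  have hab' : a - b ≠ 0 := sub_ne_zero.2 hab
  have hpa : ∀ i j, plucker φ φ' i j a = (![1, 0, 0, 0] : Fin 4 → ℝ) i *
      (![0, 1, 0, 0] : Fin 4 → ℝ) j - (![1, 0, 0, 0] : Fin 4 → ℝ) j *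
      (![0, 1, 0, 0] : Fin 4 → ℝ) i := fun i j => by simp [plucker, ha0, ha1]
  have hpb : ∀ i j, plucker φ φ' i j b = (![0, 0, 1, 0] : Fin 4 → ℝ) i *
      (![0, 0, 0, 1] : Fin 4 → ℝ) j - (![0, 0, 1, 0] : Fin 4 → ℝ) j *
      (![0, 0, 0, 1] : Fin 4 → ℝ) i := fun i j => by simp [plucker, hb0, hb1]
  have h23 : ∀ t ∈ O, plucker φ φ' 2 3 t = H t * (c * H a * (t - a) ^ 4) := by
    intro t ht
    have := hB a ha t ht
    simp [hpa] at this
    rw [this]; ring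
  have h01 : ∀ t ∈ O, plucker φ φ' 0 1 t = H t * (c * H b * (t - b) ^ 4) := by
    intro t ht
    have := hB b hb t ht
    simp [hpb] at this
    rw [this]; ring
  have hc1 : c * H a * H b * (a - b) ^ 4 = 1 := by
    have := h23 b hb
    simp [hpb] at this
    rw [this]; ring
  set c₁ := c * H a with hc₁
  set c₂ := c * H b with hc₂
  have hc₁0 : c₁ ≠ 0 := by
    intro h; rw [h] at hc1; simp at hc1
  have hc₂0 : c₂ ≠ 0 := by
    intro h
    have : c₂ * H a * (a - b) ^ 4 = 1 := by rw [hc₂, ← hc1]; ring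
    rw [h] at this; simp at this
  have hcc : c = c₁ * c₂ * (a - b) ^ 4 := by
    rw [hc₁, hc₂]; linear_combination (-c) * hc1
  set c' := c₁ * c₂ with hc'
  have hc'0 : c' ≠ 0 := mul_ne_zero hc₁0 hc₂0
  -- `J` is the polar form of `-p₀₂ p₁₃ + p₀₃ p₁₂`. By `hcc`, the function `c (s - t)⁴` is
  -- `c' (X_s Y_t - X_t Y_s)⁴`, whose extreme terms are accounted for by `p₀₁` and `p₂₃`; the other
  -- terms, divided by `X_s Y_s X_t Y_t`, are the form `D` on `(X², XY, Y²)`.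
  set J : Matrix (Fin 4) (Fin 4) ℝ := !![0, -1, 0, 0; -1, 0, 0, 0; 0, 0, 0, 1; 0, 0, 1, 0]
    with hJ
  set D : Matrix (Fin 3) (Fin 3) ℝ := !![0, 0, -4 * c'; 0, 6 * c', 0; -4 * c', 0, 0] with hD
  let S : Set ℝ := (O \ {a}) \ {b}
  have hSinf : S.Infinite :=
    ((hO.infinite_of_mem ha).sdiff (Set.finite_singleton a)).sdiff (Set.finite_singleton b)
  obtain ⟨p, hpinj, hpS⟩ := exists_injective_mem hSinf 3
  let z : ℝ → Fin 3 → ℝ := fun t => ![(t - a) ^ 2, (t - a) * (t - b), (t - b) ^ 2]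
  obtain ⟨u, hu⟩ : ∃ u : ℝ → ℝ, ∀ t, u t = (H t * (t - a) * (t - b))⁻¹ := ⟨_, fun _ => rfl⟩
  let θ : ℝ → Fin 4 → ℝ := fun t => u t • ![plucker φ φ' 0 2 t,
    plucker φ φ' 1 3 t, plucker φ φ' 0 3 t, plucker φ φ' 1 2 t]
  have hnz : ∀ t ∈ S, H t * (t - a) * (t - b) ≠ 0 := fun t ht =>
    mul_ne_zero (mul_ne_zero (hH t ht.1.1) (sub_ne_zero.2 ht.1.2)) (sub_ne_zero.2 ht.2)
  obtain ⟨W, hW, hWD⟩ := exists_linear_of_gram (r := 3) (J := J) (D := D) (S := S) (θ := θ)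
    (z := z) (by ext i j; fin_cases i <;> fin_cases j <;> rfl)
    (by rw [hJ]; simp [Matrix.det_succ_row_zero, Fin.sum_univ_succ, Fin.succAbove])
    (by
      rw [hD, Matrix.det_fin_three]
      simpa using hc'0)
    (by
      intro s hs t ht
      have h1 := hnz s hs
      have h2 := hnz t ht
      have h3 := hB s hs.1.1 t ht.1.1
      rw [h23 s hs.1.1, h23 t ht.1.1, h01 s hs.1.1, h01 t ht.1.1] at h3
      apply mul_left_cancel₀ (mul_ne_zero h1 h2)
      have h4 : (H s * (s - a) * (s - b)) * (H t * (t - a) * (t - b)) *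
          (θ s ⬝ᵥ J.mulVec (θ t)) = - plucker φ φ' 0 2 s * plucker φ φ' 1 3 t
          + plucker φ φ' 0 3 s * plucker φ φ' 1 2 t
          + plucker φ φ' 1 2 s * plucker φ φ' 0 3 t - plucker φ φ' 1 3 s * plucker φ φ' 0 2 t := by
        have e1 : H s * (s - a) * (s - b) * u s = 1 := by rw [hu]; exact mul_inv_cancel₀ h1
        have e2 : H t * (t - a) * (t - b) * u t = 1 := by rw [hu]; exact mul_inv_cancel₀ h2
        simp only [θ, hJ, Matrix.mulVec_smul, dotProduct_smul, smul_dotProduct, smul_eq_mul]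
        simp only [Matrix.mulVec, dotProduct, Fin.sum_univ_succ, Matrix.of_apply,
          Matrix.cons_val', Matrix.cons_val_zero, Matrix.cons_val_succ, Finset.univ_eq_empty,
          Finset.sum_empty, Matrix.cons_val_fin_one]
        generalize H s * (s - a) * (s - b) = m at e1
        generalize H t * (t - a) * (t - b) = m' at e2
        simp
        linear_combination (m' * u t * (-plucker φ φ' 0 2 s * plucker φ φ' 1 3 t +
          plucker φ φ' 0 3 s * plucker φ φ' 1 2 t + plucker φ φ' 1 2 s * plucker φ φ' 0 3 t -
          plucker φ φ' 1 3 s * plucker φ φ' 0 2 t)) * e1 + (-plucker φ φ' 0 2 s *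
          plucker φ φ' 1 3 t +
          plucker φ φ' 0 3 s * plucker φ φ' 1 2 t + plucker φ φ' 1 2 s * plucker φ φ' 0 3 t -
          plucker φ φ' 1 3 s * plucker φ φ' 0 2 t) * e2
      rw [h4]
      have h5 : z s ⬝ᵥ D.mulVec (z t) = c' * (-4 * (s - a) ^ 2 * (t - b) ^ 2 +
          6 * ((s - a) * (s - b)) * ((t - a) * (t - b)) - 4 * (s - b) ^ 2 * (t - a) ^ 2) := by
        simp [z, hD, Matrix.mulVec, dotProduct, Fin.sum_univ_succ]
        ring
      rw [h5]
      rw [hcc] at h3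
      linear_combination h3)
    (p := p) hpS (by
      have h1 : p 0 ≠ p 1 := fun h => absurd (hpinj h) (by decide)
      have h2 : p 0 ≠ p 2 := fun h => absurd (hpinj h) (by decide)
      have h3 : p 1 ≠ p 2 := fun h => absurd (hpinj h) (by decide)
      have : (Matrix.of fun i => z (p i)).det =
          (a - b) ^ 3 * ((p 0 - p 1) * (p 0 - p 2) * (p 1 - p 2)) := by
        rw [Matrix.det_fin_three]
        simp [z]
        ring
      rw [this]
      exact mul_ne_zero (pow_ne_zero _ hab') (mul_ne_zero (mul_ne_zero (sub_ne_zero.2 h1)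
        (sub_ne_zero.2 h2)) (sub_ne_zero.2 h3)))
  have hform : ∀ (i j : Fin 4) (l : Fin 4), (∀ t, θ t l = u t * plucker φ φ' i j t) →
      plucker φ φ' i j a = 0 → plucker φ φ' i j b = 0 →
      ∀ t ∈ O, plucker φ φ' i j t = H t * ((t - a) * (t - b) *
        (W l 0 * (t - a) ^ 2 + W l 1 * ((t - a) * (t - b)) + W l 2 * (t - b) ^ 2)) := by
    intro i j l hl h1 h2 t ht
    by_cases hta : t = a
    · subst hta; simp [h1]
    by_cases htb : t = b
    · subst htb; simp [h2]
    have h3 := congrFun (hW t ⟨⟨ht, hta⟩, htb⟩) l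
    have h4 := hnz t ⟨⟨ht, hta⟩, htb⟩
    rw [hl, hu, inv_mul_eq_iff_eq_mul₀ h4] at h3
    rw [h3]
    simp [Matrix.mulVec, dotProduct, Fin.sum_univ_succ, z]
    ring
  have h02 := hform 0 2 0 (fun t => by simp [θ]) (by simp [hpa]) (by simp [hpb])
  have h13 := hform 1 3 1 (fun t => by simp [θ]) (by simp [hpa]) (by simp [hpb])
  have h03 := hform 0 3 2 (fun t => by simp [θ]) (by simp [hpa]) (by simp [hpb])
  have h12 := hform 1 2 3 (fun t => by simp [θ]) (by simp [hpa]) (by simp [hpb])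
  -- At `a` and at `b` only one coordinate of `φ` is nonzero, so that each of the following
  -- relations says that a derivative vanishes there.
  have d12 := plucker_deriv hO (hF 0) (hF 1) (hF 2) hH h12 h02 h01 ha
    (hasDerivAt_binary_quartic a b _ _ _ a) (hasDerivAt_binary_quartic a b _ _ _ a)
    (hasDerivAt_const_mul_pow_four b c₂ a)
  have d13 := plucker_deriv hO (hF 0) (hF 1) (hF 3) hH h13 h03 h01 ha
    (hasDerivAt_binary_quartic a b _ _ _ a) (hasDerivAt_binary_quartic a b _ _ _ a)
    (hasDerivAt_const_mul_pow_four b c₂ a)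
  have e13 := plucker_deriv hO (hF 1) (hF 2) (hF 3) hH h23 h13 h12 hb
    (hasDerivAt_const_mul_pow_four a c₁ b)
    (hasDerivAt_binary_quartic a b _ _ _ b) (hasDerivAt_binary_quartic a b _ _ _ b)
  have e03 := plucker_deriv hO (hF 0) (hF 2) (hF 3) hH h23 h03 h02 hb
    (hasDerivAt_const_mul_pow_four a c₁ b)
    (hasDerivAt_binary_quartic a b _ _ _ b) (hasDerivAt_binary_quartic a b _ _ _ b)
  have hba' : b - a ≠ 0 := sub_ne_zero.2 hab.symm
  have w32 : W 3 2 = 0 := by simpa [ha0, hab'] using d12.2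
  have w12 : W 1 2 = 0 := by simpa [ha0, hab'] using d13.2
  have w10 : W 1 0 = 0 := by simpa [hb0, hba'] using e13.2
  have w20 : W 2 0 = 0 := by simpa [hb0, hba'] using e03.2
  -- the entries of `Wᵀ J W = D`
  have hent : ∀ i j,
      -(W 0 i * W 1 j + W 1 i * W 0 j) + (W 2 i * W 3 j + W 3 i * W 2 j) = D i j := by
    intro i j
    rw [← hWD]
    simp [Matrix.mul_apply, Fin.sum_univ_succ, hJ, Matrix.transpose_apply]
    ring
  have g02 := hent 0 2
  have g01 := hent 0 1
  have g11 := hent 1 1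
  have g12 := hent 1 2
  simp [w32, w12, w10, w20, hD] at g02 g01 g11 g12
  have hα : W 3 0 ≠ 0 := by
    intro h; rw [h] at g02; simp at g02; exact hc'0 g02
  have hε : W 2 2 ≠ 0 := by
    intro h; rw [h] at g02; simp at g02; exact hc'0 g02
  have hk : W 1 1 ≠ 0 := by
    intro h
    rw [h] at g01 g12 g11
    simp [hα, hε] at g01 g12
    rw [g01] at g11
    simp at g11
    exact hc'0 g11
  refine ⟨c₁, c₂, W 1 1, W 3 0, W 3 1, W 2 1, W 2 2, hc₁0, hc₂0, hk, hα, ?_, h23, h01, ?_, ?_, ?_⟩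
  · rw [g02]; ring
  · simpa only [w10, w12] using h13
  · simpa only [w32] using h12
  · simpa only [w20] using h03

open Polynomial in
/-- The rational normal curve of degree three is characterized, up to multiplication by a scalar
function, by the pairing of its tangent planes. The pairing determines the square of that function,
and the sign condition `hS` then determines the function. -/
lemma exists_polynomial_of_plucker {O : Set ℝ} (hO : IsOpen O) {φ φ' : ℝ → Fin 4 → ℝ} {h : ℝ → ℝ}
    {c a b s₀ : ℝ} (hs₀ : s₀ ≠ 0)
    (hF : ∀ i, ∀ t ∈ O, HasDerivAt (fun t => φ t i) (φ' t i) t)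
    (hh : ∀ t ∈ O, 0 < h t) (ha : a ∈ O) (hb : b ∈ O) (hab : a ≠ b)
    (ha0 : φ a = ![1, 0, 0, 0]) (ha1 : φ' a = ![0, 1, 0, 0])
    (hb0 : φ b = ![0, 0, 1, 0]) (hb1 : φ' b = ![0, 0, 0, 1])
    (hB : ∀ s ∈ O, ∀ t ∈ O, plucker φ φ' 0 1 s * plucker φ φ' 2 3 t
      - plucker φ φ' 0 2 s * plucker φ φ' 1 3 t + plucker φ φ' 0 3 s * plucker φ φ' 1 2 t
      + plucker φ φ' 1 2 s * plucker φ φ' 0 3 t - plucker φ φ' 1 3 s * plucker φ φ' 0 2 t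
      + plucker φ φ' 2 3 s * plucker φ φ' 0 1 t = c * (s - t) ^ 4 * h s ^ 2 * h t ^ 2)
    (hS : ∀ s ∈ O, ∀ t ∈ O, 0 ≤ s₀ * (φ s 2 * φ t 3 - φ s 3 * φ t 2) * (t - s)) :
    ∃ p : Fin 4 → ℝ[X], (∀ i, (p i).degree < 4) ∧
      ∀ t ∈ (O \ {a}) \ {b}, ∀ i, φ t i = h t * (p i).eval t := by
  have hH : ∀ t ∈ O, h t ^ 2 ≠ 0 := fun t ht => pow_ne_zero _ (hh t ht).ne'
  obtain ⟨c₁, c₂, k, α, β, γ, ε, hc₁, hc₂, hk, hα, hαε, h23, h01, h13, h12, h03⟩ :=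
    exists_plucker_forms hO hF hH ha hb hab ha0 ha1 hb0 hb1 hB
  have hba : b - a ≠ 0 := sub_ne_zero.2 hab.symm
  -- the linear relations between the coordinates
  have key : ∀ t ∈ (O \ {a}) \ {b}, 2 * k * (t - b) * φ t 2 =
      (α * (t - a) + 2 * β * (t - b)) * φ t 3 ∧
      2 * c₁ * (t - a) * φ t 1 = -(α * (t - b)) * φ t 3 ∧
      2 * k * (t - a) * φ t 0 = (2 * γ * (t - a) + ε * (t - b)) * φ t 1 := by
    intro t ht
    have hX : t - a ≠ 0 := sub_ne_zero.2 ht.1.2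
    have hY : t - b ≠ 0 := sub_ne_zero.2 ht.2
    obtain ⟨E1, E1'⟩ := plucker_deriv hO (hF 1) (hF 2) (hF 3) hH h23 h13 h12 ht.1.1
      (hasDerivAt_const_mul_pow_four a c₁ t)
      (hasDerivAt_binary_quartic a b _ _ _ t) (hasDerivAt_binary_quartic a b _ _ _ t)
    obtain ⟨E3, -⟩ := plucker_deriv hO (hF 0) (hF 1) (hF 3) hH h13 h03 h01 ht.1.1
      (hasDerivAt_binary_quartic a b _ _ _ t) (hasDerivAt_binary_quartic a b _ _ _ t)
      (hasDerivAt_const_mul_pow_four b c₂ t)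
    have hI : 2 * k * (t - b) * φ t 2 = (α * (t - a) + 2 * β * (t - b)) * φ t 3 := by
      apply mul_left_cancel₀ (mul_ne_zero (pow_ne_zero 2 hX) hba)
      linear_combination 4 * E1 - (t - a) * E1'
    have hII : 2 * c₁ * (t - a) * φ t 1 = -(α * (t - b)) * φ t 3 := by
      apply mul_left_cancel₀ (pow_ne_zero 3 hX)
      linear_combination 2 * E1 + (t - a) ^ 2 * (t - b) * hI
    refine ⟨hI, hII, ?_⟩
    apply mul_left_cancel₀ (mul_ne_zero (mul_ne_zero hα hX) (pow_ne_zero 2 hY))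
    linear_combination 2 * α * E3 - 2 * c₂ * (t - b) ^ 3 * hII +
      (t - a) * (t - b) ^ 3 * φ t 1 * hαε
  -- `N` solves the three linear relations of `key`, so that `φ` is a multiple of it at each point.
  let N : Fin 4 → ℝ[X] := ![
    C (-(α / (2 * k))) * (C 2 * C γ * (X - C a) * (X - C b) ^ 2 + C ε * (X - C b) ^ 3),
    C (-α) * ((X - C a) * (X - C b) ^ 2),
    C (c₁ / k) * (C α * (X - C a) ^ 3 + C 2 * C β * (X - C a) ^ 2 * (X - C b)),
    C (2 * c₁) * ((X - C a) ^ 2 * (X - C b))]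
  have hNdeg : ∀ i, (N i).degree < 4 := by
    intro i
    have : (N i).natDegree ≤ 3 := by
      fin_cases i
      · change (C (-(α / (2 * k))) * (C 2 * C γ * (X - C a) * (X - C b) ^ 2 +
          C ε * (X - C b) ^ 3)).natDegree ≤ 3
        compute_degree
      · change (C (-α) * ((X - C a) * (X - C b) ^ 2)).natDegree ≤ 3
        compute_degree
      · change (C (c₁ / k) * (C α * (X - C a) ^ 3 +
          C 2 * C β * (X - C a) ^ 2 * (X - C b))).natDegree ≤ 3
        compute_degree
      · change (C (2 * c₁) * ((X - C a) ^ 2 * (X - C b))).natDegree ≤ 3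
        compute_degree
    exact (natDegree_le_iff_degree_le.1 this).trans_lt (by norm_num)
  set l : ℝ → ℝ := fun t => φ t 3 / (2 * c₁ * (t - a) ^ 2 * (t - b)) with hl
  have hφ3 : ∀ t ∈ (O \ {a}) \ {b}, φ t 3 = l t * (2 * c₁ * (t - a) ^ 2 * (t - b)) := by
    intro t ht
    have hX : t - a ≠ 0 := sub_ne_zero.2 ht.1.2
    have hY : t - b ≠ 0 := sub_ne_zero.2 ht.2
    rw [hl]
    field_simp
  have hφ2 : ∀ t ∈ (O \ {a}) \ {b}, φ t 2 =
      l t * (c₁ / k * (α * (t - a) ^ 3 + 2 * β * (t - a) ^ 2 * (t - b))) := by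
    intro t ht
    have hY : t - b ≠ 0 := sub_ne_zero.2 ht.2
    have h1 := (key t ht).1
    rw [hφ3 t ht] at h1
    apply mul_left_cancel₀ (mul_ne_zero (mul_ne_zero two_ne_zero hk) hY)
    rw [h1]
    field_simp
  have hφ1 : ∀ t ∈ (O \ {a}) \ {b}, φ t 1 = l t * (-α * ((t - a) * (t - b) ^ 2)) := by
    intro t ht
    have hX : t - a ≠ 0 := sub_ne_zero.2 ht.1.2
    have h1 := (key t ht).2.1
    rw [hφ3 t ht] at h1
    apply mul_left_cancel₀ (mul_ne_zero (mul_ne_zero two_ne_zero hc₁) hX)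
    rw [h1]
    ring
  have hφ0 : ∀ t ∈ (O \ {a}) \ {b}, φ t 0 = l t * (-(α / (2 * k)) *
      (2 * γ * (t - a) * (t - b) ^ 2 + ε * (t - b) ^ 3)) := by
    intro t ht
    have hX : t - a ≠ 0 := sub_ne_zero.2 ht.1.2
    have h1 := (key t ht).2.2
    rw [hφ1 t ht] at h1
    apply mul_left_cancel₀ (mul_ne_zero (mul_ne_zero two_ne_zero hk) hX)
    rw [h1]
    field_simp
  have hφN : ∀ t ∈ (O \ {a}) \ {b}, ∀ i, φ t i = l t * (N i).eval t := by
    intro t ht i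
    fin_cases i
    · simpa [N] using hφ0 t ht
    · simpa [N] using hφ1 t ht
    · simpa [N] using hφ2 t ht
    · simpa [N, mul_assoc] using hφ3 t ht
  -- the scalar function is determined up to sign
  set κ : ℝ := 2 * α * c₁ * (b - a) / k with hκ
  -- by the value of the Plücker coordinate `p₂₃`
  have hlsq : ∀ t ∈ (O \ {a}) \ {b}, l t ^ 2 * κ = h t ^ 2 := by
    intro t ht
    have hX : t - a ≠ 0 := sub_ne_zero.2 ht.1.2
    have hY : t - b ≠ 0 := sub_ne_zero.2 ht.2
    have hSo : IsOpen ((O \ {a}) \ {b}) :=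
      (hO.sdiff isClosed_singleton).sdiff isClosed_singleton
    have hdl : HasDerivAt (fun t => (N 2).eval t * φ t 3 - (N 3).eval t * φ t 2) 0 t := by
      refine (hasDerivAt_const t (0 : ℝ)).congr_of_eventuallyEq ?_
      filter_upwards [hSo.mem_nhds ht] with s hs
      rw [hφN s hs 2, hφN s hs 3]
      ring
    have hd2 := (((N 2).hasDerivAt t).mul (hF 3 t ht.1.1)).sub
      (((N 3).hasDerivAt t).mul (hF 2 t ht.1.1))
    have h1 := hd2.unique hdl
    have h2 := h23 t ht.1.1
    have h3 : l t * l t * ((N 2).eval t * (derivative (N 3)).eval t -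
        (derivative (N 2)).eval t * (N 3).eval t) = h t ^ 2 * (c₁ * (t - a) ^ 4) := by
      rw [← h2, plucker, hφN t ht 2, hφN t ht 3]
      rw [hφN t ht 2, hφN t ht 3] at h1
      linear_combination (-l t) * h1
    have h4 : (N 2).eval t * (derivative (N 3)).eval t -
        (derivative (N 2)).eval t * (N 3).eval t = c₁ * κ * (t - a) ^ 4 := by
      simp [N, derivative_pow]
      rw [hκ]
      field_simp
      ring
    rw [h4] at h3
    apply mul_left_cancel₀ (mul_ne_zero hc₁ (pow_ne_zero 4 hX))
    linear_combination h3
  have hl0 : ∀ t ∈ (O \ {a}) \ {b}, l t ≠ 0 := by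
    intro t ht h0
    have := hlsq t ht
    rw [h0] at this
    have h1 := hh t ht.1.1
    nlinarith [pow_pos h1 2]
  have hκ0 : κ ≠ 0 :=
    div_ne_zero (mul_ne_zero (mul_ne_zero (mul_ne_zero two_ne_zero hα) hc₁) hba) hk
  have hsgn : ∀ s ∈ (O \ {a}) \ {b}, ∀ t ∈ (O \ {a}) \ {b}, s ≠ t →
      0 < s₀ * κ * c₁ * (l s * l t) := by
    intro s hs t ht hst
    have h1 := hS s hs.1.1 t ht.1.1
    have e : s₀ * (φ s 2 * φ t 3 - φ s 3 * φ t 2) * (t - s) =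
        (s₀ * κ * c₁ * (l s * l t)) * ((s - a) ^ 2 * (t - a) ^ 2 * (t - s) ^ 2) := by
      rw [hφ2 s hs, hφ3 s hs, hφ2 t ht, hφ3 t ht, hκ]
      field_simp
      ring
    rw [e] at h1
    have h2 : 0 < (s - a) ^ 2 * (t - a) ^ 2 * (t - s) ^ 2 :=
      mul_pos (mul_pos (sq_pos_of_ne_zero (sub_ne_zero.2 hs.1.2))
        (sq_pos_of_ne_zero (sub_ne_zero.2 ht.1.2))) (sq_pos_of_ne_zero (sub_ne_zero.2 hst.symm))
    refine lt_of_le_of_ne (nonneg_of_mul_nonneg_left h1 h2) (Ne.symm ?_)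
    exact mul_ne_zero (mul_ne_zero (mul_ne_zero hs₀ hκ0) hc₁) (mul_ne_zero (hl0 s hs) (hl0 t ht))
  have hSinf : ((O \ {a}) \ {b}).Infinite :=
    ((hO.infinite_of_mem ha).sdiff (Set.finite_singleton a)).sdiff (Set.finite_singleton b)
  obtain ⟨q, hq, hqS⟩ := exists_injective_mem hSinf 3
  -- the product of the three sign relations is `τ³` times a square
  have hτ : 0 < s₀ * κ * c₁ := by
    have h1 := hsgn _ (hqS 0) _ (hqS 1) (fun h => absurd (hq h) (by decide))
    have h2 := hsgn _ (hqS 0) _ (hqS 2) (fun h => absurd (hq h) (by decide))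
    have h3 := hsgn _ (hqS 1) _ (hqS 2) (fun h => absurd (hq h) (by decide))
    have h4 : 0 < (s₀ * κ * c₁) ^ 3 * (l (q 0) * l (q 1) * l (q 2)) ^ 2 := by
      have := mul_pos (mul_pos h1 h2) h3
      linarith [this, (by ring : s₀ * κ * c₁ * (l (q 0) * l (q 1)) *
        (s₀ * κ * c₁ * (l (q 0) * l (q 2))) * (s₀ * κ * c₁ * (l (q 1) * l (q 2))) =
        (s₀ * κ * c₁) ^ 3 * (l (q 0) * l (q 1) * l (q 2)) ^ 2)]
    have h5 := pos_of_mul_pos_left h4 (sq_nonneg _)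
    exact (Odd.pow_pos_iff (by decide)).1 h5
  set μ : ℝ := l (q 0) / h (q 0) with hμ
  have hq0 := hh _ (hqS 0).1.1
  have hlμ : ∀ t ∈ (O \ {a}) \ {b}, l t = μ * h t := by
    intro t ht
    by_cases htq : t = q 0
    · rw [htq, hμ, div_mul_cancel₀ _ hq0.ne']
    have h1 := hsgn t ht _ (hqS 0) htq
    have h2 : 0 < l t * l (q 0) := pos_of_mul_pos_right h1 hτ.le
    have h3 := hlsq t ht
    have h4 := hlsq _ (hqS 0)
    have ht0 := hh t ht.1.1
    have h5 : (l t * h (q 0) - l (q 0) * h t) * (l t * h (q 0) + l (q 0) * h t) = 0 := by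
      apply mul_left_cancel₀ hκ0
      linear_combination h (q 0) ^ 2 * h3 - h t ^ 2 * h4
    have h6 : l t * h (q 0) + l (q 0) * h t ≠ 0 := by
      intro h0
      have h7 : l t * h (q 0) * (l (q 0) * h t) = -(l (q 0) * h t) ^ 2 := by
        rw [eq_neg_of_add_eq_zero_left h0]; ring
      have h8 : 0 < l t * l (q 0) * (h (q 0) * h t) := mul_pos h2 (mul_pos hq0 ht0)
      nlinarith [sq_nonneg (l (q 0) * h t)]
    have h9 := (mul_eq_zero.1 h5).resolve_right h6
    rw [hμ]
    field_simp
    linarith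
  refine ⟨fun i => μ • N i, fun i => ?_, fun t ht i => ?_⟩
  · exact (degree_smul_le μ (N i)).trans_lt (hNdeg i)
  · rw [hφN t ht i, hlμ t ht, eval_smul, smul_eq_mul]
    ring

/-! ### From doubled points to distinct points -/

open Polynomial in
/-- A curve of the form `h(t) p(t)`, with `p` polynomial of degree less than the dimension, has
Vandermonde determinants. -/
lemma exists_rowDet_eq_of_polynomial {k : ℕ} {S : Set ℝ} {F : ℝ → Fin k → ℝ} {h : ℝ → ℝ}
    (hp : ∀ ξ : (Fin k → ℝ) →ₗ[ℝ] ℝ, ∃ p ∈ degreeLT ℝ k, ∀ t ∈ S, ξ (F t) = h t * p.eval t) :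
    ∃ c : ℝ, ∀ y : Fin k → ℝ, (∀ i, y i ∈ S) →
      rowDet (fun i => F (y i)) = c * vdm y * ∏ i, h (y i) := by
  choose p hpd hpe using fun i : Fin k => hp (LinearMap.proj i)
  refine ⟨(Matrix.of fun i j : Fin k => (p j).coeff i).det, fun y hy => ?_⟩
  have h1 : Matrix.of (fun i => F (y i)) = Matrix.of (fun i j : Fin k => h (y i) *
      (Matrix.vandermonde y * Matrix.of fun i j : Fin k => (p j).coeff i) i j) := by
    ext i j
    have h2 := hpe j (y i) (hy i)
    simp only [LinearMap.coe_proj, Function.eval] at h2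
    simp only [Matrix.of_apply, Matrix.mul_apply, Matrix.vandermonde_apply]
    rw [h2]
    have h3 : (p j).natDegree < k := by
      by_cases hz : p j = 0
      · rw [hz, natDegree_zero]
        exact i.pos
      · exact (natDegree_lt_iff_degree_lt hz).2 (mem_degreeLT.1 (hpd j))
    rw [eval_eq_sum_range' h3, ← Fin.sum_univ_eq_sum_range (fun l => (p j).coeff l * y i ^ l)]
    congr 1
    exact Finset.sum_congr rfl fun l _ => mul_comm _ _
  rw [rowDet, h1, Matrix.det_mul_column, Matrix.det_mul, det_vandermonde_eq_vdm]
  ring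

lemma rowDet_eq_mul_of_basis {k : ℕ} (b : Module.Basis (Fin k) ℝ (Fin k → ℝ))
    (v : Fin k → Fin k → ℝ) :
    rowDet v = rowDet (fun i => b.equivFun (v i)) * rowDet b := by
  rw [rowDet, rowDet, rowDet, ← Matrix.det_mul]
  congr 1
  ext i j
  have := congrFun (b.sum_equivFun (v i)) j
  simpa [Matrix.mul_apply] using this.symm

lemma exists_basis_of_rowDet_ne_zero {k : ℕ} {e : Fin k → Fin k → ℝ} (he : rowDet e ≠ 0) :
    ∃ b : Module.Basis (Fin k) ℝ (Fin k → ℝ), ∀ i, b i = e i := by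
  have hli : LinearIndependent ℝ e := Matrix.linearIndependent_rows_of_det_ne_zero he
  exact ⟨basisOfLinearIndependentOfCardEqFinrank' _ hli (by simp), fun i => by simp⟩

lemma rowDet_four (u v w x : Fin 4 → ℝ) : rowDet ![u, v, w, x] =
    (u 0 * v 1 - u 1 * v 0) * (w 2 * x 3 - w 3 * x 2)
    - (u 0 * v 2 - u 2 * v 0) * (w 1 * x 3 - w 3 * x 1)
    + (u 0 * v 3 - u 3 * v 0) * (w 1 * x 2 - w 2 * x 1)
    + (u 1 * v 2 - u 2 * v 1) * (w 0 * x 3 - w 3 * x 0)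
    - (u 1 * v 3 - u 3 * v 1) * (w 0 * x 2 - w 2 * x 0)
    + (u 2 * v 3 - u 3 * v 2) * (w 0 * x 1 - w 1 * x 0) := by
  simp [rowDet, Matrix.det_succ_row_zero, Fin.sum_univ_succ, Fin.succAbove]
  ring

lemma vdm_pair (s t : ℝ) : vdm ![s, t] = t - s := by
  rw [← det_vandermonde_eq_vdm, Matrix.det_fin_two]
  simp [Matrix.vandermonde_apply]

open Polynomial in
/-- The four-dimensional case of `exists_polynomial_of_doubled`. -/
lemma exists_polynomial_of_doubled_two {O : Set ℝ} (hO : IsOpen O) (hne : O.Nonempty)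
    {F F' : ℝ → Fin (2 * 2) → ℝ} {h : ℝ → ℝ} {c s₀ : ℝ} (hc : c ≠ 0) (hs₀ : s₀ ≠ 0)
    (hF : ∀ t ∈ O, HasDerivAt F (F' t) t) (hh : ∀ t ∈ O, 0 < h t)
    (hB : ∀ t : Fin 2 → ℝ, (∀ i, t i ∈ O) →
      rowDet (doubled F F' t) = c * vdm t ^ 4 * ∏ i, h (t i) ^ 2)
    (hS : ∀ y : Fin (2 * 2) → ℝ, (∀ i, y i ∈ O) → 0 ≤ s₀ * rowDet (fun i => F (y i)) * vdm y) :
    ∃ Z : Set ℝ, Z.Finite ∧ ∀ ξ : (Fin (2 * 2) → ℝ) →ₗ[ℝ] ℝ, ∃ p ∈ degreeLT ℝ (2 * 2),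
      ∀ t ∈ O \ Z, ξ (F t) = h t * p.eval t := by
  obtain ⟨q, hq, hqO⟩ := exists_injective_mem (hO.infinite_of_mem hne.some_mem) 2
  set a := q 0 with ha
  set b := q 1 with hb
  have hab : a ≠ b := fun h => absurd (hq h) (by decide)
  have haO : a ∈ O := hqO 0
  have hbO : b ∈ O := hqO 1
  have hdbl : ∀ (E : Type) (G G' : ℝ → E) (s t : ℝ),
      doubled G G' ![s, t] = ![G s, G' s, G t, G' t] := by
    intro E G G' s t
    funext i
    fin_cases i <;> rfl
  have hpair : ∀ s ∈ O, ∀ t ∈ O, ∀ i, (![s, t] : Fin 2 → ℝ) i ∈ O := by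
    intro s hs t ht i
    fin_cases i <;> simpa
  have he : rowDet (doubled F F' ![a, b]) ≠ 0 := by
    rw [hB _ (hpair a haO b hbO), vdm_pair]
    refine mul_ne_zero (mul_ne_zero hc (pow_ne_zero _ (sub_ne_zero.2 hab.symm))) ?_
    exact Finset.prod_ne_zero_iff.2 fun i _ => pow_ne_zero _ (hh _ (hpair a haO b hbO i)).ne'
  obtain ⟨B, hBe⟩ := exists_basis_of_rowDet_ne_zero he
  have hB0 : rowDet B ≠ 0 := by
    have : (B : Fin (2 * 2) → Fin (2 * 2) → ℝ) = doubled F F' ![a, b] := funext hBe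
    rwa [this]
  let φ : ℝ → Fin 4 → ℝ := fun t => B.equivFun (F t)
  let φ' : ℝ → Fin 4 → ℝ := fun t => B.equivFun (F' t)
  have hφ : ∀ t ∈ O, HasDerivAt φ (φ' t) t := fun t ht =>
    (hF t ht).linearMap_comp (B.equivFun : (Fin (2 * 2) → ℝ) →ₗ[ℝ] (Fin (2 * 2) → ℝ))
  have hself : ∀ i : Fin 4, B.equivFun (![F a, F' a, F b, F' b] i) = Pi.single i 1 := by
    intro i
    rw [← hdbl, ← hBe]
    funext j
    rw [Module.Basis.equivFun_self]
    simp [Pi.single_apply, eq_comm]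
  have hφa : φ a = ![1, 0, 0, 0] :=
    (hself 0).trans (by funext j; fin_cases j <;> rfl)
  have hφa' : φ' a = ![0, 1, 0, 0] :=
    (hself 1).trans (by funext j; fin_cases j <;> rfl)
  have hφb : φ b = ![0, 0, 1, 0] :=
    (hself 2).trans (by funext j; fin_cases j <;> rfl)
  have hφb' : φ' b = ![0, 0, 0, 1] :=
    (hself 3).trans (by funext j; fin_cases j <;> rfl)
  have hBφ : ∀ s ∈ O, ∀ t ∈ O, rowDet ![φ s, φ' s, φ t, φ' t] =
      (c / rowDet B) * (s - t) ^ 4 * h s ^ 2 * h t ^ 2 := by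
    intro s hs t ht
    have h1 := hB _ (hpair s hs t ht)
    rw [rowDet_eq_mul_of_basis B, vdm_pair] at h1
    have h2 : (fun i => B.equivFun (doubled F F' ![s, t] i)) = ![φ s, φ' s, φ t, φ' t] := by
      rw [hdbl]
      funext i
      fin_cases i <;> rfl
    rw [h2] at h1
    simp only [Fin.prod_univ_two, Matrix.cons_val_zero, Matrix.cons_val_one] at h1
    field_simp
    linear_combination h1
  obtain ⟨p, hpd, hpe⟩ := exists_polynomial_of_plucker (φ := φ) (φ' := φ') (h := h)
    (c := c / rowDet B) (s₀ := s₀ * rowDet B) hO (mul_ne_zero hs₀ hB0)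
    (fun i t ht => hasDerivAt_pi.1 (hφ t ht) i) hh haO hbO hab
    hφa hφa' hφb hφb'
    (by
      intro s hs t ht
      rw [← hBφ s hs t ht, rowDet_four]
      rfl)
    (by
      intro s hs t ht
      have h1 := rowDet_merge_sign (k := 2) (F := φ) (F' := φ') (s := s₀ * rowDet B) hO hφ
        (fun y hy => by
          have := hS y hy
          rw [rowDet_eq_mul_of_basis B] at this
          rw [mul_assoc s₀, mul_comm (rowDet B)]
          exact this) haO (hpair s hs t ht)
      rw [vdm_pair] at h1
      refine h1.trans_eq ?_
      congr 2
      have h4 : (Fin.cons (φ a) (Fin.cons (φ' a) (fun i => φ ((![s, t] : Fin 2 → ℝ) i)) :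
          Fin (2 + 1) → Fin 4 → ℝ) : Fin (2 + 1 + 1) → Fin 4 → ℝ) =
          ![φ a, φ' a, φ s, φ t] := by
        funext i
        fin_cases i <;> rfl
      refine (congrArg rowDet h4).trans ?_
      rw [rowDet_four, hφa, hφa']
      simp)
  refine ⟨{a, b}, by simp, fun ξ => ⟨∑ i : Fin 4, ξ (B i) • p i, ?_, fun t ht => ?_⟩⟩
  · refine Submodule.sum_mem _ fun i _ => Submodule.smul_mem _ _ ?_
    rw [mem_degreeLT]
    exact hpd i
  · have h1 : ξ (F t) = ∑ i : Fin 4, φ t i * ξ (B i) := by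
      conv_lhs => rw [← B.sum_equivFun (F t)]
      rw [map_sum]
      exact Finset.sum_congr rfl fun i _ => by rw [map_smul, smul_eq_mul]
    rw [h1, eval_finsetSum, Finset.mul_sum]
    refine Finset.sum_congr rfl fun i _ => ?_
    rw [hpe t (by
      have := ht.2
      simp only [Set.mem_insert_iff, Set.mem_singleton_iff, not_or] at this
      exact ⟨⟨ht.1, this.1⟩, this.2⟩) i, eval_smul, smul_eq_mul]
    ring

open Polynomial in
/-- A curve whose doubled determinants are those of the rational normal curve, weighted by `h`, is
`h` times a polynomial curve of degree less than the dimension, away from finitely many points.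

In the induction step, the functionals vanishing on `F(a), F'(a)` are treated by dividing these two
vectors out, which multiplies `h` by `(t - a)²`; for two points `a ≠ b` such functionals span. -/
theorem exists_polynomial_of_doubled {n : ℕ} (hn : 2 ≤ n) {O : Set ℝ} (hO : IsOpen O)
    (hne : O.Nonempty) {F F' : ℝ → Fin (2 * n) → ℝ} {h : ℝ → ℝ} {c s₀ : ℝ} (hc : c ≠ 0)
    (hs₀ : s₀ ≠ 0) (hF : ∀ t ∈ O, HasDerivAt F (F' t) t) (hh : ∀ t ∈ O, 0 < h t)
    (hB : ∀ t : Fin n → ℝ, (∀ i, t i ∈ O) →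
      rowDet (doubled F F' t) = c * vdm t ^ 4 * ∏ i, h (t i) ^ 2)
    (hS : ∀ y : Fin (2 * n) → ℝ, (∀ i, y i ∈ O) → 0 ≤ s₀ * rowDet (fun i => F (y i)) * vdm y) :
    ∃ Z : Set ℝ, Z.Finite ∧ ∀ ξ : (Fin (2 * n) → ℝ) →ₗ[ℝ] ℝ, ∃ p ∈ degreeLT ℝ (2 * n),
      ∀ t ∈ O \ Z, ξ (F t) = h t * p.eval t := by
  induction n, hn using Nat.le_induction generalizing O h c s₀ with
  | base => exact exists_polynomial_of_doubled_two hO hne hc hs₀ hF hh hB hS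
  | succ n hn ih =>
    have hOinf := hO.infinite_of_mem hne.some_mem
    have step : ∀ a ∈ O, ∃ Z : Set ℝ, Z.Finite ∧ ∀ ξ : (Fin (2 * n + 2) → ℝ) →ₗ[ℝ] ℝ,
        ξ (F a) = 0 → ξ (F' a) = 0 → ∃ p ∈ degreeLT ℝ (2 * n + 2),
          ∀ t ∈ O \ Z, ξ (F t) = h t * p.eval t := by
      intro a ha
      obtain ⟨q, hq, hqO⟩ := exists_injective_mem (hOinf.sdiff (Set.finite_singleton a)) n
      have hv : ∃ v : Fin (2 * n) → Fin (2 * n + 2) → ℝ, rowDet (Fin.cons (F a)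
          (Fin.cons (F' a) v : Fin (2 * n + 1) → _) : Fin (2 * n + 1 + 1) → _) ≠ 0 := by
        refine ⟨doubled F F' q, ?_⟩
        have hmem : ∀ i, (Fin.cons a q : Fin (n + 1) → ℝ) i ∈ O := by
          intro i
          induction i using Fin.cases with
          | zero => simpa
          | succ i => simpa using (hqO i).1
        have h1 := hB (Fin.cons a q : Fin (n + 1) → ℝ) hmem
        rw [doubled_cons] at h1
        refine fun h0 => ?_
        have h2 := h1.symm.trans h0
        refine mul_ne_zero (mul_ne_zero hc (pow_ne_zero _ ?_))
          (Finset.prod_ne_zero_iff.2 fun i _ => pow_ne_zero _ (hh _ (hmem i)).ne') h2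
        rw [vdm_ne_zero_iff, Fin.cons_injective_iff]
        exact ⟨fun ⟨i, hi⟩ => (hqO i).2 hi, hq⟩
      obtain ⟨L, κ, hκ, hLa, hLa', hd, hfac⟩ := exists_reduction₂ (k := 2 * n) (F a) (F' a) hv
      obtain ⟨Z, hZ, hZp⟩ := @ih (O \ {a}) (hO.sdiff isClosed_singleton)
        (hOinf.sdiff (Set.finite_singleton a)).nonempty (fun x => L (F x)) (fun x => L (F' x))
        (fun x => (x - a) ^ 2 * h x) (κ⁻¹ * (c * h a ^ 2)) (s₀ * κ)
        (mul_ne_zero (inv_ne_zero hκ) (mul_ne_zero hc (pow_ne_zero _ (hh a ha).ne')))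
        (mul_ne_zero hs₀ hκ) (fun t ht => (hF t ht.1).linearMap_comp L)
        (fun t ht => mul_pos (sq_pos_of_ne_zero (sub_ne_zero.2 fun h => ht.2 h)) (hh t ht.1))
        (fun t ht => by
          have h1 := hB (Fin.cons a t : Fin (n + 1) → ℝ) (by
            intro i
            induction i using Fin.cases with
            | zero => simpa
            | succ i => simpa using (ht i).1)
          rw [doubled_cons] at h1
          have h2 := (hd (doubled F F' t)).symm.trans h1
          rw [linearMap_doubled, vdm_cons, Fin.prod_univ_succ] at h2
          simp only [Fin.cons_zero, Fin.cons_succ] at h2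
          apply mul_left_cancel₀ hκ
          rw [h2]
          simp only [mul_pow, Finset.prod_mul_distrib, Finset.prod_pow]
          field_simp)
        (fun y hy => by
          have h2 := rowDet_merge_sign (k := 2 * n) hO hF hS ha (fun i => (hy i).1)
          rw [hd] at h2
          rwa [mul_assoc s₀])
      refine ⟨Z, hZ, fun ξ h0 h1 => ?_⟩
      obtain ⟨ξ', hξ'⟩ := hfac ξ h0 h1
      obtain ⟨p, hp, hpe⟩ := hZp ξ'
      refine ⟨(X - C a) ^ 2 * p, ?_, fun t ht => ?_⟩
      · rw [mem_degreeLT] at hp ⊢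
        by_cases hz : p = 0
        · rw [hz, mul_zero, degree_zero]
          exact WithBot.bot_lt_coe _
        · rw [degree_mul, degree_pow, degree_X_sub_C, degree_eq_natDegree hz]
          have := (natDegree_lt_iff_degree_lt hz).2 hp
          rw [nsmul_eq_mul, mul_one]
          have h3 : 2 + p.natDegree < 2 * n + 2 := by omega
          exact_mod_cast h3
      · rw [hξ']
        by_cases hta : t = a
        · subst hta
          rw [hLa]
          simp
        · rw [hpe t ⟨⟨ht.1, hta⟩, ht.2⟩]
          simp
          ring
    obtain ⟨m, rfl⟩ : ∃ m, n = m + 1 := ⟨n - 1, by omega⟩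
    obtain ⟨q, hq, hqO⟩ := exists_injective_mem hOinf (m + 1 + 1)
    set a := q 0 with ha
    set b := q 1 with hb
    obtain ⟨Z₁, hZ₁, hp₁⟩ := step a (hqO 0)
    obtain ⟨Z₂, hZ₂, hp₂⟩ := step b (hqO 1)
    refine ⟨Z₁ ∪ Z₂, hZ₁.union hZ₂, fun ξ => ?_⟩
    have he : rowDet (doubled F F' q) ≠ 0 := by
      rw [hB q hqO]
      exact mul_ne_zero (mul_ne_zero hc (pow_ne_zero _ ((vdm_ne_zero_iff q).2 hq)))
        (Finset.prod_ne_zero_iff.2 fun i _ => pow_ne_zero _ (hh _ (hqO i)).ne')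
    obtain ⟨B, hBe⟩ := exists_basis_of_rowDet_ne_zero he
    -- `ξ₁` agrees with `ξ` on the basis vectors other than `F(a), F'(a)`, where it vanishes
    let ξ₁ : (Fin (2 * (m + 1 + 1)) → ℝ) →ₗ[ℝ] ℝ :=
      B.constr ℝ fun i => if i.val < 2 then 0 else ξ (B i)
    have hξ₁ : ∀ i, ξ₁ (B i) = if i.val < 2 then 0 else ξ (B i) := fun i => B.constr_basis ℝ _ i
    have b0 : B ⟨0, by omega⟩ = F a := (hBe ⟨0, by omega⟩).trans (by simp [doubled, ha])
    have b1 : B ⟨1, by omega⟩ = F' a := (hBe ⟨1, by omega⟩).trans (by simp [doubled, ha])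
    have b2 : B ⟨2, by omega⟩ = F b := (hBe ⟨2, by omega⟩).trans (by simp [doubled, hb])
    have b3 : B ⟨3, by omega⟩ = F' b := (hBe ⟨3, by omega⟩).trans (by simp [doubled, hb])
    obtain ⟨p₁, hp₁d, hp₁e⟩ := hp₁ ξ₁ (by rw [← b0, hξ₁]; rfl) (by rw [← b1, hξ₁]; rfl)
    obtain ⟨p₂, hp₂d, hp₂e⟩ := hp₂ (ξ - ξ₁)
      (by rw [← b2, LinearMap.sub_apply, hξ₁]; exact sub_self _)
      (by rw [← b3, LinearMap.sub_apply, hξ₁]; exact sub_self _)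
    refine ⟨p₁ + p₂, Submodule.add_mem _ hp₁d hp₂d, fun t ht => ?_⟩
    have h1 := hp₁e t ⟨ht.1, fun h => ht.2 (Or.inl h)⟩
    have h2 := hp₂e t ⟨ht.1, fun h => ht.2 (Or.inr h)⟩
    rw [LinearMap.sub_apply] at h2
    have h3 : (p₁ + p₂).eval t = p₁.eval t + p₂.eval t := eval_add
    linear_combination h1 + h2 - h t * h3

/-- The determinant formula at doubled points implies the formula at distinct points, away from
finitely many points. -/
theorem exists_rowDet_eq_of_doubled {n : ℕ} (hn : 2 ≤ n) {O : Set ℝ} (hO : IsOpen O)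
    (hne : O.Nonempty) {F F' : ℝ → Fin (2 * n) → ℝ} {h : ℝ → ℝ} {c s₀ : ℝ} (hc : c ≠ 0)
    (hs₀ : s₀ ≠ 0) (hF : ∀ t ∈ O, HasDerivAt F (F' t) t) (hh : ∀ t ∈ O, 0 < h t)
    (hB : ∀ t : Fin n → ℝ, (∀ i, t i ∈ O) →
      rowDet (doubled F F' t) = c * vdm t ^ 4 * ∏ i, h (t i) ^ 2)
    (hS : ∀ y : Fin (2 * n) → ℝ, (∀ i, y i ∈ O) → 0 ≤ s₀ * rowDet (fun i => F (y i)) * vdm y) :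
    ∃ Z : Set ℝ, Z.Finite ∧ ∃ c' : ℝ, ∀ y : Fin (2 * n) → ℝ, (∀ i, y i ∈ O \ Z) →
      rowDet (fun i => F (y i)) = c' * vdm y * ∏ i, h (y i) := by
  obtain ⟨Z, hZ, hp⟩ := exists_polynomial_of_doubled hn hO hne hc hs₀ hF hh hB hS
  exact ⟨Z, hZ, exists_rowDet_eq_of_polynomial hp⟩

/-! ### Relabelling, ordering and splitting of coordinates -/

lemma measurePreserving_comp_equiv {ι κ : Type*} [Fintype ι] [Fintype κ] (e : ι ≃ κ) :
    MeasurePreserving (fun x : κ → ℝ => x ∘ e) :=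
  (volume_measurePreserving_piCongrLeft (fun _ : κ => ℝ) e).symm

lemma measurePreserving_sumElim {ι κ α : Type*} [Fintype ι] [Fintype κ] [Fintype α]
    (e : ι ⊕ κ ≃ α) :
    MeasurePreserving (fun p : (ι → ℝ) × (κ → ℝ) => (Sum.elim p.1 p.2 : ι ⊕ κ → ℝ) ∘ e.symm) :=
  (measurePreserving_comp_equiv e.symm).comp
    (volume_measurePreserving_sumPiEquivProdPi_symm (fun _ : ι ⊕ κ => ℝ))

lemma ae_injective (N : ℕ) : ∀ᵐ x : Fin N → ℝ, Function.Injective x := by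
  have h : ∀ i j : Fin N, i ≠ j → ∀ᵐ x : Fin N → ℝ, x i ≠ x j := by
    intro i j hij
    let L : (Fin N → ℝ) →ₗ[ℝ] ℝ :=
      (LinearMap.proj i : (Fin N → ℝ) →ₗ[ℝ] ℝ) - LinearMap.proj j
    have hL : LinearMap.ker L ≠ ⊤ := by
      intro htop
      have h1 : (Pi.single i 1 : Fin N → ℝ) ∈ LinearMap.ker L := htop ▸ Submodule.mem_top
      simp [L, hij.symm] at h1
    have h0 := Measure.addHaar_submodule (volume : Measure (Fin N → ℝ)) _ hL
    rw [ae_iff]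
    convert h0 using 2
    ext x
    simp [L, sub_eq_zero]
  have h2 : ∀ᵐ x : Fin N → ℝ, ∀ i j : Fin N, i ≠ j → x i ≠ x j := by
    rw [ae_all_iff]; intro i
    rw [ae_all_iff]; intro j
    by_cases hij : i = j
    · simp [hij]
    · filter_upwards [h i j hij] with x hx _ using hx
  filter_upwards [h2] with x hx i j hij
  by_contra hne
  exact hx i j hne hij

/-- The permutation listing the coordinates of `x` in decreasing order. -/
noncomputable def descendingPerm {N : ℕ} (x : Fin N → ℝ) : Equiv.Perm (Fin N) :=
  Fin.revPerm.trans (Tuple.sort x)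

lemma descending_eq_comp {N : ℕ} (x : Fin N → ℝ) : descending x = x ∘ descendingPerm x := rfl

lemma antitone_descending {N : ℕ} (x : Fin N → ℝ) : Antitone (descending x) :=
  fun _ _ h => Tuple.monotone_sort x (Fin.rev_le_rev.2 h)

lemma strictAnti_descending {N : ℕ} {x : Fin N → ℝ} (hx : Function.Injective x) :
    StrictAnti (descending x) :=
  (antitone_descending x).strictAnti_of_injective (hx.comp (descendingPerm x).injective)

lemma descending_of_antitone {N : ℕ} {x : Fin N → ℝ} (hx : Antitone x) : descending x = x := by
  have h : x ∘ Fin.revPerm = x ∘ Tuple.sort x := by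
    rw [Tuple.comp_sort_eq_comp_iff_monotone]
    exact fun i j h => hx (Fin.rev_le_rev.2 h)
  funext k
  have := congrFun h k.rev
  simpa [descending] using this.symm

lemma ae_comp_perm {N : ℕ} {P : (Fin N → ℝ) → Prop} (h : ∀ᵐ x, P x) (σ : Equiv.Perm (Fin N)) :
    ∀ᵐ x : Fin N → ℝ, P (x ∘ σ) :=
  (measurePreserving_comp_equiv σ).quasiMeasurePreserving.ae h

/-- A permutation invariant property that holds for almost every decreasing tuple holds almost
everywhere. -/
lemma ae_of_ae_strictAnti {N : ℕ} {P : (Fin N → ℝ) → Prop}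
    (hP : ∀ (σ : Equiv.Perm (Fin N)) x, P (x ∘ σ) → P x) (h : ∀ᵐ x, StrictAnti x → P x) :
    ∀ᵐ x, P x := by
  have h1 : ∀ᵐ x : Fin N → ℝ, ∀ σ : Equiv.Perm (Fin N), StrictAnti (x ∘ σ) → P (x ∘ σ) := by
    rw [ae_all_iff]
    exact fun σ => ae_comp_perm h σ
  filter_upwards [h1, ae_injective N] with x hx hinj
  exact hP (descendingPerm x) x (hx _ (strictAnti_descending hinj))

lemma ae_ae_cons {N : ℕ} {P : (Fin (N + 1) → ℝ) → Prop} (h : ∀ᵐ x, P x) :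
    ∀ᵐ y : Fin N → ℝ, ∀ᵐ t : ℝ, P (Fin.cons t y) := by
  have h1 := (volume_preserving_piFinSuccAbove (fun _ : Fin (N + 1) => ℝ) 0).symm
  have h2 := h1.quasiMeasurePreserving.ae h
  have h3 := (Measure.measurePreserving_swap (μ := (volume : Measure (Fin N → ℝ)))
    (ν := (volume : Measure ℝ))).quasiMeasurePreserving.ae h2
  filter_upwards [Measure.ae_ae_of_ae_prod h3] with y hy
  filter_upwards [hy] with t ht
  simpa [MeasurableEquiv.piFinSuccAbove, Fin.insertNthEquiv] using ht

lemma ae_forall_coord {N : ℕ} {P : ℝ → Prop} (h : ∀ᵐ t, P t) :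
    ∀ᵐ x : Fin N → ℝ, ∀ i, P (x i) := by
  rw [ae_all_iff]
  exact fun i =>
    (Measure.quasiMeasurePreserving_eval (fun _ : Fin N => (volume : Measure ℝ)) i).ae h

lemma ae_notMem_of_finite {Z : Set ℝ} (hZ : Z.Finite) : ∀ᵐ t : ℝ, t ∉ Z :=
  measure_eq_zero_iff_ae_notMem.1 (hZ.measure_zero _)

lemma isOpen_forall_mem {N : ℕ} {O : Set ℝ} (hO : IsOpen O) :
    IsOpen {x : Fin N → ℝ | ∀ i, x i ∈ O} := by
  have : {x : Fin N → ℝ | ∀ i, x i ∈ O} = Set.pi Set.univ fun _ => O := by ext; simp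
  rw [this]
  exact isOpen_set_pi Set.finite_univ fun _ _ => hO

lemma isOpen_injective (N : ℕ) : IsOpen {x : Fin N → ℝ | Function.Injective x} := by
  have : {x : Fin N → ℝ | Function.Injective x} = {x | vdm x ≠ 0} := by
    ext x; exact (vdm_ne_zero_iff x).symm
  rw [this]
  exact isOpen_ne_fun continuous_vdm continuous_const

lemma exists_strictAnti_mem {S : Set ℝ} (hS : S.Infinite) (N : ℕ) :
    ∃ y : Fin N → ℝ, StrictAnti y ∧ ∀ i, y i ∈ S := by
  obtain ⟨y, hy, hyS⟩ := exists_injective_mem hS N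
  exact ⟨descending y, strictAnti_descending hy, fun i => hyS _⟩

/-- An almost sure property of tuples holds for some tuple of distinct points of an open set. -/
lemma exists_injective_of_ae {N : ℕ} {P : (Fin N → ℝ) → Prop} (h : ∀ᵐ x, P x) {O : Set ℝ}
    (hO : IsOpen O) (hne : O.Nonempty) : ∃ y, P y ∧ Function.Injective y ∧ ∀ i, y i ∈ O := by
  obtain ⟨y, hy, hyO⟩ := exists_injective_mem (hO.infinite_of_mem hne.some_mem) N
  obtain ⟨x, hx, hxP⟩ := (Measure.dense_of_ae h).exists_mem_open
    ((isOpen_injective N).inter (isOpen_forall_mem hO)) ⟨y, hy, hyO⟩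
  exact ⟨x, hx, hxP.1, hxP.2⟩

lemma exists_strictAnti_of_ae {N : ℕ} {P : (Fin N → ℝ) → Prop} (h : ∀ᵐ x, StrictAnti x → P x)
    {O : Set ℝ} (hO : IsOpen O) (hne : O.Nonempty) :
    ∃ y, P y ∧ StrictAnti y ∧ ∀ i, y i ∈ O := by
  have h1 : ∀ᵐ x : Fin N → ℝ, ∀ σ : Equiv.Perm (Fin N), StrictAnti (x ∘ σ) → P (x ∘ σ) := by
    rw [ae_all_iff]
    exact fun σ => ae_comp_perm h σ
  obtain ⟨y, hy, hinj, hyO⟩ := exists_injective_of_ae h1 hO hne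
  exact ⟨y ∘ descendingPerm y, hy _ (strictAnti_descending hinj), strictAnti_descending hinj,
    fun i => hyO _⟩

/-- The Vandermonde product has the same sign at all strictly decreasing tuples. -/
lemma exists_sign_vdm (N : ℕ) : ∃ s : ℝ, s ^ 2 = 1 ∧
    ∀ x : Fin N → ℝ, StrictAnti x → s * vdm x = |vdm x| := by
  refine ⟨Equiv.Perm.sign (Fin.revPerm : Equiv.Perm (Fin N)), ?_, fun x hx => ?_⟩
  · rcases Int.units_eq_one_or (Equiv.Perm.sign (Fin.revPerm : Equiv.Perm (Fin N))) with h | h <;>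
      simp [h]
  · rw [← vdm_comp_perm]
    have hpos : 0 < vdm (x ∘ Fin.revPerm) := by
      refine Finset.prod_pos fun i _ => Finset.prod_pos fun j hj => ?_
      have hij : i < j := Finset.mem_Ioi.1 hj
      exact sub_pos.2 (hx (Fin.rev_lt_rev.2 hij))
    have habs : |vdm (x ∘ Fin.revPerm)| = |vdm x| := by
      rw [vdm_comp_perm, abs_mul]
      rcases Int.units_eq_one_or (Equiv.Perm.sign (Fin.revPerm : Equiv.Perm (Fin N))) with h | h <;>
        simp [h]
    rw [← habs, abs_of_pos hpos]

lemma abs_sign_mul {N : ℕ} (σ : Equiv.Perm (Fin N)) (x : ℝ) :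
    |((Equiv.Perm.sign σ : ℤ) : ℝ) * x| = |x| := by
  rw [abs_mul]
  rcases Int.units_eq_one_or (Equiv.Perm.sign σ) with h | h <;> simp [h]

lemma abs_vdm_comp_perm {N : ℕ} (x : Fin N → ℝ) (σ : Equiv.Perm (Fin N)) :
    |vdm (x ∘ σ)| = |vdm x| := by rw [vdm_comp_perm, abs_sign_mul]

lemma abs_rowDet_comp_perm {N : ℕ} (v : Fin N → Fin N → ℝ) (σ : Equiv.Perm (Fin N)) :
    |rowDet (fun i => v (σ i))| = |rowDet v| := by rw [rowDet_perm, abs_sign_mul]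

/-- The permutation of the doubled indices induced by a permutation. -/
def doubledPerm {n : ℕ} (σ : Equiv.Perm (Fin n)) : Equiv.Perm (Fin (2 * n)) where
  toFun k := ⟨2 * (σ ⟨k / 2, by omega⟩).val + k % 2, by omega⟩
  invFun k := ⟨2 * (σ.symm ⟨k / 2, by omega⟩).val + k % 2, by omega⟩
  left_inv k := by
    ext
    have h1 : ∀ a : ℕ, (2 * a + k.val % 2) / 2 = a := fun a => by omega
    have h2 : ∀ a : ℕ, (2 * a + k.val % 2) % 2 = k.val % 2 := fun a => by omega
    simp only [h1, h2, Fin.eta, Equiv.symm_apply_apply]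
    omega
  right_inv k := by
    ext
    have h1 : ∀ a : ℕ, (2 * a + k.val % 2) / 2 = a := fun a => by omega
    have h2 : ∀ a : ℕ, (2 * a + k.val % 2) % 2 = k.val % 2 := fun a => by omega
    simp only [h1, h2, Fin.eta, Equiv.apply_symm_apply]
    omega

lemma doubled_comp_perm {E : Type*} {n : ℕ} (F F' : ℝ → E) (t : Fin n → ℝ)
    (σ : Equiv.Perm (Fin n)) :
    doubled F F' (t ∘ σ) = fun i => doubled F F' t (doubledPerm σ i) := by
  funext k
  have h1 : ∀ a : ℕ, (2 * a + k.val % 2) / 2 = a := fun a => by omega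
  have h2 : ∀ a : ℕ, (2 * a + k.val % 2) % 2 = k.val % 2 := fun a => by omega
  simp only [doubled, doubledPerm, Equiv.coe_fn_mk, h1, h2, Function.comp]

lemma continuousOn_doubled {n N : ℕ} {F F' : ℝ → Fin N → ℝ} {O : Set ℝ} (hF : ContinuousOn F O)
    (hF' : ContinuousOn F' O) :
    ContinuousOn (fun t : Fin n → ℝ => doubled F F' t) {t | ∀ i, t i ∈ O} := by
  refine continuousOn_pi.2 fun k => ?_
  unfold doubled
  split_ifs
  · exact hF.comp (continuous_apply _).continuousOn fun t ht => ht _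
  · exact hF'.comp (continuous_apply _).continuousOn fun t ht => ht _

lemma continuousOn_comp_coord {n N : ℕ} {F : ℝ → Fin N → ℝ} {O : Set ℝ} (hF : ContinuousOn F O) :
    ContinuousOn (fun (t : Fin n → ℝ) i => F (t i)) {t | ∀ i, t i ∈ O} :=
  continuousOn_pi.2 fun i => hF.comp (continuous_apply i).continuousOn fun _ ht => ht i

lemma continuousOn_prod_coord {n : ℕ} {h : ℝ → ℝ} {O : Set ℝ} (hh : ContinuousOn h O) :
    ContinuousOn (fun t : Fin n → ℝ => ∏ i, h (t i)) {t | ∀ i, t i ∈ O} :=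
  continuousOn_finsetProd _ fun i _ => hh.comp (continuous_apply i).continuousOn fun _ ht => ht i

/-! ### The criterion for almost every point -/

/-- If `Φ` is continuous and positive at tuples of distinct points and has almost everywhere the
product form `c |vdm x|^p (∏ h(xᵢ))^e`, then `h` agrees almost everywhere with a continuous
positive function, away from finitely many points, and the product form holds everywhere. -/
lemma exists_continuous_representative {N : ℕ} {O : Set ℝ} (hO : IsOpen O) (hne : O.Nonempty)
    {Φ : (Fin (N + 1) → ℝ) → ℝ} (hΦ : ContinuousOn Φ {x | ∀ i, x i ∈ O})
    (hpos : ∀ x : Fin (N + 1) → ℝ, Function.Injective x → (∀ i, x i ∈ O) → 0 < Φ x)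
    (p : ℕ) {e : ℕ} (he : e ≠ 0) {c : ℝ} (hc : 0 < c) {h : ℝ → ℝ} (hh : ∀ t, 0 ≤ h t)
    (hae : ∀ᵐ x : Fin (N + 1) → ℝ, (∀ i, x i ∈ O) → Φ x = c * |vdm x| ^ p * (∏ i, h (x i)) ^ e) :
    ∃ Z : Set ℝ, Z.Finite ∧ ∃ k : ℝ → ℝ, ContinuousOn k (O \ Z) ∧ (∀ t ∈ O \ Z, 0 < k t) ∧
      (∀ᵐ t, t ∈ O → t ∈ O \ Z ∧ k t = h t) ∧
      ∀ x : Fin (N + 1) → ℝ, (∀ i, x i ∈ O \ Z) →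
        Φ x = c * |vdm x| ^ p * (∏ i, k (x i)) ^ e := by
  -- `y` is generic: the product form holds at `(t, y)` for almost every `t`. Solving it for `h(t)`
  -- defines the continuous function `k`.
  obtain ⟨y, hy, hyinj, hyO⟩ := exists_injective_of_ae (ae_ae_cons hae) hO hne
  have hZ : (Set.range y).Finite := Set.finite_range y
  have hO' : IsOpen (O \ Set.range y) := hO.sdiff hZ.isClosed
  have hmem : ∀ t ∈ O \ Set.range y, ∀ i, (Fin.cons t y : Fin (N + 1) → ℝ) i ∈ O := by
    intro t ht i
    induction i using Fin.cases with
    | zero => simpa using ht.1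
    | succ i => simpa using hyO i
  have hinj : ∀ t ∈ O \ Set.range y, Function.Injective (Fin.cons t y : Fin (N + 1) → ℝ) :=
    fun t ht => Fin.cons_injective_iff.2 ⟨ht.2, hyinj⟩
  have hv : ∀ t ∈ O \ Set.range y, 0 < |vdm (Fin.cons t y : Fin (N + 1) → ℝ)| :=
    fun t ht => abs_pos.2 ((vdm_ne_zero_iff _).2 (hinj t ht))
  have hgood : ∀ᵐ t, t ∈ O → t ∈ O \ Set.range y := by
    filter_upwards [ae_notMem_of_finite hZ] with t ht h1 using ⟨h1, ht⟩
  obtain ⟨t₀, ht₀⟩ : ∃ t₀, t₀ ∈ O \ Set.range y ∧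
      Φ (Fin.cons t₀ y) = c * |vdm (Fin.cons t₀ y : Fin (N + 1) → ℝ)| ^ p *
        (∏ i, h ((Fin.cons t₀ y : Fin (N + 1) → ℝ) i)) ^ e := by
    obtain ⟨x, hx, hxP⟩ := (Measure.dense_of_ae hy).exists_mem_open hO'
      ((hO.infinite_of_mem hne.some_mem).sdiff hZ).nonempty
    exact ⟨x, hxP, hx (hmem x hxP)⟩
  have hH : 0 < ∏ i, h (y i) := by
    refine lt_of_le_of_ne (Finset.prod_nonneg fun i _ => hh _) fun h0 => ?_
    have h1 := hpos _ (hinj t₀ ht₀.1) (hmem t₀ ht₀.1)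
    rw [ht₀.2, Fin.prod_univ_succ] at h1
    simp [← h0, he] at h1
  set k : ℝ → ℝ := fun t => (Φ (Fin.cons t y) /
    (c * |vdm (Fin.cons t y : Fin (N + 1) → ℝ)| ^ p * (∏ i, h (y i)) ^ e)) ^ ((e : ℝ)⁻¹) with hk
  have hcons : Continuous fun t : ℝ => (Fin.cons t y : Fin (N + 1) → ℝ) :=
    Continuous.finCons (A := fun _ => ℝ) continuous_id continuous_const
  have hkc : ContinuousOn k (O \ Set.range y) := by
    refine ContinuousOn.rpow_const (ContinuousOn.div (hΦ.comp hcons.continuousOn hmem) ?_ ?_) ?_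
    · exact ((continuous_const.mul ((continuous_vdm.comp hcons).abs.pow p)).mul
        continuous_const).continuousOn
    · intro t ht
      have := hv t ht
      positivity
    · exact fun t _ => Or.inr (by positivity)
  have hkpos : ∀ t ∈ O \ Set.range y, 0 < k t := by
    intro t ht
    have := hv t ht
    have := hpos _ (hinj t ht) (hmem t ht)
    positivity
  have hkh : ∀ᵐ t, t ∈ O → t ∈ O \ Set.range y ∧ k t = h t := by
    filter_upwards [hy, hgood] with t ht hg htO
    refine ⟨hg htO, ?_⟩
    have h1 := ht (hmem t (hg htO))
    have hv1 := hv t (hg htO)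
    have h2 : Φ (Fin.cons t y) /
        (c * |vdm (Fin.cons t y : Fin (N + 1) → ℝ)| ^ p * (∏ i, h (y i)) ^ e) = h t ^ e := by
      rw [h1, Fin.prod_univ_succ]
      simp only [Fin.cons_zero, Fin.cons_succ]
      field_simp
      rw [mul_pow, mul_comm]
    simp only [hk, h2]
    exact Real.pow_rpow_inv_natCast (hh t) he
  refine ⟨Set.range y, hZ, k, hkc, hkpos, hkh, ?_⟩
  have hae2 : ∀ᵐ x : Fin (N + 1) → ℝ, x ∈ {x | ∀ i, x i ∈ O \ Set.range y} →
      Φ x = c * |vdm x| ^ p * (∏ i, k (x i)) ^ e := by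
    filter_upwards [hae, ae_forall_coord hkh] with x hx hkx hxO
    rw [hx fun i => (hxO i).1]
    congr 2
    exact Finset.prod_congr rfl fun i _ => ((hkx i (hxO i).1).2).symm
  refine fun x hx => Measure.eqOn_open_of_ae_eq (μ := volume)
    ((ae_restrict_iff' (isOpen_forall_mem hO').measurableSet).2 hae2) (isOpen_forall_mem hO')
    (hΦ.mono fun x hx i => (hx i).1) ?_ hx
  exact (continuous_const.mul (continuous_vdm.abs.pow p)).continuousOn.mul
    ((continuousOn_prod_coord hkc).pow e)

section Criterion

variable {n : ℕ} {O : Set ℝ} {F F' : ℝ → Fin (2 * n) → ℝ} {κA κB : ℝ}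

/-- If `det (F(yᵢ))` has a constant sign at decreasing tuples, then its sign at an arbitrary tuple
is a constant times that of the Vandermonde product. -/
lemma exists_sign_of_pos_strictAnti
    (hposA : ∀ y : Fin (2 * n) → ℝ, StrictAnti y → (∀ i, y i ∈ O) →
      0 < κA * rowDet (fun i => F (y i))) :
    ∃ s : ℝ, |s| = |κA| ∧ ∀ y : Fin (2 * n) → ℝ, (∀ i, y i ∈ O) →
      s * rowDet (fun i => F (y i)) * vdm y = |κA| * |rowDet (fun i => F (y i))| * |vdm y| := by
  obtain ⟨s, hs, hsv⟩ := exists_sign_vdm (2 * n)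
  have hs' : |s| = 1 := by
    have : s = 1 ∨ s = -1 := by simpa using sq_eq_sq_iff_eq_or_eq_neg.1 (hs.trans (one_pow 2).symm)
    rcases this with h | h <;> simp [h]
  refine ⟨κA * s, by rw [abs_mul, hs', mul_one], fun y hy => ?_⟩
  by_cases hinj : Function.Injective y
  · set σ := descendingPerm y
    have hσ : StrictAnti (y ∘ σ) := strictAnti_descending hinj
    have h1 := hposA (y ∘ σ) hσ fun i => hy _
    have h2 := hsv _ hσ
    have e1 : rowDet (fun i => F ((y ∘ σ) i)) = Equiv.Perm.sign σ * rowDet (fun i => F (y i)) :=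
      rowDet_perm (fun i => F (y i)) σ
    have e2 := abs_sign_mul σ (rowDet fun i => F (y i))
    rw [← e1] at e2
    rw [← abs_vdm_comp_perm y σ, ← h2, ← e2, ← abs_mul, abs_of_pos h1, e1, vdm_comp_perm]
    rcases Int.units_eq_one_or (Equiv.Perm.sign σ) with h | h <;> rw [h] <;> push_cast <;> ring
  · have h0 : vdm y = 0 := by
      by_contra h; exact hinj ((vdm_ne_zero_iff y).1 h)
    simp [h0]

/-- The determinantal form of the equivalence: `det (F(yᵢ))` is, at almost all ordered tuples, a
multiple of `|vdm| ∏ h` exactly if the merged determinant `det (F(tᵢ), F'(tᵢ))` is a multiple of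
`|vdm|⁴ ∏ h²`. -/
theorem ae_rowDet_iff_ae_rowDet_doubled (hn : 2 ≤ n) (hO : IsOpen O) (hne : O.Nonempty)
    (hF : ∀ t ∈ O, HasDerivAt F (F' t) t) (hF' : ContinuousOn F' O)
    (hposA : ∀ y : Fin (2 * n) → ℝ, StrictAnti y → (∀ i, y i ∈ O) →
      0 < κA * rowDet (fun i => F (y i)))
    (hposB : ∀ t : Fin n → ℝ, StrictAnti t → (∀ i, t i ∈ O) → 0 < κB * rowDet (doubled F F' t))
    {h : ℝ → ℝ} (hh : ∀ t, 0 ≤ h t) :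
    (∃ c > 0, ∀ᵐ y : Fin (2 * n) → ℝ, StrictAnti y → (∀ i, y i ∈ O) →
      κA * rowDet (fun i => F (y i)) = c * |vdm y| * ∏ i, h (y i)) ↔
    ∃ c > 0, ∀ᵐ t : Fin n → ℝ, StrictAnti t → (∀ i, t i ∈ O) →
      κB * rowDet (doubled F F' t) = c * |vdm t| ^ 4 * (∏ i, h (t i)) ^ 2 := by
  have hFc : ContinuousOn F O := fun t ht => (hF t ht).continuousAt.continuousWithinAt
  obtain ⟨s, hsκ, hs⟩ := exists_sign_of_pos_strictAnti hposA
  have hinf : O.Infinite := hO.infinite_of_mem hne.some_mem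
  have hκA : κA ≠ 0 := by
    obtain ⟨y, hy, hyO⟩ := exists_strictAnti_mem hinf (2 * n)
    intro h0
    simpa [h0] using hposA y hy hyO
  have hκB : κB ≠ 0 := by
    obtain ⟨y, hy, hyO⟩ := exists_strictAnti_mem hinf n
    intro h0
    simpa [h0] using hposB y hy hyO
  have hs0 : s ≠ 0 := abs_pos.1 (hsκ ▸ abs_pos.2 hκA)
  have hSnn : ∀ y : Fin (2 * n) → ℝ, (∀ i, y i ∈ O) → 0 ≤ s * rowDet (fun i => F (y i)) * vdm y :=
    fun y hy => by rw [hs y hy]; positivity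
  have hΦA : ContinuousOn (fun y : Fin (2 * n) → ℝ => |κA| * |rowDet (fun i => F (y i))|)
      {y | ∀ i, y i ∈ O} :=
    continuousOn_const.mul (continuous_rowDet.comp_continuousOn (continuousOn_comp_coord hFc)).abs
  have hΦB : ContinuousOn (fun t : Fin n → ℝ => |κB| * |rowDet (doubled F F' t)|)
      {y | ∀ i, y i ∈ O} :=
    continuousOn_const.mul
      (continuous_rowDet.comp_continuousOn (continuousOn_doubled hFc hF')).abs
  have hposA' : ∀ y : Fin (2 * n) → ℝ, Function.Injective y → (∀ i, y i ∈ O) →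
      0 < |κA| * |rowDet (fun i => F (y i))| := by
    intro y hy hyO
    rw [← abs_rowDet_comp_perm _ (descendingPerm y), ← abs_mul]
    exact abs_pos.2 (hposA _ (strictAnti_descending hy) fun i => hyO _).ne'
  have hposB' : ∀ t : Fin n → ℝ, Function.Injective t → (∀ i, t i ∈ O) →
      0 < |κB| * |rowDet (doubled F F' t)| := by
    intro y hy hyO
    have h1 := hposB _ (strictAnti_descending hy) fun i => hyO _
    rw [descending_eq_comp, doubled_comp_perm] at h1
    rw [← abs_rowDet_comp_perm _ (doubledPerm (descendingPerm y)), ← abs_mul]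
    exact abs_pos.2 h1.ne'
  constructor
  -- `h` is replaced by a continuous function, for which the formula at distinct points holds
  -- everywhere; points are then merged.
  · rintro ⟨c, hc, hae⟩
    have hae' : ∀ᵐ y : Fin (2 * n) → ℝ, (∀ i, y i ∈ O) →
        |κA| * |rowDet (fun i => F (y i))| = c * |vdm y| ^ 1 * (∏ i, h (y i)) ^ 1 := by
      refine ae_of_ae_strictAnti (fun σ y hy hyO => ?_) ?_
      · have h1 := hy fun i => hyO _
        have e1 := abs_rowDet_comp_perm (fun i => F (y i)) σ
        have e2 : ∏ i, h ((y ∘ σ) i) = ∏ i, h (y i) := Equiv.prod_comp σ fun i => h (y i)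
        rw [abs_vdm_comp_perm, e2] at h1
        rw [← h1, ← e1]
        rfl
      · filter_upwards [hae] with y hy hya hyO
        rw [← abs_mul, hy hya hyO, pow_one, pow_one, abs_of_nonneg]
        have := Finset.prod_nonneg fun i (_ : i ∈ Finset.univ) => hh (y i)
        positivity
    obtain ⟨m, rfl⟩ : ∃ m, n = m + 1 := ⟨n - 1, by omega⟩
    obtain ⟨Z, hZ, k, hkc, hkpos, hkh, hk⟩ := exists_continuous_representative (N := 2 * m + 1)
      hO hne hΦA hposA' 1 one_ne_zero hc hh hae'
    have hO' : IsOpen (O \ Z) := hO.sdiff hZ.isClosed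
    have hA : ∀ y : Fin (2 * (m + 1)) → ℝ, (∀ i, y i ∈ O \ Z) →
        rowDet (fun i => F (y i)) = c / s * vdm y * ∏ i, k (y i) := by
      intro y hy
      have h1 := hs y fun i => (hy i).1
      have h2 : |κA| * |rowDet fun i => F (y i)| = c * |vdm y| * ∏ i, k (y i) := by
        have := hk y hy
        rwa [pow_one, pow_one] at this
      by_cases hv : vdm y = 0
      · have h3 : rowDet (fun i => F (y i)) = 0 := by
          simpa [hv, hκA] using h2
        simp [h3, hv]
      · rw [h2] at h1
        have h4 : s * rowDet (fun i => F (y i)) * vdm y =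
            (c * vdm y * ∏ i, k (y i)) * vdm y := by
          rw [h1, mul_right_comm, mul_assoc c, abs_mul_abs_self]; ring
        have h5 := mul_right_cancel₀ hv h4
        field_simp
        linarith
    have hB := fun t ht => rowDet_doubled_of_rowDet hO' (t := t) (div_ne_zero hc.ne' hs0)
      (fun t ht => hF t ht.1) hkc (fun t ht => (hkpos t ht).ne') hA ht
    have hd : 0 < κB * (c / s) := by
      obtain ⟨t, ht, htO⟩ := exists_strictAnti_mem (hinf.sdiff hZ) (m + 1)
      have h1 := hposB t ht fun i => (htO i).1
      rw [hB t htO, mul_assoc (c / s), ← mul_assoc] at h1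
      have : 0 ≤ vdm t ^ 4 * ∏ i, k (t i) ^ 2 := by
        have := Finset.prod_nonneg fun i (_ : i ∈ Finset.univ) => sq_nonneg (k (t i))
        positivity
      exact pos_of_mul_pos_left h1 this
    refine ⟨_, hd, ?_⟩
    filter_upwards [ae_forall_coord hkh] with t ht _ htO
    rw [hB t fun i => (ht i (htO i)).1, ← Finset.prod_pow, Even.pow_abs (by decide),
      Finset.prod_congr rfl fun i _ => by rw [(ht i (htO i)).2]]
    ring
  -- The continuous representative gives the formula at doubled points up to sign; the sign is
  -- known from the determinants at distinct points, whose sign is preserved by merging.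
  · rintro ⟨c, hc, hae⟩
    have hae' : ∀ᵐ t : Fin n → ℝ, (∀ i, t i ∈ O) →
        |κB| * |rowDet (doubled F F' t)| = c * |vdm t| ^ 4 * (∏ i, h (t i)) ^ 2 := by
      refine ae_of_ae_strictAnti (fun σ y hy hyO => ?_) ?_
      · have h1 := hy fun i => hyO _
        have e2 : ∏ i, h ((y ∘ σ) i) = ∏ i, h (y i) := Equiv.prod_comp σ fun i => h (y i)
        rw [abs_vdm_comp_perm, e2, doubled_comp_perm, abs_rowDet_comp_perm] at h1
        exact h1
      · filter_upwards [hae] with y hy hya hyO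
        rw [← abs_mul, hy hya hyO, abs_of_nonneg]
        positivity
    obtain ⟨m, rfl⟩ : ∃ m, n = m + 1 := ⟨n - 1, by omega⟩
    obtain ⟨Z, hZ, k, hkc, hkpos, hkh, hk⟩ := exists_continuous_representative
      hO hne hΦB hposB' 4 two_ne_zero hc hh hae'
    have hO' : IsOpen (O \ Z) := hO.sdiff hZ.isClosed
    have hne' : (O \ Z).Nonempty := (hinf.sdiff hZ).nonempty
    have hB : ∀ t : Fin (m + 1) → ℝ, (∀ i, t i ∈ O \ Z) →
        rowDet (doubled F F' t) = s / |s| * (c / |κB|) * vdm t ^ 4 * ∏ i, k (t i) ^ 2 := by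
      intro t ht
      have h1 := rowDet_doubled_sign hO hF hSnn (t := t) fun i => (ht i).1
      have h2 := hk t ht
      rw [Even.pow_abs (by decide), ← Finset.prod_pow] at h2
      have h3 : |κB| ≠ 0 := abs_ne_zero.2 hκB
      have h4 : |s| * |rowDet (doubled F F' t)| = s * rowDet (doubled F F' t) := by
        rw [← abs_mul, abs_of_nonneg h1]
      have h5 : rowDet (doubled F F' t) = s / |s| * |rowDet (doubled F F' t)| := by
        rw [div_mul_eq_mul_div, eq_div_iff (abs_ne_zero.2 hs0)]
        rcases abs_choice s with h | h <;> rw [h] at h4 ⊢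
        · linarith
        · linarith
      have h6 : |rowDet (doubled F F' t)| = c / |κB| * vdm t ^ 4 * ∏ i, k (t i) ^ 2 := by
        rw [div_mul_eq_mul_div, div_mul_eq_mul_div, eq_div_iff h3, mul_comm, h2]
      rw [h5, h6]
      ring
    have hne0 : s / |s| * (c / |κB|) ≠ 0 :=
      mul_ne_zero (div_ne_zero hs0 (abs_ne_zero.2 hs0)) (div_ne_zero hc.ne' (abs_ne_zero.2 hκB))
    obtain ⟨Z', hZ', c', hc'⟩ := exists_rowDet_eq_of_doubled hn hO' hne' hne0 hs0
      (fun t ht => hF t ht.1) hkpos hB fun y hy => hSnn y fun i => (hy i).1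
    have hcpos : 0 < |κA| * |c'| := by
      obtain ⟨y, hy, hyO⟩ := exists_strictAnti_mem ((hinf.sdiff hZ).sdiff hZ') (2 * (m + 1))
      have h1 := hposA y hy fun i => (hyO i).1.1
      rw [hc' y hyO] at h1
      have : c' ≠ 0 := fun h0 => by simp [h0] at h1
      positivity
    refine ⟨_, hcpos, ?_⟩
    filter_upwards [ae_forall_coord hkh, ae_forall_coord (ae_notMem_of_finite hZ')]
      with y hy hyZ hya hyO
    have h1 := hc' y fun i => ⟨(hy i (hyO i)).1, hyZ i⟩
    have h2 : 0 ≤ ∏ i, k (y i) := Finset.prod_nonneg fun i _ => (hkpos _ (hy i (hyO i)).1).le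
    rw [← abs_of_pos (hposA y hya hyO), h1, abs_mul, abs_mul, abs_mul, abs_of_nonneg h2,
      Finset.prod_congr rfl fun i _ => (hy i (hyO i)).2]
    ring

end Criterion

/-! ### Superposing two Vandermonde determinants -/

lemma vdm_eq_prod_ite {N : ℕ} (x : Fin N → ℝ) :
    vdm x = ∏ i, ∏ j, if i < j then x j - x i else 1 := by
  refine Finset.prod_congr rfl fun i _ => ?_
  rw [← Finset.prod_filter]
  congr 1
  ext j; simp

lemma vdm_append {p q : ℕ} (y : Fin p → ℝ) (z : Fin q → ℝ) :
    vdm (Fin.append y z) = vdm y * vdm z * ∏ i, ∏ j, (z j - y i) := by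
  have h1 : ∀ (i : Fin p) (j : Fin q), (Fin.castAdd q i) < Fin.natAdd p j := fun i j => by
    simp only [Fin.lt_def, Fin.val_castAdd, Fin.val_natAdd]; omega
  have h2 : ∀ (i : Fin p) (j : Fin q), ¬ Fin.natAdd p j < (Fin.castAdd q i) := fun i j =>
    (h1 i j).asymm
  have h3 : ∀ i j : Fin q, Fin.natAdd p i < Fin.natAdd p j ↔ i < j := fun i j => by
    rw [Fin.lt_def, Fin.lt_def]; simp
  have h4 : ∀ i j : Fin p, Fin.castAdd q i < Fin.castAdd q j ↔ i < j := fun i j => by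
    rw [Fin.lt_def, Fin.lt_def]; simp
  simp only [vdm_eq_prod_ite, Fin.prod_univ_add, Fin.append_left, Fin.append_right, h1, h2, h3, h4,
    if_true, if_false, Finset.prod_const_one, Finset.prod_mul_distrib]
  ring

/-- The Vandermonde product of a tuple, up to sign, from two complementary subtuples. -/
lemma abs_vdm_sumElim {p q N : ℕ} (e : Fin p ⊕ Fin q ≃ Fin N) (y : Fin p → ℝ) (z : Fin q → ℝ) :
    |vdm (Sum.elim y z ∘ e.symm)| = |vdm y| * |vdm z| * ∏ i, ∏ j, |z i - y j| := by
  obtain rfl : p + q = N := by simpa using Fintype.card_congr e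
  have h1 : Sum.elim y z ∘ e.symm = Fin.append y z ∘ (e.symm.trans finSumFinEquiv) := by
    funext a
    simp only [Function.comp, Equiv.trans_apply]
    cases e.symm a <;> simp
  rw [h1]
  have := abs_vdm_comp_perm (Fin.append y z) (e.symm.trans finSumFinEquiv)
  rw [this, vdm_append, abs_mul, abs_mul, Finset.abs_prod, Finset.prod_comm]
  simp only [Finset.abs_prod]

section Superposition

variable {p q : ℕ}

/-- The matrix with rows `(x^k)_{k<p}, (η x^l)_{l<q}`. -/
def signedVandermonde (η x : Fin p ⊕ Fin q → ℝ) : Matrix (Fin p ⊕ Fin q) (Fin p ⊕ Fin q) ℝ :=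
  Matrix.of fun b => Sum.elim (fun k => x b ^ (k : ℕ)) fun l => η b * x b ^ (l : ℕ)

/-- Laplace expansion along the two column blocks, in unnormalized form. -/
lemma factorial_mul_det_signedVandermonde (η x : Fin p ⊕ Fin q → ℝ) :
    (p.factorial * q.factorial : ℝ) * (signedVandermonde η x).det =
      ∑ σ : Equiv.Perm (Fin p ⊕ Fin q), (Equiv.Perm.sign σ : ℤ) *
        (vdm (fun i => x (σ (Sum.inl i))) * vdm (fun i => x (σ (Sum.inr i))) *
          ∏ i, η (σ (Sum.inr i))) := by
  have h1 : ∀ ρ : Equiv.Perm (Fin p) × Equiv.Perm (Fin q), (signedVandermonde η x).det =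
      ∑ σ : Equiv.Perm (Fin p ⊕ Fin q), (Equiv.Perm.sign σ : ℤ) *
        (((Equiv.Perm.sign ρ.1 : ℤ) * ∏ i, x (σ (Sum.inl (ρ.1 i))) ^ (i : ℕ)) *
        ((Equiv.Perm.sign ρ.2 : ℤ) * ∏ i, x (σ (Sum.inr (ρ.2 i))) ^ (i : ℕ)) *
          ∏ i, η (σ (Sum.inr i))) := by
    intro ρ
    rw [Matrix.det_apply, ← Equiv.sum_comp (Equiv.mulRight (Equiv.Perm.sumCongr ρ.1 ρ.2))]
    refine Finset.sum_congr rfl fun σ _ => ?_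
    simp only [Equiv.coe_mulRight, map_mul, Equiv.Perm.sign_sumCongr, Units.smul_def,
      Fintype.prod_sum_type, zsmul_eq_mul, signedVandermonde, Matrix.of_apply, Sum.elim_inl,
      Sum.elim_inr, Equiv.Perm.mul_apply, Equiv.sumCongr_apply, Sum.map_inl, Sum.map_inr,
      Finset.prod_mul_distrib]
    rw [Equiv.prod_comp ρ.2 fun i => η (σ (Sum.inr i))]
    push_cast
    ring
  have h2 : ∑ _ρ : Equiv.Perm (Fin p) × Equiv.Perm (Fin q), (signedVandermonde η x).det =
      (p.factorial * q.factorial : ℝ) * (signedVandermonde η x).det := by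
    simp [Fintype.card_perm]
  rw [← h2, Finset.sum_congr rfl fun ρ _ => h1 ρ, Finset.sum_comm]
  refine Finset.sum_congr rfl fun σ _ => ?_
  rw [← Finset.mul_sum, ← Finset.sum_mul, Fintype.sum_prod_type]
  simp only [← Finset.mul_sum, ← Finset.sum_mul]
  congr 3 <;> rw [← det_vandermonde_eq_vdm, Matrix.det_apply] <;>
    simp [Matrix.vandermonde, Units.smul_def]

lemma det_signedVandermonde (hpq : p ≤ q) {η : Fin p ⊕ Fin q → ℝ} (h1 : ∀ i, η (Sum.inl i) = 1)
    (h2 : ∀ i, η (Sum.inr i) = -1) (x : Fin p ⊕ Fin q → ℝ) :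
    (signedVandermonde η x).det = 2 ^ p * vdm (fun i => x (Sum.inl i)) *
      ((-1) ^ q * vdm (fun i => x (Sum.inr i))) := by
  -- Adding column `l` of the second block to column `l` of the first one clears the first
  -- block in the rows where `η = -1`.
  let E : Matrix (Fin q) (Fin p) ℝ := Matrix.of fun l k => if (l : ℕ) = k then 1 else 0
  have hE : ∀ (c t : ℝ) (k : Fin p),
      ∑ l : Fin q, c * t ^ (l : ℕ) * (if (l : ℕ) = k then 1 else 0) = c * t ^ (k : ℕ) := by
    intro c t k
    rw [Finset.sum_eq_single (⟨k, by omega⟩ : Fin q)]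
    · simp
    · intro b _ hb
      rw [if_neg, mul_zero]
      exact fun h => hb (Fin.ext h)
    · simp
  have hmul : signedVandermonde η x * Matrix.fromBlocks (1 : Matrix (Fin p) (Fin p) ℝ)
        (0 : Matrix (Fin p) (Fin q) ℝ) E (1 : Matrix (Fin q) (Fin q) ℝ) = Matrix.fromBlocks
      ((2 : ℝ) • Matrix.vandermonde fun i => x (Sum.inl i))
      (Matrix.of fun i (l : Fin q) => x (Sum.inl i) ^ (l : ℕ)) 0
      (-Matrix.vandermonde fun i => x (Sum.inr i)) := by
    ext b c
    rcases b with b | b <;> rcases c with c | c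
    · simpa [Matrix.mul_apply, Fintype.sum_sum_type, signedVandermonde, h1, Matrix.one_apply,
        E, Matrix.vandermonde, two_mul] using hE 1 (x (Sum.inl b)) c
    · simp [Matrix.mul_apply, Fintype.sum_sum_type, signedVandermonde, h1, Matrix.one_apply]
    · have := hE (-1) (x (Sum.inr b)) c
      simp only [Matrix.mul_apply, Fintype.sum_sum_type, signedVandermonde, h2, E,
        Matrix.of_apply, Sum.elim_inl, Sum.elim_inr, Matrix.fromBlocks_apply₁₁,
        Matrix.fromBlocks_apply₂₁, this]
      simp [Matrix.one_apply]
    · simp [Matrix.mul_apply, Fintype.sum_sum_type, signedVandermonde, h2, Matrix.one_apply,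
        Matrix.vandermonde]
  have hdet := congrArg Matrix.det hmul
  rw [Matrix.det_mul, Matrix.det_fromBlocks_zero₁₂, Matrix.det_fromBlocks_zero₂₁] at hdet
  simpa [Matrix.det_smul, Matrix.det_neg, det_vandermonde_eq_vdm] using hdet

lemma exists_prod_prod_compl_sub (q : ℕ) : ∃ c : ℝ, ∀ z : Fin q → ℝ,
    ∏ i, ∏ j ∈ {i}ᶜ, (z i - z j) = c * vdm z ^ 2 := by
  refine ⟨∏ i : Fin q, ∏ j ∈ Finset.Ioi i, (-1), fun z => ?_⟩
  rw [← Finset.prod_prod_Ioi_mul_eq_prod_prod_off_diag fun j i => z i - z j, vdm, pow_two,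
    ← Finset.prod_mul_distrib, ← Finset.prod_mul_distrib]
  refine Finset.prod_congr rfl fun i _ => ?_
  rw [← Finset.prod_mul_distrib, ← Finset.prod_mul_distrib]
  exact Finset.prod_congr rfl fun j _ => by ring

lemma prod_compl_singleton_inr (w : Fin p ⊕ Fin q → ℝ) (i : Fin q) :
    ∏ a ∈ {Sum.inr i}ᶜ, (w (Sum.inr i) - w a) =
      (∏ j, (w (Sum.inr i) - w (Sum.inl j))) *
        ∏ j ∈ {i}ᶜ, (w (Sum.inr i) - w (Sum.inr j)) := by
  have h : ∀ {α : Type} [Fintype α] [DecidableEq α] (b : α) (g : α → ℝ),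
      ∏ a ∈ {b}ᶜ, g a = ∏ a, if a = b then 1 else g a := by
    intro α _ _ b g
    rw [Finset.prod_ite, Finset.prod_const_one, one_mul]
    congr 1
    ext; simp
  rw [h, h, Fintype.prod_sum_type]
  simp

/-- Gunson's identity: the superposition of two Vandermonde products is a multiple of the product
of the Vandermonde products of the points with `η = 1` and of those with `η = -1`, provided that
the signs `η` alternate along the ordered points. Up to a common sign, the summands are the terms
of a Laplace expansion. -/
theorem sum_perm_abs_vdm_mul_abs_vdm (hpq : p ≤ q) {η : Fin p ⊕ Fin q → ℝ}
    (h1 : ∀ i, η (Sum.inl i) = 1) (h2 : ∀ i, η (Sum.inr i) = -1) {x : Fin p ⊕ Fin q → ℝ}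
    (hx : Function.Injective x) {s : ℝ} (hs : ∀ b, 0 < s * η b * ∏ a ∈ {b}ᶜ, (x b - x a)) :
    ∑ σ : Equiv.Perm (Fin p ⊕ Fin q),
      |vdm (fun i => x (σ (Sum.inl i)))| * |vdm (fun i => x (σ (Sum.inr i)))| =
    (p.factorial * q.factorial : ℝ) * 2 ^ p *
      (|vdm (fun i => x (Sum.inl i))| * |vdm (fun i => x (Sum.inr i))|) := by
  obtain ⟨c, hc⟩ := exists_prod_prod_compl_sub q
  set T : Equiv.Perm (Fin p ⊕ Fin q) → ℝ := fun σ => (Equiv.Perm.sign σ : ℤ) *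
    (vdm (fun i => x (σ (Sum.inl i))) * vdm (fun i => x (σ (Sum.inr i))) *
      ∏ i, η (σ (Sum.inr i))) with hT
  have hη : ∀ σ : Equiv.Perm (Fin p ⊕ Fin q), |∏ i, η (σ (Sum.inr i))| = 1 := by
    intro σ
    rw [Finset.abs_prod]
    refine Finset.prod_eq_one fun i _ => ?_
    rcases σ (Sum.inr i) with k | k <;> simp [h1, h2]
  have habs : ∀ σ, |T σ| =
      |vdm (fun i => x (σ (Sum.inl i)))| * |vdm (fun i => x (σ (Sum.inr i)))| := by
    intro σ
    simp only [hT]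
    rw [abs_mul, abs_mul, abs_mul, hη, mul_one]
    rcases Int.units_eq_one_or (Equiv.Perm.sign σ) with h | h <;> simp [h]
  set V : ℝ := vdm (fun i => x (finSumFinEquiv.symm i)) with hV
  have hsplit : ∀ σ : Equiv.Perm (Fin p ⊕ Fin q), (Equiv.Perm.sign σ : ℤ) * V =
      vdm (fun i => x (σ (Sum.inl i))) * vdm (fun i => x (σ (Sum.inr i))) *
        ∏ j, ∏ i, (x (σ (Sum.inr i)) - x (σ (Sum.inl j))) := by
    intro σ
    rw [← vdm_append, ← Equiv.Perm.sign_permCongr (finSumFinEquiv) σ, hV,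
      ← vdm_comp_perm (fun i => x (finSumFinEquiv.symm i))]
    congr 1
    funext a
    simp only [Function.comp, Equiv.permCongr_apply, Equiv.symm_apply_apply]
    obtain ⟨b, rfl⟩ := finSumFinEquiv.surjective a
    rcases b with b | b <;> simp
  -- By `hsplit`, `sign σ * V` and the two Vandermonde products differ by the cross terms, whose
  -- sign `hs` relates to that of `∏ η`; hence all terms `T σ` of the Laplace expansion have
  -- one sign.
  have hsign : ∀ σ, 0 < V * c * s ^ q * T σ := by
    intro σ
    have h3 : 0 < ∏ i, (s * η (σ (Sum.inr i)) *
        ∏ a ∈ {σ (Sum.inr i)}ᶜ, (x (σ (Sum.inr i)) - x a)) :=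
      Finset.prod_pos fun i _ => hs _
    have h4 : ∀ i, ∏ a ∈ {σ (Sum.inr i)}ᶜ, (x (σ (Sum.inr i)) - x a) =
        (∏ j, (x (σ (Sum.inr i)) - x (σ (Sum.inl j)))) *
        ∏ j ∈ {i}ᶜ, (x (σ (Sum.inr i)) - x (σ (Sum.inr j))) := by
      intro i
      rw [← prod_compl_singleton_inr fun a => x (σ a)]
      refine (Finset.prod_bij (fun a _ => σ a) ?_ (fun _ _ _ _ h => σ.injective h) ?_
        fun _ _ => rfl).symm
      · intro a ha
        simpa using ha
      · intro b hb
        exact ⟨σ.symm b, by simpa [Equiv.symm_apply_eq] using hb, by simp⟩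
    simp only [h4] at h3
    rw [Finset.prod_mul_distrib, Finset.prod_mul_distrib, Finset.prod_mul_distrib,
      hc fun i => x (σ (Sum.inr i)), Finset.prod_comm] at h3
    have h5 : 0 < (vdm fun i => x (σ (Sum.inl i))) ^ 2 := by
      have : (vdm fun i => x (σ (Sum.inl i))) ≠ 0 :=
        (vdm_ne_zero_iff _).2 (hx.comp (σ.injective.comp Sum.inl_injective))
      positivity
    have h6 := mul_pos h5 h3
    refine h6.trans_eq ?_
    simp only [hT, Finset.prod_const, Finset.card_univ, Fintype.card_fin]
    linear_combination -c * s ^ q * (vdm fun i => x (σ (Sum.inl i))) *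
      (vdm fun i => x (σ (Sum.inr i))) * (∏ i, η (σ (Sum.inr i))) * hsplit σ
  have hsum : ∑ σ, |T σ| = |∑ σ, T σ| := by
    have h0 : 0 < |V * c * s ^ q| := abs_pos.2 fun h => by simpa [h] using hsign 1
    refine mul_left_cancel₀ h0.ne' ?_
    rw [← abs_mul, Finset.mul_sum, Finset.mul_sum, abs_of_pos
      (Finset.sum_pos (fun σ _ => hsign σ) Finset.univ_nonempty)]
    exact Finset.sum_congr rfl fun σ _ => by rw [← abs_mul, abs_of_pos (hsign σ)]
  rw [← Finset.sum_congr rfl fun σ _ => habs σ, hsum, ← factorial_mul_det_signedVandermonde,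
    det_signedVandermonde hpq h1 h2]
  simp only [abs_mul, abs_pow, abs_neg, abs_one, one_pow, Nat.abs_cast, one_mul, abs_two]
  ring

/-- Gunson's identity for the points of a decreasing tuple, split by the parity of their rank. -/
theorem sum_perm_abs_vdm_castAdd_natAdd (hpq : p ≤ q) (e : Fin p ⊕ Fin q ≃ Fin (p + q)) {ε : ℝ}
    (h1 : ∀ i, (-1 : ℝ) ^ (e (Sum.inl i)).val = ε) (h2 : ∀ i, (-1 : ℝ) ^ (e (Sum.inr i)).val = -ε)
    {x : Fin (p + q) → ℝ} (hx : StrictAnti x) :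
    ∑ σ : Equiv.Perm (Fin (p + q)),
      |vdm (fun i => x (σ (Fin.castAdd q i)))| * |vdm (fun i => x (σ (Fin.natAdd p i)))| =
    (p.factorial * q.factorial : ℝ) * 2 ^ p *
      (|vdm (fun i => x (e (Sum.inl i)))| * |vdm (fun i => x (e (Sum.inr i)))|) := by
  have key := sum_perm_abs_vdm_mul_abs_vdm hpq (η := Sum.elim (fun _ => 1) fun _ => -1)
    (x := fun b => x (e b)) (s := ε) (fun _ => rfl) (fun _ => rfl)
    (hx.injective.comp e.injective) ?_
  · rw [← key]
    refine Fintype.sum_equiv (Equiv.equivCongr finSumFinEquiv.symm e.symm) _ _ fun σ => ?_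
    simp [Equiv.equivCongr]
  · intro b
    have hηb : ε * (Sum.elim (fun _ => 1) (fun _ => -1) b : ℝ) = (-1) ^ (e b).val := by
      rcases b with b | b <;> simp [h1, h2]
    have h3 : ∏ a ∈ {b}ᶜ, (x (e b) - x (e a)) = ∏ a ∈ {e b}ᶜ, (x (e b) - x a) := by
      refine Finset.prod_bij (fun a _ => e a) ?_ (fun _ _ _ _ h => e.injective h) ?_ fun _ _ => rfl
      · intro a ha
        simpa using ha
      · intro a ha
        exact ⟨e.symm a, by simpa [Equiv.symm_apply_eq] using ha, by simp⟩
    have h4 : (-1 : ℝ) ^ (e b).val = ∏ a ∈ {e b}ᶜ, if a < e b then (-1) else 1 := by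
      rw [Finset.prod_ite, Finset.prod_const_one, mul_one, Finset.prod_const]
      congr 1
      rw [← Fin.card_Iio (e b)]
      congr 1
      ext a
      simp only [Finset.mem_Iio, Finset.mem_filter, Finset.mem_compl, Finset.mem_singleton]
      exact ⟨fun h => ⟨h.ne, h⟩, fun h => h.2⟩
    rw [hηb, h3, h4, ← Finset.prod_mul_distrib]
    refine Finset.prod_pos fun a ha => ?_
    have hne : a ≠ e b := by simpa using ha
    split_ifs with hlt
    · have := hx hlt; linarith
    · have := hx (lt_of_le_of_ne (not_lt.1 hlt) hne.symm); linarith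

end Superposition

/-! ### Densities of the ordered points -/

lemma MeasureTheory.MeasurePreserving.map_withDensity_comp {α β : Type*} [MeasurableSpace α]
    [MeasurableSpace β] {μ : Measure α} {ν : Measure β} {g : α → β} (hg : MeasurePreserving g μ ν)
    {d : β → ℝ≥0∞} (hd : Measurable d) :
    (μ.withDensity (d ∘ g)).map g = ν.withDensity d := by
  ext s hs
  rw [Measure.map_apply hg.measurable hs, withDensity_apply _ (hg.measurable hs),
    withDensity_apply _ hs, ← hg.map_eq, setLIntegral_map hs hd hg.measurable]
  rfl

lemma perm_eq_descendingPerm {N : ℕ} {x : Fin N → ℝ} {σ : Equiv.Perm (Fin N)}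
    (hσ : StrictAnti (x ∘ σ)) : σ = descendingPerm x := by
  have hinj : Function.Injective x := by
    have := hσ.injective
    exact (Function.Injective.of_comp_iff' x σ.bijective).1 this
  have h := (hσ.range_inj (strictAnti_descending hinj)).1 (by
    rw [descending_eq_comp, EquivLike.range_comp, EquivLike.range_comp])
  ext i
  exact congrArg Fin.val (hinj (congrFun h i))

/-- The set of strictly decreasing tuples. -/
def decreasingTuples (N : ℕ) : Set (Fin N → ℝ) := {x | StrictAnti x}

lemma isOpen_decreasingTuples (N : ℕ) : IsOpen (decreasingTuples N) := by
  have : decreasingTuples N = ⋂ i, ⋂ j, {x : Fin N → ℝ | i < j → x j < x i} := by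
    ext x
    simp [decreasingTuples, StrictAnti]
  rw [this]
  refine isOpen_iInter_of_finite fun i => isOpen_iInter_of_finite fun j => ?_
  by_cases h : i < j
  · simpa [h] using isOpen_lt (continuous_apply j) (continuous_apply i)
  · simp [h]

lemma measurableSet_decreasingTuples (N : ℕ) : MeasurableSet (decreasingTuples N) :=
  (isOpen_decreasingTuples N).measurableSet

/-- The law of the decreasingly ordered points of `μ` has the density `δ` with respect to Lebesgue
measure on the strictly decreasing tuples. -/
structure HasOrderedDensity {N : ℕ} (μ : Measure (Fin N → ℝ)) (δ : (Fin N → ℝ) → ℝ≥0∞) : Prop where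
  measurable : Measurable δ
  map_eq : μ.map descending = volume.withDensity ((decreasingTuples N).indicator δ)

lemma measurable_comp_perm {N : ℕ} {d : (Fin N → ℝ) → ℝ≥0∞} (hd : Measurable d)
    (σ : Equiv.Perm (Fin N)) : Measurable fun x : Fin N → ℝ => d (x ∘ σ) :=
  hd.comp (measurePreserving_comp_equiv σ).measurable

/-- The ordered points of a measure with density `d` have the symmetrization of `d` as density: only
the permutation that orders `x` contributes at `x`. -/
lemma hasOrderedDensity_withDensity {N : ℕ} {d : (Fin N → ℝ) → ℝ≥0∞} (hd : Measurable d) :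
    HasOrderedDensity (volume.withDensity d)
      fun x => ∑ σ : Equiv.Perm (Fin N), d (x ∘ σ) := by
  refine ⟨Finset.measurable_sum _ fun σ _ => measurable_comp_perm hd σ, ?_⟩
  ext s hs
  rw [Measure.map_apply measurable_descending hs, withDensity_apply _ (measurable_descending hs),
    withDensity_apply _ hs, ← lintegral_indicator (measurable_descending hs),
    ← lintegral_indicator hs]
  set D := decreasingTuples N
  have hD : MeasurableSet D := measurableSet_decreasingTuples N
  have h1 : ∀ᵐ x : Fin N → ℝ, (descending ⁻¹' s).indicator d x =
      ∑ σ : Equiv.Perm (Fin N), (D ∩ s).indicator (fun y => d (y ∘ σ.symm)) (x ∘ σ) := by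
    filter_upwards [ae_injective N] with x hx
    rw [Finset.sum_eq_single (descendingPerm x)]
    · have h2 : x ∘ descendingPerm x ∈ D := strictAnti_descending hx
      have h3 : (x ∘ descendingPerm x) ∘ (descendingPerm x).symm = x := by
        funext i; simp
      by_cases hs' : x ∘ descendingPerm x ∈ s
      · rw [Set.indicator_of_mem (show x ∈ descending ⁻¹' s from hs'),
          Set.indicator_of_mem (Set.mem_inter h2 hs'), h3]
      · rw [Set.indicator_of_notMem (show x ∉ descending ⁻¹' s from hs'),
          Set.indicator_of_notMem fun h => hs' h.2]
    · intro σ _ hσ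
      exact Set.indicator_of_notMem (fun h => hσ (perm_eq_descendingPerm h.1)) _
    · simp
  rw [lintegral_congr_ae h1, lintegral_finsetSum]
  · have h2 : ∀ σ : Equiv.Perm (Fin N),
        ∫⁻ x, (D ∩ s).indicator (fun y => d (y ∘ σ.symm)) (x ∘ σ) =
          ∫⁻ x, (D ∩ s).indicator (fun y => d (y ∘ σ.symm)) x := fun σ =>
      (measurePreserving_comp_equiv σ).lintegral_comp
        ((measurable_comp_perm hd σ.symm).indicator (hD.inter hs))
    rw [Finset.sum_congr rfl fun σ _ => h2 σ, ← lintegral_finsetSum]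
    · refine lintegral_congr fun x => ?_
      by_cases hx : x ∈ D ∩ s
      · rw [Set.indicator_of_mem hx.2, Set.indicator_of_mem hx.1,
          ← Equiv.sum_comp (Equiv.inv (Equiv.Perm (Fin N)))]
        exact Finset.sum_congr rfl fun σ _ => Set.indicator_of_mem hx _
      · rw [Finset.sum_eq_zero fun σ _ => Set.indicator_of_notMem hx _]
        by_cases h1 : x ∈ s
        · rw [Set.indicator_of_mem h1, Set.indicator_of_notMem fun h => hx ⟨h, h1⟩]
        · rw [Set.indicator_of_notMem h1]
    · exact fun σ _ => (measurable_comp_perm hd σ.symm).indicator (hD.inter hs)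
  · exact fun σ _ => ((measurable_comp_perm hd σ.symm).indicator (hD.inter hs)).comp
      (measurePreserving_comp_equiv σ).measurable

/-- Positions `2j + 1 - τ` (`j < m`) and `2i + τ` (`i < r`) filling up `N = m + r` ranks
alternately, where `τ ≤ 1`: the first are the even ranks if `τ = 0` and the odd ranks if `τ = 1`
(ranks being counted from one, positions from zero). -/
structure Interlacing (τ m r N : ℕ) where
  /-- The bijection between the two families of positions and all positions. -/
  equiv : Fin m ⊕ Fin r ≃ Fin N
  le_one : τ ≤ 1
  inl : ∀ j, (equiv (Sum.inl j)).val = 2 * j.val + 1 - τ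
  inr : ∀ i, (equiv (Sum.inr i)).val = 2 * i.val + τ

/-- Interlacing positions exist if the numbers of positions of the two kinds are compatible. -/
lemma Interlacing.nonempty {τ m r N : ℕ} (hτ : τ ≤ 1) (hN : N = m + r) (h1 : r + τ ≤ m + 1)
    (h2 : m ≤ r + τ) : Nonempty (Interlacing τ m r N) := by
  let g : Fin m ⊕ Fin r → Fin N := Sum.elim (fun j => ⟨2 * j.val + 1 - τ, by omega⟩)
    fun i => ⟨2 * i.val + τ, by omega⟩
  have hg : Function.Bijective g := by
    rw [Fintype.bijective_iff_injective_and_card]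
    refine ⟨?_, by simp [hN]⟩
    rintro (a | a) (b | b) h
    · have := congrArg Fin.val h
      simp only [g, Sum.elim_inl] at this
      exact congrArg Sum.inl (Fin.ext (by omega))
    · have := congrArg Fin.val h
      simp only [g, Sum.elim_inl, Sum.elim_inr] at this
      omega
    · have := congrArg Fin.val h
      simp only [g, Sum.elim_inl, Sum.elim_inr] at this
      omega
    · have := congrArg Fin.val h
      simp only [g, Sum.elim_inr] at this
      exact congrArg Sum.inr (Fin.ext (by omega))
  exact ⟨⟨Equiv.ofBijective g hg, hτ, fun _ => rfl, fun _ => rfl⟩⟩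

/-- The interval of points with exactly `s` of the decreasing points `y` above them. -/
def slot {m : ℕ} (y : Fin m → ℝ) (s : ℕ) : Set ℝ :=
  {x | ∀ j : Fin m, (j.val < s → x < y j) ∧ (s ≤ j.val → y j < x)}

/-- The tuples interlacing with `y`. -/
def slotBox {m : ℕ} (τ r : ℕ) (y : Fin m → ℝ) : Set (Fin r → ℝ) :=
  {z | ∀ i, z i ∈ slot y (i.val + τ)}

lemma isOpen_slot {m : ℕ} (y : Fin m → ℝ) (s : ℕ) : IsOpen (slot y s) := by
  have : slot y s = ⋂ j : Fin m, ({x | j.val < s → x < y j} ∩ {x | s ≤ j.val → y j < x}) := by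
    ext x; simp [slot]
  rw [this]
  refine isOpen_iInter_of_finite fun j => IsOpen.inter ?_ ?_
  · by_cases h : j.val < s
    · simpa [h] using isOpen_lt continuous_id continuous_const
    · simp [h]
  · by_cases h : s ≤ j.val
    · simpa [h] using isOpen_lt continuous_const continuous_id
    · simp [h]

lemma slotBox_eq_pi {m : ℕ} (τ r : ℕ) (y : Fin m → ℝ) :
    slotBox τ r y = Set.univ.pi fun i : Fin r => slot y (i.val + τ) := by
  ext; simp [slotBox]

lemma measurableSet_slotBox {m : ℕ} (τ r : ℕ) (y : Fin m → ℝ) : MeasurableSet (slotBox τ r y) := by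
  rw [slotBox_eq_pi]
  exact (isOpen_set_pi Set.finite_univ fun i _ => isOpen_slot y _).measurableSet

namespace Interlacing

variable {τ m r N : ℕ} (E : Interlacing τ m r N)

/-- The tuple with `y` and `z` at the interlacing positions. -/
def merge (y : Fin m → ℝ) (z : Fin r → ℝ) : Fin N → ℝ := Sum.elim y z ∘ E.equiv.symm

include E in
lemma card_eq : N = m + r := by simpa using (Fintype.card_congr E.equiv).symm

lemma merge_inl (y : Fin m → ℝ) (z : Fin r → ℝ) (j : Fin m) :
    E.merge y z (E.equiv (Sum.inl j)) = y j := by simp [merge]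

lemma merge_inr (y : Fin m → ℝ) (z : Fin r → ℝ) (i : Fin r) :
    E.merge y z (E.equiv (Sum.inr i)) = z i := by simp [merge]

/-- The merged tuple is decreasing exactly if `y` is decreasing and `z` interlaces with it. The
order of the `z i` among each other needs no condition, since any two are separated by a `y j`. -/
lemma strictAnti_merge_iff (y : Fin m → ℝ) (z : Fin r → ℝ) :
    StrictAnti (E.merge y z) ↔ StrictAnti y ∧ z ∈ slotBox τ r y := by
  have hτ := E.le_one
  constructor
  · intro h
    have hlt : ∀ a b, (E.equiv a).val < (E.equiv b).val →
        E.merge y z (E.equiv b) < E.merge y z (E.equiv a) := fun a b hab => h hab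
    refine ⟨fun i j hij => ?_, fun i j => ⟨fun hj => ?_, fun hj => ?_⟩⟩
    · have := hlt (Sum.inl i) (Sum.inl j) (by rw [E.inl, E.inl]; have : i.val < j.val := hij; omega)
      rwa [E.merge_inl, E.merge_inl] at this
    · have := hlt (Sum.inl j) (Sum.inr i) (by rw [E.inl, E.inr]; omega)
      rwa [E.merge_inl, E.merge_inr] at this
    · have := hlt (Sum.inr i) (Sum.inl j) (by rw [E.inl, E.inr]; omega)
      rwa [E.merge_inl, E.merge_inr] at this
  · rintro ⟨hy, hz⟩ a b hab
    obtain ⟨a, rfl⟩ := E.equiv.surjective a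
    obtain ⟨b, rfl⟩ := E.equiv.surjective b
    rw [Fin.lt_def] at hab
    rcases a with i | i <;> rcases b with j | j
    · rw [E.merge_inl, E.merge_inl]
      rw [E.inl, E.inl] at hab
      exact hy (Fin.lt_def.2 (by omega))
    · rw [E.merge_inl, E.merge_inr]
      rw [E.inl, E.inr] at hab
      exact (hz j i).1 (by omega)
    · rw [E.merge_inl, E.merge_inr]
      rw [E.inl, E.inr] at hab
      exact (hz i j).2 (by omega)
    · rw [E.merge_inr, E.merge_inr]
      have hj := (E.equiv (Sum.inr j)).isLt
      rw [E.inr] at hj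
      rw [E.inr, E.inr] at hab
      -- The position following that of `z i` carries one of the `y`, which separates `z i`, `z j`.
      obtain ⟨c, hc⟩ := E.equiv.surjective ⟨2 * i.val + τ + 1, by omega⟩
      have hc' := congrArg Fin.val hc
      rcases c with c | c
      · rw [E.inl] at hc'
        simp only at hc'
        exact ((hz j c).1 (by omega)).trans ((hz i c).2 (by omega))
      · rw [E.inr] at hc'
        simp only at hc'
        omega

lemma abs_vdm_merge (y : Fin m → ℝ) (z : Fin r → ℝ) :
    |vdm (E.merge y z)| = |vdm y| * |vdm z| * ∏ i, ∏ j, |z i - y j| :=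
  abs_vdm_sumElim E.equiv y z

lemma prod_merge {M : Type*} [CommMonoid M] (w : ℝ → M) (y : Fin m → ℝ) (z : Fin r → ℝ) :
    ∏ a, w (E.merge y z a) = (∏ j, w (y j)) * ∏ i, w (z i) := by
  rw [← Equiv.prod_comp E.equiv, Fintype.prod_sum_type]
  simp only [merge_inl, merge_inr]

lemma measurePreserving_merge :
    MeasurePreserving (fun p : (Fin m → ℝ) × (Fin r → ℝ) => E.merge p.1 p.2) :=
  measurePreserving_sumElim E.equiv

/-- The ordered density of every other point of an ensemble is a marginal density: the remaining
points are integrated out over the tuples that interlace with the selected ones. -/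
lemma hasOrderedDensity_map {μ : Measure (Fin N → ℝ)} {Δ : (Fin N → ℝ) → ℝ≥0∞}
    (hμ : HasOrderedDensity μ Δ) :
    HasOrderedDensity (μ.map fun x i => descending x (E.equiv (Sum.inl i)))
      fun y => ∫⁻ z in slotBox τ r y, Δ (E.merge y z) := by
  set D := decreasingTuples N
  have hD : MeasurableSet D := measurableSet_decreasingTuples N
  have hm : Measurable fun p : (Fin m → ℝ) × (Fin r → ℝ) => Δ (E.merge p.1 p.2) :=
    hμ.measurable.comp E.measurePreserving_merge.measurable
  have hdm : Measurable fun p : (Fin m → ℝ) × (Fin r → ℝ) => D.indicator Δ (E.merge p.1 p.2) :=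
    (hμ.measurable.indicator hD).comp E.measurePreserving_merge.measurable
  have hS : MeasurableSet {p : (Fin m → ℝ) × (Fin r → ℝ) | p.2 ∈ slotBox τ r p.1} := by
    have : {p : (Fin m → ℝ) × (Fin r → ℝ) | p.2 ∈ slotBox τ r p.1} = ⋂ i : Fin r, ⋂ j : Fin m,
        ({p | j.val < i.val + τ → p.2 i < p.1 j} ∩ {p | i.val + τ ≤ j.val → p.1 j < p.2 i}) := by
      ext p; simp [slotBox, slot]
    rw [this]
    refine MeasurableSet.iInter fun i => MeasurableSet.iInter fun j => MeasurableSet.inter ?_ ?_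
    · by_cases h : j.val < i.val + τ
      · simpa [h] using measurableSet_lt ((measurable_pi_apply i).comp measurable_snd)
          ((measurable_pi_apply j).comp measurable_fst)
      · simp [h]
    · by_cases h : i.val + τ ≤ j.val
      · simpa [h] using measurableSet_lt ((measurable_pi_apply j).comp measurable_fst)
          ((measurable_pi_apply i).comp measurable_snd)
      · simp [h]
  set part : (Fin N → ℝ) → (Fin m → ℝ) := fun x i => x (E.equiv (Sum.inl i)) with hpart
  have hpm : Measurable part := measurable_pi_lambda _ fun i => measurable_pi_apply _
  have hanti : ∀ x : Fin N → ℝ, Antitone x → Antitone (part x) := by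
    intro x hx i j hij
    refine hx (Fin.le_def.2 ?_)
    rw [E.inl, E.inl]
    have : i.val ≤ j.val := hij
    omega
  refine ⟨?_, ?_⟩
  · have h1 : Measurable fun p : (Fin m → ℝ) × (Fin r → ℝ) =>
        ({p : (Fin m → ℝ) × (Fin r → ℝ) | p.2 ∈ slotBox τ r p.1}.indicator
          (fun p => Δ (E.merge p.1 p.2))) p := hm.indicator hS
    have h2 := h1.lintegral_prod_right' (ν := (volume : Measure (Fin r → ℝ)))
    convert h2 using 2 with y
    rw [← lintegral_indicator (measurableSet_slotBox τ r y)]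
    rfl
  · have h1 : (μ.map fun x i => descending x (E.equiv (Sum.inl i))).map descending =
        (μ.map descending).map part := by
      rw [show (fun (x : Fin N → ℝ) i => descending x (E.equiv (Sum.inl i))) = part ∘ descending
        from rfl, Measure.map_map measurable_descending (hpm.comp measurable_descending),
        Measure.map_map hpm measurable_descending]
      congr 1
      funext x
      exact descending_of_antitone (hanti _ (antitone_descending x))
    rw [h1, hμ.map_eq]
    ext s hs
    rw [Measure.map_apply hpm hs, withDensity_apply _ (hpm hs), withDensity_apply _ hs,
      ← lintegral_indicator (hpm hs), ← lintegral_indicator hs,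
      ← E.measurePreserving_merge.lintegral_comp ((hμ.measurable.indicator hD).indicator (hpm hs)),
      Measure.volume_eq_prod]
    refine (lintegral_prod (fun p : (Fin m → ℝ) × (Fin r → ℝ) =>
      (part ⁻¹' s).indicator (D.indicator Δ) (E.merge p.1 p.2))
      (((hμ.measurable.indicator hD).indicator (hpm hs)).comp
        E.measurePreserving_merge.measurable).aemeasurable).trans ?_
    refine lintegral_congr fun y => ?_
    have hp : ∀ z, part (E.merge y z) = y := fun z => funext fun j => E.merge_inl y z j
    by_cases hys : y ∈ s
    · rw [Set.indicator_of_mem hys]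
      have h2 : ∀ z, (part ⁻¹' s).indicator (D.indicator Δ) (E.merge y z) =
          D.indicator Δ (E.merge y z) := fun z =>
        Set.indicator_of_mem (s := part ⁻¹' s) (by rwa [Set.mem_preimage, hp]) _
      simp only [h2]
      by_cases hy : y ∈ decreasingTuples m
      · rw [Set.indicator_of_mem hy, ← lintegral_indicator (measurableSet_slotBox τ r y)]
        refine lintegral_congr fun z => ?_
        by_cases hz : z ∈ slotBox τ r y
        · rw [Set.indicator_of_mem hz,
            Set.indicator_of_mem
              (show E.merge y z ∈ D from (E.strictAnti_merge_iff y z).2 ⟨hy, hz⟩)]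
        · rw [Set.indicator_of_notMem hz, Set.indicator_of_notMem
            fun h => hz ((E.strictAnti_merge_iff y z).1 h).2]
      · rw [Set.indicator_of_notMem hy]
        have h3 : ∀ z, D.indicator Δ (E.merge y z) = 0 := fun z =>
          Set.indicator_of_notMem (fun h => hy ((E.strictAnti_merge_iff y z).1 h).1) _
        simp [h3]
    · rw [Set.indicator_of_notMem hys]
      have h2 : ∀ z, (part ⁻¹' s).indicator (D.indicator Δ) (E.merge y z) = 0 := fun z =>
        Set.indicator_of_notMem (s := part ⁻¹' s) (by rwa [Set.mem_preimage, hp]) _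
      simp [h2]

end Interlacing

lemma HasOrderedDensity.add {N : ℕ} {μ ν : Measure (Fin N → ℝ)} {δ η : (Fin N → ℝ) → ℝ≥0∞}
    (hμ : HasOrderedDensity μ δ) (hν : HasOrderedDensity ν η) :
    HasOrderedDensity (μ + ν) fun x => δ x + η x := by
  refine ⟨hμ.measurable.add hν.measurable, ?_⟩
  rw [Measure.map_add _ _ measurable_descending, hμ.map_eq, hν.map_eq,
    ← withDensity_add_left (hμ.measurable.indicator (measurableSet_decreasingTuples N))]
  congr 1
  exact (Set.indicator_add (decreasingTuples N) δ η).symm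

lemma HasOrderedDensity.smul {N : ℕ} {μ : Measure (Fin N → ℝ)} {δ : (Fin N → ℝ) → ℝ≥0∞}
    (hμ : HasOrderedDensity μ δ) (c : ℝ≥0∞) :
    HasOrderedDensity (c • μ) fun x => c * δ x := by
  refine ⟨hμ.measurable.const_mul c, ?_⟩
  rw [Measure.map_smul, hμ.map_eq,
    ← withDensity_smul _ (hμ.measurable.indicator (measurableSet_decreasingTuples N))]
  congr 1
  exact (Set.indicator_const_smul _ c δ).symm

/-- Two ensembles agree exactly if their ordered densities are proportional almost everywhere on the
decreasing tuples. -/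
lemma sameEnsemble_iff {N : ℕ} {μ ν : Measure (Fin N → ℝ)} {δ η : (Fin N → ℝ) → ℝ≥0∞}
    (hμ : HasOrderedDensity μ δ) (hν : HasOrderedDensity ν η) :
    SameEnsemble μ ν ↔ ∃ c : ℝ≥0∞, c ≠ 0 ∧ c ≠ ∞ ∧ ∀ᵐ x : Fin N → ℝ, StrictAnti x →
      δ x = c * η x := by
  have hD := measurableSet_decreasingTuples N
  refine exists_congr fun c => and_congr_right fun _ => and_congr_right fun _ => ?_
  rw [hμ.map_eq, hν.map_eq, ← withDensity_smul _ (hν.measurable.indicator hD),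
    withDensity_eq_iff_of_sigmaFinite (hμ.measurable.indicator hD).aemeasurable
      ((hν.measurable.indicator hD).const_smul c).aemeasurable]
  refine Filter.eventually_congr (Filter.Eventually.of_forall fun x => ?_)
  by_cases hx : StrictAnti x
  · simp [Set.indicator_of_mem (show x ∈ decreasingTuples N from hx), hx]
  · simp [Set.indicator_of_notMem (show x ∉ decreasingTuples N from hx), hx]

/-! ### The ordered densities of the ensembles -/

lemma betaEnsemble_eq (β N : ℕ) (w : ℝ → ℝ≥0∞) : betaEnsemble β N w =
    volume.withDensity fun x => (∏ i, w (x i)) * ENNReal.ofReal (|vdm x| ^ β) := by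
  simp only [betaEnsemble, vdm, Finset.abs_prod]

lemma measurable_prod_mul_ofReal {N : ℕ} {w : ℝ → ℝ≥0∞} (hw : Measurable w)
    {φ : (Fin N → ℝ) → ℝ} (hφ : Measurable φ) :
    Measurable fun x : Fin N → ℝ => (∏ i, w (x i)) * ENNReal.ofReal (φ x) :=
  (Finset.measurable_fun_prod _ fun i _ => hw.comp (measurable_pi_apply i)).mul hφ.ennreal_ofReal

lemma measurable_abs_vdm_pow (N β : ℕ) : Measurable fun x : Fin N → ℝ => |vdm x| ^ β :=
  (continuous_vdm.abs.pow β).measurable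

lemma hasOrderedDensity_betaEnsemble (β N : ℕ) {w : ℝ → ℝ≥0∞} (hw : Measurable w) :
    HasOrderedDensity (betaEnsemble β N w)
      fun x => N.factorial * ((∏ i, w (x i)) * ENNReal.ofReal (|vdm x| ^ β)) := by
  rw [betaEnsemble_eq]
  have h := hasOrderedDensity_withDensity
    (measurable_prod_mul_ofReal hw (measurable_abs_vdm_pow N β))
  convert h using 2 with x
  have h1 : ∀ σ : Equiv.Perm (Fin N),
      (∏ i, w ((x ∘ σ) i)) * ENNReal.ofReal (|vdm (x ∘ σ)| ^ β) =
        (∏ i, w (x i)) * ENNReal.ofReal (|vdm x| ^ β) := fun σ => by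
    rw [abs_vdm_comp_perm, ← Equiv.prod_comp σ fun i => w (x i)]
    rfl
  simp only [h1]
  rw [Finset.sum_const, Finset.card_univ, Fintype.card_perm, Fintype.card_fin, nsmul_eq_mul]

lemma ensembleUnion_withDensity {p q : ℕ} {a : (Fin p → ℝ) → ℝ≥0∞} {b : (Fin q → ℝ) → ℝ≥0∞}
    (ha : Measurable a) (hb : Measurable b) :
    ensembleUnion (volume.withDensity a) (volume.withDensity b) =
      volume.withDensity fun x =>
        a (fun i => x (Fin.castAdd q i)) * b fun i => x (Fin.natAdd p i) := by
  have h := (measurePreserving_sumElim (finSumFinEquiv (m := p) (n := q))).map_withDensity_comp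
    (d := fun x => a (fun i => x (Fin.castAdd q i)) * b fun i => x (Fin.natAdd p i))
    ((ha.comp (measurable_pi_lambda _ fun i => measurable_pi_apply _)).mul
      (hb.comp (measurable_pi_lambda _ fun i => measurable_pi_apply _)))
  rw [ensembleUnion, prod_withDensity ha hb, ← h, Measure.volume_eq_prod]
  have h1 : ∀ z : (Fin p → ℝ) × (Fin q → ℝ),
      Sum.elim z.1 z.2 ∘ finSumFinEquiv.symm = Fin.append z.1 z.2 := by
    intro z
    funext k
    obtain ⟨b, rfl⟩ := finSumFinEquiv.surjective k
    rcases b with b | b <;> simp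
  simp only [h1]
  congr 2
  funext z
  simp

/-- The integral of the `β = 1` density over the tuples interlacing with `y`. -/
noncomputable def interlacingIntegral {m : ℕ} (τ r : ℕ) (w : ℝ → ℝ≥0∞) (y : Fin m → ℝ) : ℝ≥0∞ :=
  ∫⁻ z in slotBox τ r y, (∏ i, w (z i)) * ENNReal.ofReal |vdm z|

/-- The same integral, with the Vandermonde product taken over all points of the merged tuple. -/
noncomputable def mergedIntegral {τ m r N : ℕ} (E : Interlacing τ m r N) (w : ℝ → ℝ≥0∞)
    (t : Fin m → ℝ) : ℝ≥0∞ :=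
  ∫⁻ z in slotBox τ r t, (∏ i, w (z i)) * ENNReal.ofReal |vdm (E.merge t z)|

lemma mergedIntegral_eq {τ m r N : ℕ} (E : Interlacing τ m r N) (w : ℝ → ℝ≥0∞) (t : Fin m → ℝ) :
    mergedIntegral E w t = ENNReal.ofReal |vdm t| *
      interlacingIntegral τ r (fun x => w x * ENNReal.ofReal (∏ j, |x - t j|)) t := by
  rw [mergedIntegral, interlacingIntegral, ← lintegral_const_mul' _ _ ENNReal.ofReal_ne_top]
  refine lintegral_congr fun z => ?_
  rw [E.abs_vdm_merge, Finset.prod_mul_distrib, ← ENNReal.ofReal_prod_of_nonneg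
    fun i _ => Finset.prod_nonneg fun j _ => abs_nonneg _, ENNReal.ofReal_mul (by positivity),
    ENNReal.ofReal_mul (by positivity)]
  ring

namespace Interlacing

variable {τ m r N : ℕ} (E : Interlacing τ m r N)

/-- The ordered density of every other point of an orthogonal ensemble. -/
lemma hasOrderedDensity_orthogonal {w : ℝ → ℝ≥0∞} (hw : Measurable w) :
    ∃ δ, HasOrderedDensity ((orthogonalEnsemble N w).map
        fun x i => descending x (E.equiv (Sum.inl i))) δ ∧
      ∀ t, δ t = N.factorial * ((∏ j, w (t j)) * mergedIntegral E w t) := by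
  refine ⟨_, E.hasOrderedDensity_map (hasOrderedDensity_betaEnsemble 1 N hw), fun t => ?_⟩
  have hm : Measurable fun z : Fin r → ℝ => E.merge t z :=
    E.measurePreserving_merge.measurable.comp measurable_prodMk_left
  have h1 : Measurable fun z : Fin r → ℝ =>
      (∏ i, w (z i)) * ENNReal.ofReal |vdm (E.merge t z)| :=
    measurable_prod_mul_ofReal hw (continuous_vdm.abs.measurable.comp hm)
  rw [mergedIntegral, ← lintegral_const_mul _ h1, ← lintegral_const_mul _ (h1.const_mul _)]
  refine lintegral_congr fun z => ?_
  rw [E.prod_merge, pow_one]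
  ring

/-- The ordered density of every other point of the union of two orthogonal ensembles. The
hypothesis `hG` is Gunson's identity, which decouples the selected points from the remaining
ones. -/
lemma hasOrderedDensity_union {p q : ℕ} (E : Interlacing τ m r (p + q)) {w : ℝ → ℝ≥0∞}
    (hw : Measurable w) {C : ℝ} (hC : 0 ≤ C) (hG : ∀ x : Fin (p + q) → ℝ, StrictAnti x →
      ∑ σ : Equiv.Perm (Fin (p + q)),
        |vdm (fun i => x (σ (Fin.castAdd q i)))| * |vdm (fun i => x (σ (Fin.natAdd p i)))| =
      C * (|vdm (fun i => x (E.equiv (Sum.inl i)))| * |vdm (fun i => x (E.equiv (Sum.inr i)))|)) :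
    ∃ δ, HasOrderedDensity ((ensembleUnion (orthogonalEnsemble p w) (orthogonalEnsemble q w)).map
        fun x i => descending x (E.equiv (Sum.inl i))) δ ∧
      ∀ y, StrictAnti y → δ y = ENNReal.ofReal C *
        ((∏ j, w (y j)) * ENNReal.ofReal |vdm y| * interlacingIntegral τ r w y) := by
  have hmp := measurable_prod_mul_ofReal hw (measurable_abs_vdm_pow p 1)
  have hmq := measurable_prod_mul_ofReal hw (measurable_abs_vdm_pow q 1)
  have hd := hasOrderedDensity_withDensity (d := fun x : Fin (p + q) → ℝ =>
    ((∏ i, w (x (Fin.castAdd q i))) * ENNReal.ofReal (|vdm fun i => x (Fin.castAdd q i)| ^ 1)) *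
      ((∏ i, w (x (Fin.natAdd p i))) * ENNReal.ofReal (|vdm fun i => x (Fin.natAdd p i)| ^ 1)))
    ((hmp.comp (measurable_pi_lambda _ fun i => measurable_pi_apply _)).mul
      (hmq.comp (measurable_pi_lambda _ fun i => measurable_pi_apply _)))
  rw [orthogonalEnsemble, orthogonalEnsemble, betaEnsemble_eq, betaEnsemble_eq,
    ensembleUnion_withDensity hmp hmq]
  refine ⟨_, E.hasOrderedDensity_map hd, fun y hy => ?_⟩
  have h1 : Measurable fun z : Fin r → ℝ => (∏ i, w (z i)) * ENNReal.ofReal |vdm z| :=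
    measurable_prod_mul_ofReal hw continuous_vdm.abs.measurable
  rw [interlacingIntegral, ← lintegral_const_mul _ h1, ← lintegral_const_mul _ (h1.const_mul _)]
  refine setLIntegral_congr_fun (measurableSet_slotBox τ r y) fun z hz => ?_
  have hx : StrictAnti (E.merge y z) := (E.strictAnti_merge_iff y z).2 ⟨hy, hz⟩
  have h2 : ∀ σ : Equiv.Perm (Fin (p + q)),
      ((∏ i, w ((E.merge y z ∘ σ) (Fin.castAdd q i))) *
          ENNReal.ofReal (|vdm fun i => (E.merge y z ∘ σ) (Fin.castAdd q i)| ^ 1)) *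
        ((∏ i, w ((E.merge y z ∘ σ) (Fin.natAdd p i))) *
          ENNReal.ofReal (|vdm fun i => (E.merge y z ∘ σ) (Fin.natAdd p i)| ^ 1)) =
      ((∏ j, w (y j)) * ∏ i, w (z i)) *
        ENNReal.ofReal (|vdm (fun i => E.merge y z (σ (Fin.castAdd q i)))| *
          |vdm (fun i => E.merge y z (σ (Fin.natAdd p i)))|) := by
    intro σ
    rw [← E.prod_merge w y z, ← Equiv.prod_comp σ, Fin.prod_univ_add,
      ENNReal.ofReal_mul (abs_nonneg _), pow_one, pow_one]
    simp only [Function.comp]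
    ring
  simp only [h2]
  rw [← Finset.mul_sum, ← ENNReal.ofReal_sum_of_nonneg fun σ _ => by positivity, hG _ hx]
  simp only [E.merge_inl, E.merge_inr]
  rw [ENNReal.ofReal_mul hC, ENNReal.ofReal_mul (abs_nonneg _)]
  ring

lemma neg_one_pow_inl (j : Fin m) : (-1 : ℝ) ^ (E.equiv (Sum.inl j)).val = -(-1) ^ τ := by
  rw [E.inl]
  have := E.le_one
  interval_cases τ
  · simp [pow_add, pow_mul]
  · simp [pow_mul]

lemma neg_one_pow_inr (i : Fin r) : (-1 : ℝ) ^ (E.equiv (Sum.inr i)).val = (-1) ^ τ := by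
  rw [E.inr]
  simp [pow_add, pow_mul]

/-- The case in which as many points are selected as the smaller ensemble has. -/
lemma hasOrderedDensity_union_left {p q : ℕ} (hpq : p ≤ q) (E : Interlacing τ p q (p + q))
    {w : ℝ → ℝ≥0∞} (hw : Measurable w) :
    ∃ δ, HasOrderedDensity ((ensembleUnion (orthogonalEnsemble p w) (orthogonalEnsemble q w)).map
        fun x i => descending x (E.equiv (Sum.inl i))) δ ∧
      ∀ y, StrictAnti y → δ y = ENNReal.ofReal (p.factorial * q.factorial * 2 ^ p) *
        ((∏ j, w (y j)) * ENNReal.ofReal |vdm y| * interlacingIntegral τ q w y) :=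
  E.hasOrderedDensity_union hw (by positivity) fun x hx =>
    sum_perm_abs_vdm_castAdd_natAdd hpq E.equiv (ε := -(-1) ^ τ) E.neg_one_pow_inl
      (fun i => by rw [E.neg_one_pow_inr, neg_neg]) hx

/-- The case in which as many points are selected as the larger ensemble has. -/
lemma hasOrderedDensity_union_right {p q : ℕ} (hpq : p ≤ q) (E : Interlacing τ q p (p + q))
    {w : ℝ → ℝ≥0∞} (hw : Measurable w) :
    ∃ δ, HasOrderedDensity ((ensembleUnion (orthogonalEnsemble p w) (orthogonalEnsemble q w)).map
        fun x i => descending x (E.equiv (Sum.inl i))) δ ∧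
      ∀ y, StrictAnti y → δ y = ENNReal.ofReal (p.factorial * q.factorial * 2 ^ p) *
        ((∏ j, w (y j)) * ENNReal.ofReal |vdm y| * interlacingIntegral τ p w y) :=
  E.hasOrderedDensity_union hw (by positivity) fun x hx => by
    rw [sum_perm_abs_vdm_castAdd_natAdd hpq ((Equiv.sumComm _ _).trans E.equiv) (ε := (-1) ^ τ)
      E.neg_one_pow_inr E.neg_one_pow_inl hx, mul_comm |vdm fun i => x (E.equiv (Sum.inl i))|]
    rfl

end Interlacing

/-- Comparison with a `β`-ensemble; constant factors of either density are irrelevant. -/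
lemma sameEnsemble_betaEnsemble_iff {N : ℕ} (β : ℕ) {μ : Measure (Fin N → ℝ)}
    {δ ρ : (Fin N → ℝ) → ℝ≥0∞} (hμ : HasOrderedDensity μ δ) {C : ℝ≥0∞} (hC : C ≠ 0) (hC' : C ≠ ∞)
    (hδ : ∀ x, StrictAnti x → δ x = C * ρ x) {w : ℝ → ℝ≥0∞} (hw : Measurable w) :
    SameEnsemble μ (betaEnsemble β N w) ↔ ∃ c : ℝ≥0∞, c ≠ 0 ∧ c ≠ ∞ ∧
      ∀ᵐ x : Fin N → ℝ, StrictAnti x →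
        ρ x = c * ((∏ i, w (x i)) * ENNReal.ofReal (|vdm x| ^ β)) := by
  rw [sameEnsemble_iff hμ (hasOrderedDensity_betaEnsemble β N hw)]
  have hN : (N.factorial : ℝ≥0∞) ≠ 0 := by exact_mod_cast N.factorial_ne_zero
  have hN' : (N.factorial : ℝ≥0∞) ≠ ∞ := ENNReal.natCast_ne_top _
  constructor
  · rintro ⟨c, h0, h1, h⟩
    refine ⟨C⁻¹ * c * N.factorial, ?_, ?_, ?_⟩
    · exact mul_ne_zero (mul_ne_zero (ENNReal.inv_ne_zero.2 hC') h0) hN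
    · exact ENNReal.mul_ne_top (ENNReal.mul_ne_top (ENNReal.inv_ne_top.2 hC) h1) hN'
    · filter_upwards [h] with x hx hsa
      have h2 := hx hsa
      rw [hδ x hsa] at h2
      rw [mul_assoc, mul_assoc, ← h2, ← mul_assoc, ENNReal.inv_mul_cancel hC hC', one_mul]
  · rintro ⟨c, h0, h1, h⟩
    refine ⟨C * c * (N.factorial : ℝ≥0∞)⁻¹, ?_, ?_, ?_⟩
    · exact mul_ne_zero (mul_ne_zero hC h0) (ENNReal.inv_ne_zero.2 hN')
    · exact ENNReal.mul_ne_top (ENNReal.mul_ne_top hC' h1) (ENNReal.inv_ne_top.2 hN)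
    · filter_upwards [h] with x hx hsa
      rw [hδ x hsa, hx hsa, mul_assoc (C * c), ← mul_assoc _ (N.factorial : ℝ≥0∞),
        ENNReal.inv_mul_cancel hN hN', one_mul, mul_assoc]

/-! ### From kernels to ensembles -/

lemma volume_eq_zero_of_ae_strictAnti {N : ℕ} {S : Set ℝ}
    (h : ∀ᵐ y : Fin N → ℝ, StrictAnti y → ¬ ∀ i, y i ∈ S) : volume S = 0 := by
  have h1 : ∀ᵐ y : Fin N → ℝ, ¬ ∀ i, y i ∈ S :=
    ae_of_ae_strictAnti (fun σ y hy hyS => hy fun i => hyS _) h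
  have h2 : volume (Set.univ.pi fun _ : Fin N => S) = 0 := by
    rw [measure_eq_zero_iff_ae_notMem]
    filter_upwards [h1] with y hy hyS using hy fun i => hyS i trivial
  rw [volume_pi_pi, Finset.prod_const] at h2
  by_contra hS
  exact pow_ne_zero _ hS h2

/-- The kernels `KA` and `KB` are, on decreasing tuples of points of `{f > 0}`, given by the
determinants of one curve `F` and of the pair `F, F'`. -/
def HasDeterminantalForm {n : ℕ} (f : ℝ → ℝ) (KA : (Fin (2 * n) → ℝ) → ℝ≥0∞)
    (KB : (Fin n → ℝ) → ℝ≥0∞) : Prop :=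
  ∃ (F F' : ℝ → Fin (2 * n) → ℝ) (κA κB : ℝ),
    (∀ t, 0 < f t → HasDerivAt F (F' t) t) ∧ ContinuousOn F' {x | 0 < f x} ∧
    (∀ y, StrictAnti y → (∀ i, 0 < f (y i)) →
      KA y = ENNReal.ofReal (κA * rowDet fun i => F (y i))) ∧
    ∀ t, StrictAnti t → (∀ i, 0 < f (t i)) →
      (∏ i, weight f (t i)) * KB t = ENNReal.ofReal (κB * rowDet (doubled F F' t))

/-- The equivalence of the two almost everywhere identities between densities. The kernels `KA` and
`KB` are positive, and as soon as one of them takes a finite value they are given by the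
determinants of one curve `F` and its derivative. -/
theorem ae_density_iff {n : ℕ} (hn : 2 ≤ n) {f g : ℝ → ℝ} (hf0 : ∀ x, 0 ≤ f x)
    (hg0 : ∀ x, 0 ≤ g x) (hO : IsOpen {x | 0 < f x})
    {KA : (Fin (2 * n) → ℝ) → ℝ≥0∞} {KB : (Fin n → ℝ) → ℝ≥0∞}
    (hposA : ∀ y, StrictAnti y → (∀ i, 0 < f (y i)) → KA y ≠ 0)
    (hposB : ∀ t, StrictAnti t → (∀ i, 0 < f (t i)) → KB t ≠ 0)
    (hrep : ((∃ y, StrictAnti y ∧ (∀ i, 0 < f (y i)) ∧ KA y ≠ ∞) ∨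
        ∃ t, StrictAnti t ∧ (∀ i, 0 < f (t i)) ∧ KB t ≠ ∞) →
      HasDeterminantalForm f KA KB) :
    (∃ c : ℝ≥0∞, c ≠ 0 ∧ c ≠ ∞ ∧ ∀ᵐ y : Fin (2 * n) → ℝ, StrictAnti y →
      (∏ i, weight f (y i)) * ENNReal.ofReal |vdm y| * KA y =
        c * ((∏ i, weight g (y i)) * ENNReal.ofReal (|vdm y| ^ 2))) ↔
    ∃ c : ℝ≥0∞, c ≠ 0 ∧ c ≠ ∞ ∧ ∀ᵐ t : Fin n → ℝ, StrictAnti t →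
      (∏ i, weight f (t i)) * KB t =
        c * ((∏ i, quotientSqWeight g f (t i)) * ENNReal.ofReal (|vdm t| ^ 4)) := by
  have hvpos : ∀ {N : ℕ} {x : Fin N → ℝ}, StrictAnti x → 0 < |vdm x| := fun hx =>
    abs_pos.2 ((vdm_ne_zero_iff _).2 hx.injective)
  -- Both identities force `g` to vanish almost everywhere where `f` does.
  set A := ∃ c : ℝ≥0∞, c ≠ 0 ∧ c ≠ ∞ ∧ ∀ᵐ y : Fin (2 * n) → ℝ, StrictAnti y →
      (∏ i, weight f (y i)) * ENNReal.ofReal |vdm y| * KA y =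
        c * ((∏ i, weight g (y i)) * ENNReal.ofReal (|vdm y| ^ 2)) with hAdef
  set B := ∃ c : ℝ≥0∞, c ≠ 0 ∧ c ≠ ∞ ∧ ∀ᵐ t : Fin n → ℝ, StrictAnti t →
      (∏ i, weight f (t i)) * KB t =
        c * ((∏ i, quotientSqWeight g f (t i)) * ENNReal.ofReal (|vdm t| ^ 4)) with hBdef
  have hnull : A ∨ B → ∀ᵐ x, f x = 0 → g x = 0 := by
    intro hAB
    have hS : volume {x | f x = 0 ∧ 0 < g x} = 0 := by
      rcases hAB with ⟨c, hc, -, hA⟩ | ⟨c, hc, -, hB⟩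
      · refine volume_eq_zero_of_ae_strictAnti (N := 2 * n) ?_
        filter_upwards [hA] with y hy hsa hyS
        have h1 := hy hsa
        rw [Finset.prod_eq_zero (Finset.mem_univ ⟨0, by omega⟩) (by simp [weight, (hyS _).1]),
          zero_mul, zero_mul] at h1
        refine mul_ne_zero hc (mul_ne_zero (Finset.prod_ne_zero_iff.2 fun i _ => ?_) ?_) h1.symm
        · simpa [weight] using (hyS i).2
        · have := hvpos hsa
          simpa using abs_pos.1 this
      · refine volume_eq_zero_of_ae_strictAnti (N := n) ?_
        filter_upwards [hB] with y hy hsa hyS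
        have h1 := hy hsa
        rw [Finset.prod_eq_zero (Finset.mem_univ ⟨0, by omega⟩) (by simp [weight, (hyS _).1]),
          zero_mul] at h1
        refine mul_ne_zero hc (mul_ne_zero (Finset.prod_ne_zero_iff.2 fun i _ => ?_) ?_) h1.symm
        · simpa [quotientSqWeight, weight, (hyS i).1] using (hyS i).2
        · have := hvpos hsa
          simpa using abs_pos.1 this
    filter_upwards [measure_eq_zero_iff_ae_notMem.1 hS] with x hx hfx
    by_contra hgx
    exact hx ⟨hfx, lt_of_le_of_ne (hg0 x) (Ne.symm hgx)⟩
  suffices h : (∀ᵐ x, f x = 0 → g x = 0) → (A ↔ B) from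
    ⟨fun hA => (h (hnull (Or.inl hA))).1 hA, fun hB => (h (hnull (Or.inr hB))).2 hB⟩
  intro hgf
  -- If `f` vanishes everywhere, then `g` vanishes almost everywhere, and both identities
  -- are `0 = 0`.
  rcases Set.eq_empty_or_nonempty {x | 0 < f x} with hem | hne
  · have hf : ∀ x, f x = 0 := fun x =>
      le_antisymm (not_lt.1 fun h => Set.notMem_empty x (hem ▸ h)) (hf0 x)
    refine iff_of_true ⟨1, one_ne_zero, ENNReal.one_ne_top, ?_⟩
      ⟨1, one_ne_zero, ENNReal.one_ne_top, ?_⟩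
    · filter_upwards [ae_forall_coord hgf] with y hy _
      have i₀ : Fin (2 * n) := ⟨0, by omega⟩
      rw [Finset.prod_eq_zero (Finset.mem_univ i₀) (by simp [weight, hf]),
        Finset.prod_eq_zero (Finset.mem_univ i₀) (by simp [weight, hy i₀ (hf _)])]
      simp
    · filter_upwards [ae_forall_coord hgf] with y hy _
      have i₀ : Fin n := ⟨0, by omega⟩
      rw [Finset.prod_eq_zero (Finset.mem_univ i₀) (by simp [weight, hf]),
        Finset.prod_eq_zero (f := fun i => quotientSqWeight g f (y i)) (Finset.mem_univ i₀)
          (by simp [quotientSqWeight, weight, hy i₀ (hf _)])]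
      simp
  -- The right hand sides are finite on `{f > 0}`, so either identity makes a kernel finite
  -- somewhere.
  have hfin : A ∨ B → (∃ y, StrictAnti y ∧ (∀ i, 0 < f (y i)) ∧ KA y ≠ ∞) ∨
        ∃ t, StrictAnti t ∧ (∀ i, 0 < f (t i)) ∧ KB t ≠ ∞ := by
    rintro (⟨c, -, hc, hA⟩ | ⟨c, -, hc, hB⟩)
    · obtain ⟨y, hy, hsa, hyO⟩ := exists_strictAnti_of_ae hA hO hne
      refine Or.inl ⟨y, hsa, hyO, fun htop => ?_⟩
      rw [htop, ENNReal.mul_top] at hy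
      · exact ENNReal.mul_ne_top hc (ENNReal.mul_ne_top
          (ENNReal.prod_ne_top fun i _ => ENNReal.ofReal_ne_top) ENNReal.ofReal_ne_top) hy.symm
      · refine mul_ne_zero (Finset.prod_ne_zero_iff.2 fun i _ => ?_) ?_
        · simpa [weight] using hyO i
        · simpa using (hvpos hsa)
    · obtain ⟨y, hy, hsa, hyO⟩ := exists_strictAnti_of_ae hB hO hne
      refine Or.inr ⟨y, hsa, hyO, fun htop => ?_⟩
      rw [htop, ENNReal.mul_top] at hy
      · refine ENNReal.mul_ne_top hc (ENNReal.mul_ne_top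
          (ENNReal.prod_ne_top fun i _ => ENNReal.pow_ne_top
            (ENNReal.div_ne_top ENNReal.ofReal_ne_top ?_)) ENNReal.ofReal_ne_top) hy.symm
        simpa [weight] using hyO i
      · refine Finset.prod_ne_zero_iff.2 fun i _ => ?_
        simpa [weight] using hyO i
  suffices h : ((∃ y, StrictAnti y ∧ (∀ i, 0 < f (y i)) ∧ KA y ≠ ∞) ∨
      ∃ t, StrictAnti t ∧ (∀ i, 0 < f (t i)) ∧ KB t ≠ ∞) → (A ↔ B) from
    ⟨fun hA => (h (hfin (Or.inl hA))).1 hA, fun hB => (h (hfin (Or.inr hB))).2 hB⟩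
  intro hfinite
  obtain ⟨F, F', κA, κB, hF, hF', hKA, hKB⟩ := hrep hfinite
  have hposA' : ∀ y : Fin (2 * n) → ℝ, StrictAnti y → (∀ i, y i ∈ {x | 0 < f x}) →
      0 < κA * rowDet (fun i => F (y i)) := by
    intro y hsa hyO
    have h1 := hposA y hsa hyO
    rw [hKA y hsa hyO] at h1
    exact ENNReal.ofReal_pos.1 (pos_iff_ne_zero.2 h1)
  have hposB' : ∀ t : Fin n → ℝ, StrictAnti t → (∀ i, t i ∈ {x | 0 < f x}) →
      0 < κB * rowDet (doubled F F' t) := by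
    intro y hsa hyO
    have h1 : (∏ i, weight f (y i)) * KB y ≠ 0 := by
      refine mul_ne_zero (Finset.prod_ne_zero_iff.2 fun i _ => ?_) (hposB y hsa hyO)
      simpa [weight] using hyO i
    rw [hKB y hsa hyO] at h1
    exact ENNReal.ofReal_pos.1 (pos_iff_ne_zero.2 h1)
  have hcore := ae_rowDet_iff_ae_rowDet_doubled hn hO hne hF hF' hposA' hposB'
    (h := fun x => g x / f x) fun x => div_nonneg (hg0 x) (hf0 x)
  -- A positive finite constant of `ℝ≥0∞` is the same thing as a positive real one.
  have hconst : ∀ P : ℝ≥0∞ → Prop, (∃ c : ℝ≥0∞, c ≠ 0 ∧ c ≠ ∞ ∧ P c) ↔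
      ∃ c > 0, P (ENNReal.ofReal c) := by
    intro P
    constructor
    · rintro ⟨c, h0, h1, hc⟩
      exact ⟨c.toReal, ENNReal.toReal_pos h0 h1, by rwa [ENNReal.ofReal_toReal h1]⟩
    · rintro ⟨c, h0, hc⟩
      exact ⟨_, by simpa using h0, ENNReal.ofReal_ne_top, hc⟩
  rw [hAdef, hBdef, hconst, hconst]
  refine Iff.trans (exists_congr fun c => and_congr_right fun hc => ?_)
    (hcore.trans (exists_congr fun c => and_congr_right fun hc => ?_))
  · refine Filter.eventually_congr ?_
    filter_upwards [ae_forall_coord hgf] with y hy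
    refine forall_congr' fun hsa => ?_
    by_cases hyO : ∀ i, 0 < f (y i)
    · have hfy : 0 < ∏ i, f (y i) := Finset.prod_pos fun i _ => hyO i
      have hgy : 0 ≤ ∏ i, g (y i) := Finset.prod_nonneg fun i _ => hg0 _
      have hv := hvpos hsa
      have hp := hposA' y hsa hyO
      simp only [hyO, implies_true, forall_const, weight]
      rw [hKA y hsa hyO, ← ENNReal.ofReal_prod_of_nonneg fun i _ => hf0 _,
        ← ENNReal.ofReal_prod_of_nonneg fun i _ => hg0 _, ← ENNReal.ofReal_mul hfy.le,
        ← ENNReal.ofReal_mul (by positivity), ← ENNReal.ofReal_mul hgy,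
        ← ENNReal.ofReal_mul hc.le, ENNReal.ofReal_eq_ofReal_iff (by positivity) (by positivity),
        Finset.prod_div_distrib]
      rw [mul_div_assoc', eq_div_iff hfy.ne']
      constructor
      · intro h
        refine mul_right_cancel₀ hv.ne' ?_
        linarith
      · intro h
        linear_combination |vdm y| * h
    -- If `f` vanishes at some `y i`, then so does `g`, and the identity of densities is `0 = 0`.
    · have hyO' : ¬ ∀ i, y i ∈ {x | 0 < f x} := hyO
      refine iff_of_true ?_ fun h => absurd h hyO'
      push Not at hyO
      obtain ⟨i, hi⟩ := hyO
      have hfi : f (y i) = 0 := le_antisymm hi (hf0 _)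
      rw [Finset.prod_eq_zero (Finset.mem_univ i) (by simp [weight, hfi]),
        Finset.prod_eq_zero (f := fun i => weight g (y i)) (Finset.mem_univ i)
          (by simp [weight, hy i hfi])]
      simp
  · refine Filter.eventually_congr ?_
    filter_upwards [ae_forall_coord hgf] with y hy
    refine forall_congr' fun hsa => ?_
    by_cases hyO : ∀ i, 0 < f (y i)
    · have hv := hvpos hsa
      have hp := hposB' y hsa hyO
      have hq : ∀ i, quotientSqWeight g f (y i) = ENNReal.ofReal ((g (y i) / f (y i)) ^ 2) := by
        intro i
        rw [quotientSqWeight, weight, weight, ← ENNReal.ofReal_div_of_pos (hyO i),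
          ← ENNReal.ofReal_pow (div_nonneg (hg0 _) (hf0 _))]
      simp only [hyO, implies_true, forall_const, hq]
      rw [hKB y hsa hyO, ← ENNReal.ofReal_prod_of_nonneg fun i _ => sq_nonneg _,
        ← ENNReal.ofReal_mul (Finset.prod_nonneg fun i _ => sq_nonneg _),
        ← ENNReal.ofReal_mul hc.le, ENNReal.ofReal_eq_ofReal_iff hp.le (mul_nonneg hc.le
          (mul_nonneg (Finset.prod_nonneg fun i _ => sq_nonneg _) (by positivity))),
        Finset.prod_pow, mul_comm (_ ^ 2), ← mul_assoc]
    -- Here the convention `0 / 0 = 0` applies.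
    · have hyO' : ¬ ∀ i, y i ∈ {x | 0 < f x} := hyO
      refine iff_of_true (fun h => absurd h hyO') ?_
      push Not at hyO
      obtain ⟨i, hi⟩ := hyO
      have hfi : f (y i) = 0 := le_antisymm hi (hf0 _)
      rw [Finset.prod_eq_zero (Finset.mem_univ i) (by simp [weight, hfi]),
        Finset.prod_eq_zero (f := fun i => quotientSqWeight g f (y i)) (Finset.mem_univ i)
          (by simp [quotientSqWeight, weight, hy i hfi])]
      simp

/-! ### Positivity of the interlacing integrals and moments -/

lemma lt_of_mem_slot {m : ℕ} {y : Fin m → ℝ} {s s' : ℕ} (hss : s < s') (hs' : s' ≤ m) {x x' : ℝ}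
    (hx : x ∈ slot y s) (hx' : x' ∈ slot y s') : x' < x :=
  ((hx' ⟨s, by omega⟩).1 hss).trans ((hx ⟨s, by omega⟩).2 le_rfl)

lemma notMem_range_of_mem_slot {m : ℕ} {y : Fin m → ℝ} {s : ℕ} {x : ℝ} (hx : x ∈ slot y s) (j) :
    x ≠ y j := by
  rcases lt_or_ge j.val s with h | h
  · exact ((hx j).1 h).ne
  · exact ((hx j).2 h).ne'

lemma slot_inter_nonempty {m : ℕ} (hm : 0 < m) {y : Fin m → ℝ} (hy : StrictAnti y) {O : Set ℝ}
    (hO : IsOpen O) (hyO : ∀ i, y i ∈ O) {s : ℕ} (hs : s ≤ m) : (slot y s ∩ O).Nonempty := by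
  rcases hs.lt_or_eq with hlt | rfl
  · have h1 : ∀ᶠ x in nhdsWithin (y ⟨s, hlt⟩) (Set.Ioi (y ⟨s, hlt⟩)), ∀ j : Fin m,
        (j.val < s → x < y j) ∧ (s ≤ j.val → y j < x) := by
      rw [Filter.eventually_all]
      intro j
      rcases lt_or_ge j.val s with h | h
      · have h2 : y ⟨s, hlt⟩ < y j := hy (Fin.lt_def.2 h)
        filter_upwards [nhdsWithin_le_nhds (Iio_mem_nhds h2)] with x hx
        exact ⟨fun _ => hx, fun h' => absurd h (by omega)⟩
      · have h2 : y j ≤ y ⟨s, hlt⟩ := hy.antitone (Fin.le_def.2 h)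
        filter_upwards [self_mem_nhdsWithin] with x hx
        exact ⟨fun h' => absurd h (by omega), fun _ => h2.trans_lt hx⟩
    obtain ⟨x, hx, hxO⟩ := (h1.and (nhdsWithin_le_nhds (hO.mem_nhds (hyO ⟨s, hlt⟩)))).exists
    exact ⟨x, hx, hxO⟩
  · obtain ⟨l, hl⟩ : ∃ l : Fin s, l.val + 1 = s := ⟨⟨s - 1, by omega⟩, by simp only; omega⟩
    have h1 : ∀ᶠ x in nhdsWithin (y l) (Set.Iio (y l)), ∀ j : Fin s,
        (j.val < s → x < y j) ∧ (s ≤ j.val → y j < x) := by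
      rw [Filter.eventually_all]
      intro j
      have h2 : y l ≤ y j := hy.antitone (Fin.le_def.2 (by omega))
      filter_upwards [self_mem_nhdsWithin] with x hx
      exact ⟨fun _ => lt_of_lt_of_le hx h2, fun h' => absurd j.isLt (by omega)⟩
    obtain ⟨x, hx, hxO⟩ := (h1.and (nhdsWithin_le_nhds (hO.mem_nhds (hyO l)))).exists
    exact ⟨x, hx, hxO⟩

lemma lintegral_box_ne_zero {k : ℕ} {V J : Fin k → Set ℝ} (hV : ∀ i, IsOpen (V i))
    (hne : ∀ i, (V i).Nonempty) (hVJ : ∀ i, V i ⊆ J i)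
    (hinj : ∀ z : Fin k → ℝ, (∀ i, z i ∈ V i) → Function.Injective z) {w : ℝ → ℝ≥0∞}
    (hw : Measurable w) (hpos : ∀ i, ∀ x ∈ V i, w x ≠ 0) :
    ∫⁻ z in {z : Fin k → ℝ | ∀ i, z i ∈ J i}, (∏ i, w (z i)) * ENNReal.ofReal |vdm z| ≠ 0 := by
  have hVo : IsOpen {z : Fin k → ℝ | ∀ i, z i ∈ V i} := by
    have : {z : Fin k → ℝ | ∀ i, z i ∈ V i} = Set.univ.pi V := by ext; simp
    rw [this]
    exact isOpen_set_pi Set.finite_univ fun i _ => hV i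
  have hVne : {z : Fin k → ℝ | ∀ i, z i ∈ V i}.Nonempty :=
    ⟨fun i => (hne i).some, fun i => (hne i).some_mem⟩
  intro h0
  have h1 : ∫⁻ z in {z : Fin k → ℝ | ∀ i, z i ∈ V i},
      (∏ i, w (z i)) * ENNReal.ofReal |vdm z| = 0 :=
    le_antisymm ((lintegral_mono_set (show {z : Fin k → ℝ | ∀ i, z i ∈ V i} ⊆ {z | ∀ i, z i ∈ J i}
      from fun z hz i => hVJ i (hz i))).trans h0.le) bot_le
  rw [lintegral_eq_zero_iff (measurable_prod_mul_ofReal hw continuous_vdm.abs.measurable),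
    Filter.EventuallyEq, ae_restrict_iff' hVo.measurableSet] at h1
  refine (hVo.measure_pos volume hVne).ne' (measure_eq_zero_iff_ae_notMem.2 ?_)
  filter_upwards [h1] with z hz hzV
  refine mul_ne_zero (Finset.prod_ne_zero_iff.2 fun i _ => hpos i _ (hzV i)) ?_ (hz hzV)
  simpa using (vdm_ne_zero_iff z).2 (hinj z hzV)

lemma abs_vdm_insertNth {k : ℕ} (a : Fin (k + 1)) (x : ℝ) (z : Fin k → ℝ) :
    |vdm (a.insertNth x z : Fin (k + 1) → ℝ)| = (∏ i, |z i - x|) * |vdm z| := by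
  have h := Fin.insertNth_comp_cycleRange_symm a x z
  rw [← abs_vdm_comp_perm _ a.cycleRange.symm, h, vdm_cons, abs_mul, Finset.abs_prod]

/-- Integrating out all variables but one: if the integral over a box is finite and one variable
can be separated from the others, then the weight has a finite moment. -/
lemma lintegral_moment_ne_top {k : ℕ} {J : Fin (k + 1) → Set ℝ} (hJ : ∀ i, MeasurableSet (J i))
    {w : ℝ → ℝ≥0∞} (hw : Measurable w)
    (hfin : ∫⁻ z in {z : Fin (k + 1) → ℝ | ∀ i, z i ∈ J i},
      (∏ i, w (z i)) * ENNReal.ofReal |vdm z| ≠ ∞) (a : Fin (k + 1))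
    (hne : ∫⁻ z in {z : Fin k → ℝ | ∀ i, z i ∈ J (a.succAbove i)},
      (∏ i, w (z i)) * ENNReal.ofReal |vdm z| ≠ 0)
    {S : Set ℝ} (hS : MeasurableSet S) (hSJ : S ⊆ J a) {p : ℝ}
    (hp : ∀ x ∈ S, ∀ i, i ≠ a → ∀ z ∈ J i, |x - p| ≤ |z - x|) :
    ∫⁻ x in S, w x * ENNReal.ofReal (|x - p| ^ k) ≠ ∞ := by
  intro htop
  apply hfin
  have hbox : ∀ {l : ℕ} (J : Fin l → Set ℝ), (∀ i, MeasurableSet (J i)) →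
      MeasurableSet {z : Fin l → ℝ | ∀ i, z i ∈ J i} := by
    intro l J hJ
    have : {z : Fin l → ℝ | ∀ i, z i ∈ J i} = Set.univ.pi J := by ext; simp
    rw [this]
    exact MeasurableSet.univ_pi hJ
  have hΦ : ∀ l : ℕ, Measurable fun z : Fin l → ℝ => (∏ i, w (z i)) * ENNReal.ofReal |vdm z| :=
    fun l => measurable_prod_mul_ofReal hw continuous_vdm.abs.measurable
  have hmp := (volume_preserving_piFinSuccAbove (fun _ : Fin (k + 1) => ℝ) a).symm
  have hmx : Measurable fun x : ℝ => w x * ENNReal.ofReal (|x - p| ^ k) :=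
    hw.mul (by fun_prop)
  have hb := hbox J hJ
  have hb' := hbox (fun i => J (a.succAbove i)) fun i => hJ _
  have hprod : ∫⁻ q : ℝ × (Fin k → ℝ),
      S.indicator (fun x => w x * ENNReal.ofReal (|x - p| ^ k)) q.1 *
        {z : Fin k → ℝ | ∀ i, z i ∈ J (a.succAbove i)}.indicator
          (fun z => (∏ i, w (z i)) * ENNReal.ofReal |vdm z|) q.2 = ∞ := by
    rw [Measure.volume_eq_prod, lintegral_prod_mul (hmx.indicator hS).aemeasurable
      ((hΦ k).indicator hb').aemeasurable, lintegral_indicator hS, lintegral_indicator hb', htop,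
      ENNReal.top_mul hne]
  rw [← lintegral_indicator hb, ← hmp.lintegral_comp ((hΦ _).indicator hb), eq_top_iff, ← hprod]
  refine lintegral_mono fun q => ?_
  obtain ⟨x, z⟩ := q
  by_cases hx : x ∈ S
  swap
  · simp [hx]
  by_cases hz : z ∈ {z : Fin k → ℝ | ∀ i, z i ∈ J (a.succAbove i)}
  swap
  · rw [Set.indicator_of_notMem hz, mul_zero]
    exact bot_le
  have hxz : (a.insertNth x z : Fin (k + 1) → ℝ) ∈ {z : Fin (k + 1) → ℝ | ∀ i, z i ∈ J i} := by
    intro i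
    induction i using Fin.succAboveCases a with
    | x => simpa using hSJ hx
    | p i => simpa using hz i
  have he : ((MeasurableEquiv.piFinSuccAbove (fun _ : Fin (k + 1) => ℝ) a).symm (x, z)) =
      a.insertNth x z := rfl
  rw [he, Set.indicator_of_mem hxz, Set.indicator_of_mem hx, Set.indicator_of_mem hz,
    Fin.prod_univ_succAbove _ a, abs_vdm_insertNth, ENNReal.ofReal_mul (by positivity)]
  simp only [Fin.insertNth_apply_same, Fin.insertNth_apply_succAbove]
  have hle : ENNReal.ofReal (|x - p| ^ k) ≤ ENNReal.ofReal (∏ i, |z i - x|) := by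
    refine ENNReal.ofReal_le_ofReal ?_
    calc |x - p| ^ k = ∏ _i : Fin k, |x - p| := by simp
      _ ≤ _ := Finset.prod_le_prod (fun _ _ => abs_nonneg _) fun i _ =>
        hp x hx _ (Fin.succAbove_ne a i) _ (hz i)
  calc w x * ENNReal.ofReal (|x - p| ^ k) * ((∏ i, w (z i)) * ENNReal.ofReal |vdm z|)
      = w x * (∏ i, w (z i)) * (ENNReal.ofReal (|x - p| ^ k) * ENNReal.ofReal |vdm z|) := by ring
    _ ≤ _ := by gcongr

section Slots

variable {m : ℕ} {y : Fin m → ℝ} {O : Set ℝ} {w : ℝ → ℝ≥0∞} {τ r : ℕ}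

/-- The weight is only required to be nonzero away from the points `y`, to cover the weights
`w(x) ∏ |x - y j|` of merged integrals. -/
lemma interlacingIntegral_ne_zero (hm : 0 < m) (hy : StrictAnti y) (hO : IsOpen O)
    (hyO : ∀ i, y i ∈ O) (hw : Measurable w) (hpos : ∀ x ∈ O, (∀ j, x ≠ y j) → w x ≠ 0)
    (hr : r + τ ≤ m + 1) : interlacingIntegral τ r w y ≠ 0 := by
  refine lintegral_box_ne_zero (V := fun i : Fin r => slot y (i.val + τ) ∩ O)
    (fun i => (isOpen_slot y _).inter hO)
    (fun i => slot_inter_nonempty hm hy hO hyO (by omega)) (fun i => Set.inter_subset_left)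
    (fun z hz i j hij => ?_) hw fun i x hx => hpos x hx.2 (notMem_range_of_mem_slot hx.1)
  by_contra hne
  rcases lt_or_gt_of_ne hne with h | h
  · exact (lt_of_mem_slot (by have : i.val < j.val := h; omega) (by omega) (hz i).1 (hz j).1).ne'
      hij
  · exact (lt_of_mem_slot (by have : j.val < i.val := h; omega) (by omega) (hz j).1 (hz i).1).ne
      hij

lemma lintegral_moment_ne_top_of_interlacingIntegral {k : ℕ} (hm : 0 < m) (hy : StrictAnti y)
    (hO : IsOpen O) (hyO : ∀ i, y i ∈ O) (hw : Measurable w)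
    (hpos : ∀ x ∈ O, (∀ j, x ≠ y j) → w x ≠ 0) (hr : k + 1 + τ ≤ m + 1)
    (hfin : interlacingIntegral τ (k + 1) w y ≠ ∞) (a : Fin (k + 1)) {S : Set ℝ}
    (hS : MeasurableSet S) (hSJ : S ⊆ slot y (a.val + τ)) {p : ℝ}
    (hp : ∀ x ∈ S, ∀ i : Fin (k + 1), i ≠ a → ∀ z ∈ slot y (i.val + τ), |x - p| ≤ |z - x|) :
    ∫⁻ x in S, w x * ENNReal.ofReal (|x - p| ^ k) ≠ ∞ := by
  refine lintegral_moment_ne_top (J := fun i : Fin (k + 1) => slot y (i.val + τ))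
    (fun i => (isOpen_slot y _).measurableSet) hw hfin a ?_ hS hSJ hp
  refine lintegral_box_ne_zero (V := fun i : Fin k => slot y ((a.succAbove i).val + τ) ∩ O)
    (fun i => (isOpen_slot y _).inter hO)
    (fun i => slot_inter_nonempty hm hy hO hyO (by omega)) (fun i => Set.inter_subset_left)
    (fun z hz i j hij => ?_) hw fun i x hx => hpos x hx.2 (notMem_range_of_mem_slot hx.1)
  by_contra hne
  have hne' : a.succAbove i ≠ a.succAbove j := fun h => hne (Fin.succAbove_right_injective h)
  rcases lt_or_gt_of_ne hne' with h | h
  · exact (lt_of_mem_slot (by have : (a.succAbove i).val < (a.succAbove j).val := h; omega)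
      (by omega) (hz i).1 (hz j).1).ne' hij
  · exact (lt_of_mem_slot (by have : (a.succAbove j).val < (a.succAbove i).val := h; omega)
      (by omega) (hz j).1 (hz i).1).ne hij

/-- A finite interlacing integral bounds a moment at `+∞`: a variable in the slot above `y 0` is
farther from each of the other `k` variables than from `y 0`. -/
lemma upper_moment_ne_top {k : ℕ} (hm : 0 < m) (hy : StrictAnti y)
    (hO : IsOpen O) (hyO : ∀ i, y i ∈ O) (hw : Measurable w)
    (hpos : ∀ x ∈ O, (∀ j, x ≠ y j) → w x ≠ 0) (hr : k ≤ m)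
    (hfin : interlacingIntegral 0 (k + 1) w y ≠ ∞) :
    ∫⁻ x in Set.Ioi (y ⟨0, hm⟩), w x * ENNReal.ofReal (|x - y ⟨0, hm⟩| ^ k) ≠ ∞ := by
  refine lintegral_moment_ne_top_of_interlacingIntegral hm hy hO hyO hw hpos (by omega) hfin 0
    measurableSet_Ioi (fun x hx j => ⟨fun h => absurd h (by simp), fun _ =>
      lt_of_le_of_lt (hy.antitone (Fin.le_def.2 (by simp))) hx⟩) fun x hx i hi z hz => ?_
  have h1 : z < y ⟨0, hm⟩ := (hz ⟨0, hm⟩).1 (by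
    have : i.val ≠ 0 := fun h => hi (Fin.ext h)
    simp only; omega)
  have h2 : y ⟨0, hm⟩ < x := hx
  rw [abs_of_pos (by linarith), abs_of_neg (by linarith)]
  linarith

/-- The corresponding bound for a variable in the slot below the last point of `y`. -/
lemma lower_moment_ne_top {k : ℕ} (hm : 0 < m) (hy : StrictAnti y)
    (hO : IsOpen O) (hyO : ∀ i, y i ∈ O) (hw : Measurable w)
    (hpos : ∀ x ∈ O, (∀ j, x ≠ y j) → w x ≠ 0) (hr : k + τ = m)
    (hfin : interlacingIntegral τ (k + 1) w y ≠ ∞) :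
    ∫⁻ x in Set.Iio (y ⟨m - 1, by omega⟩),
      w x * ENNReal.ofReal (|x - y ⟨m - 1, by omega⟩| ^ k) ≠ ∞ := by
  refine lintegral_moment_ne_top_of_interlacingIntegral hm hy hO hyO hw hpos (by omega) hfin
    (Fin.last k) measurableSet_Iio (fun x hx j => ⟨fun _ =>
      lt_of_lt_of_le hx (hy.antitone (Fin.le_def.2 (by simp only; omega))), fun h =>
      absurd h (by simp only [Fin.val_last]; omega)⟩) fun x hx i hi z hz => ?_
  have h1 : y ⟨m - 1, by omega⟩ < z := (hz ⟨m - 1, by omega⟩).2 (by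
    have : i.val ≠ k := fun h => hi (Fin.ext h)
    simp only; omega)
  have h2 : x < y ⟨m - 1, by omega⟩ := hx
  rw [abs_of_neg (by linarith), abs_of_pos (by linarith)]
  linarith

end Slots

/-! ### Determinantal formulas for the interlacing integrals -/

/-- The curve `f(x) (1, x, …, x^{d-1})`. -/
def momentCurve (f : ℝ → ℝ) (d : ℕ) (x : ℝ) : Fin d → ℝ := fun k => f x * x ^ (k : ℕ)

lemma rowDet_momentCurve {d : ℕ} (f : ℝ → ℝ) (x : Fin d → ℝ) :
    rowDet (fun a => momentCurve f d (x a)) = (∏ a, f (x a)) * vdm x := by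
  rw [← det_vandermonde_eq_vdm, ← Matrix.det_mul_column]
  rfl

lemma rowDet_sumElim {m r d : ℕ} (e : Fin m ⊕ Fin r ≃ Fin d) (u : Fin m → Fin d → ℝ)
    (v : Fin r → Fin d → ℝ) : rowDet (fun a => Sum.elim u v (e.symm a)) =
      ∑ σ : Equiv.Perm (Fin d), (Equiv.Perm.sign σ : ℤ) *
        ((∏ j, u j (σ (e (Sum.inl j)))) * ∏ i, v i (σ (e (Sum.inr i)))) := by
  rw [rowDet, ← Matrix.det_transpose, Matrix.det_apply']
  refine Finset.sum_congr rfl fun σ _ => ?_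
  rw [← Equiv.prod_comp e, Fintype.prod_sum_type]
  simp

/-- Integrating a determinant over a box, one row for each variable. -/
lemma integral_box_rowDet {m r d : ℕ} (e : Fin m ⊕ Fin r ≃ Fin d) (u : Fin m → Fin d → ℝ)
    {φ : ℝ → Fin d → ℝ} {J : Fin r → Set ℝ} (hφ : ∀ i k, IntegrableOn (fun x => φ x k) (J i)) :
    IntegrableOn (fun z : Fin r → ℝ => rowDet fun a => Sum.elim u (fun i => φ (z i)) (e.symm a))
      {z | ∀ i, z i ∈ J i} ∧
    ∫ z in {z : Fin r → ℝ | ∀ i, z i ∈ J i},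
        rowDet (fun a => Sum.elim u (fun i => φ (z i)) (e.symm a)) =
      rowDet fun a => Sum.elim u (fun i k => ∫ x in J i, φ x k) (e.symm a) := by
  have hbox : (volume : Measure (Fin r → ℝ)).restrict {z | ∀ i, z i ∈ J i} =
      Measure.pi fun i => volume.restrict (J i) := by
    have : {z : Fin r → ℝ | ∀ i, z i ∈ J i} = Set.univ.pi J := by ext; simp
    rw [this, volume_pi, Measure.restrict_pi_pi]
  have hint : ∀ σ : Equiv.Perm (Fin d), Integrable (fun z : Fin r → ℝ =>
      ((Equiv.Perm.sign σ : ℤ) : ℝ) *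
        ((∏ j, u j (σ (e (Sum.inl j)))) * ∏ i, φ (z i) (σ (e (Sum.inr i)))))
      (Measure.pi fun i => volume.restrict (J i)) := fun σ =>
    ((Integrable.fintype_prod (f := fun i x => φ x (σ (e (Sum.inr i)))) fun i =>
      hφ i _).const_mul _).const_mul _
  simp only [IntegrableOn, hbox, rowDet_sumElim]
  refine ⟨integrable_finsetSum _ fun σ _ => hint σ, ?_⟩
  rw [integral_finsetSum _ fun σ _ => hint σ]
  refine Finset.sum_congr rfl fun σ _ => ?_
  rw [integral_const_mul, integral_const_mul,
    integral_fintype_prod_eq_prod fun i x => φ x (σ (e (Sum.inr i)))]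

/-- The same for the integral of a nonnegative function, a constant multiple of the determinant. -/
lemma lintegral_box_rowDet {m r d : ℕ} (e : Fin m ⊕ Fin r ≃ Fin d) (u : Fin m → Fin d → ℝ)
    {φ : ℝ → Fin d → ℝ} {J : Fin r → Set ℝ} (hJ : ∀ i, MeasurableSet (J i))
    (hφ : ∀ i k, IntegrableOn (fun x => φ x k) (J i)) {s : ℝ}
    (hs : ∀ z : Fin r → ℝ, (∀ i, z i ∈ J i) →
      0 ≤ s * rowDet fun a => Sum.elim u (fun i => φ (z i)) (e.symm a)) :
    ∫⁻ z in {z : Fin r → ℝ | ∀ i, z i ∈ J i},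
        ENNReal.ofReal (s * rowDet fun a => Sum.elim u (fun i => φ (z i)) (e.symm a)) =
      ENNReal.ofReal
        (s * rowDet fun a => Sum.elim u (fun i k => ∫ x in J i, φ x k) (e.symm a)) := by
  have hbox : MeasurableSet {z : Fin r → ℝ | ∀ i, z i ∈ J i} := by
    have : {z : Fin r → ℝ | ∀ i, z i ∈ J i} = Set.univ.pi J := by ext; simp
    rw [this]
    exact MeasurableSet.univ_pi hJ
  obtain ⟨h1, h2⟩ := integral_box_rowDet e u hφ
  rw [← h2, ← integral_const_mul, ofReal_integral_eq_lintegral_ofReal (h1.const_mul s)]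
  exact (ae_restrict_iff' hbox).2 (Filter.Eventually.of_forall hs)

lemma strictAnti_of_mem_slotBox {m τ r : ℕ} (hr : r + τ ≤ m + 1) {y : Fin m → ℝ} {z : Fin r → ℝ}
    (hz : z ∈ slotBox τ r y) : StrictAnti z := fun i j hij =>
  lt_of_mem_slot (by have : i.val < j.val := hij; omega) (by omega) (hz i) (hz j)

/-- The integral of the moment curve over a slot. -/
noncomputable def slotMoment (f : ℝ → ℝ) (d : ℕ) {m : ℕ} (y : Fin m → ℝ) (s : ℕ) : Fin d → ℝ :=
  fun k => ∫ x in slot y s, momentCurve f d x k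

section

variable {m r τ : ℕ} {f : ℝ → ℝ} (hf0 : ∀ x, 0 ≤ f x)

include hf0

/-- The interlacing integral is a determinant whose rows are the moments of `f` over the slots. -/
lemma interlacingIntegral_eq_ofReal_rowDet {s : ℝ}
    (hs : ∀ x : Fin r → ℝ, StrictAnti x → s * vdm x = |vdm x|) (hr : r + τ ≤ m + 1)
    {y : Fin m → ℝ} (hint : ∀ (i : Fin r) (k : Fin r),
      IntegrableOn (fun x => momentCurve f r x k) (slot y (i.val + τ))) :
    interlacingIntegral τ r (weight f) y =
      ENNReal.ofReal (s * rowDet fun i : Fin r => slotMoment f r y (i.val + τ)) := by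
  have hsa : ∀ z : Fin r → ℝ, (∀ i, z i ∈ slot y (i.val + τ)) → s * vdm z = |vdm z| := fun z hz =>
    hs z (strictAnti_of_mem_slotBox hr hz)
  have hdet : ∀ z : Fin r → ℝ, (rowDet fun a =>
      Sum.elim (fun j : Fin 0 => j.elim0) (fun i => momentCurve f r (z i))
        ((Equiv.emptySum (Fin 0) (Fin r)).symm a)) = (∏ a, f (z a)) * vdm z := fun z => by
    rw [← rowDet_momentCurve]
    rfl
  have h1 := lintegral_box_rowDet (Equiv.emptySum (Fin 0) (Fin r)) (fun j => j.elim0)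
    (J := fun i : Fin r => slot y (i.val + τ)) (fun i => (isOpen_slot y _).measurableSet) hint
    (s := s) fun z hz => by
      rw [hdet, mul_left_comm s, hsa z hz]
      exact mul_nonneg (Finset.prod_nonneg fun i _ => hf0 _) (abs_nonneg _)
  refine Eq.trans (setLIntegral_congr_fun (measurableSet_slotBox τ r y) fun z hz => ?_) h1
  rw [hdet, mul_left_comm s, hsa z hz, ENNReal.ofReal_mul (Finset.prod_nonneg fun i _ => hf0 _),
    ENNReal.ofReal_prod_of_nonneg fun i _ => hf0 _]
  rfl

/-- The merged integral is a determinant with rows of two kinds: the moment curve at the points `t`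
and the moments of `f` over the slots. -/
lemma prod_mul_mergedIntegral_eq_ofReal_rowDet {N : ℕ} (E : Interlacing τ m r N) {s : ℝ}
    (hs : ∀ x : Fin N → ℝ, StrictAnti x → s * vdm x = |vdm x|) {t : Fin m → ℝ} (ht : StrictAnti t)
    (hint : ∀ (i : Fin r) (k : Fin N),
      IntegrableOn (fun x => momentCurve f N x k) (slot t (i.val + τ))) :
    (∏ j, weight f (t j)) * mergedIntegral E (weight f) t =
      ENNReal.ofReal (s * rowDet fun a => Sum.elim (fun j => momentCurve f N (t j))
        (fun i => slotMoment f N t (i.val + τ)) (E.equiv.symm a)) := by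
  have hsa : ∀ z : Fin r → ℝ, (∀ i, z i ∈ slot t (i.val + τ)) →
      s * vdm (E.merge t z) = |vdm (E.merge t z)| := fun z hz =>
    hs _ ((E.strictAnti_merge_iff t z).2 ⟨ht, hz⟩)
  have hdet : ∀ z : Fin r → ℝ, (rowDet fun a =>
      Sum.elim (fun j => momentCurve f N (t j)) (fun i => momentCurve f N (z i))
        (E.equiv.symm a)) = (∏ a, f (E.merge t z a)) * vdm (E.merge t z) := fun z => by
    rw [← rowDet_momentCurve]
    congr 1
    funext a
    rw [Interlacing.merge, Function.comp]
    rcases E.equiv.symm a with j | i <;> rfl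
  have h1 := lintegral_box_rowDet E.equiv (fun j => momentCurve f N (t j))
    (J := fun i : Fin r => slot t (i.val + τ)) (fun i => (isOpen_slot t _).measurableSet) hint
    (s := s) fun z hz => by
      rw [hdet, mul_left_comm s, hsa z hz]
      exact mul_nonneg (Finset.prod_nonneg fun i _ => hf0 _) (abs_nonneg _)
  have hprod : ∏ j, weight f (t j) ≠ ∞ := ENNReal.prod_ne_top fun i _ => ENNReal.ofReal_ne_top
  rw [mergedIntegral, ← lintegral_const_mul' _ _ hprod]
  refine Eq.trans (setLIntegral_congr_fun (measurableSet_slotBox τ r t) fun z hz => ?_) h1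
  rw [hdet, mul_left_comm s, hsa z hz, ENNReal.ofReal_mul (Finset.prod_nonneg fun i _ => hf0 _),
    ENNReal.ofReal_prod_of_nonneg fun i _ => hf0 _, ← mul_assoc, ← E.prod_merge]
  rfl

end

/-! ### Primitives of the moment curve -/

/-- All moments of `f` of order less than `d` converge at `+∞`. -/
def UpperMoments (f : ℝ → ℝ) (d : ℕ) : Prop :=
  ∀ b, 0 < f b → ∀ k : Fin d, IntegrableOn (fun x => momentCurve f d x k) (Set.Ioi b)

/-- All moments of `f` of order less than `d` converge at `-∞`. -/
def LowerMoments (f : ℝ → ℝ) (d : ℕ) : Prop :=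
  ∀ b, 0 < f b → ∀ k : Fin d, IntegrableOn (fun x => momentCurve f d x k) (Set.Iio b)

/-- The primitive of the moment curve vanishing at `b`. -/
noncomputable def momentPrimitive (f : ℝ → ℝ) (d : ℕ) (b x : ℝ) : Fin d → ℝ :=
  fun k => ∫ t in b..x, momentCurve f d t k

/-- The limit of the primitive of the moment curve at `+∞`. -/
noncomputable def upperLimit (f : ℝ → ℝ) (d : ℕ) (b : ℝ) : Fin d → ℝ :=
  fun k => ∫ t in Set.Ioi b, momentCurve f d t k

/-- The limit of the primitive of the moment curve at `-∞`. -/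
noncomputable def lowerLimit (f : ℝ → ℝ) (d : ℕ) (b : ℝ) : Fin d → ℝ :=
  fun k => -∫ t in Set.Iio b, momentCurve f d t k

/-- Away from `p`, the monomials of degree at most `n` are bounded by a multiple of `|x - p| ^ n`,
so that the moment of order `n` about `p` controls those of lower order. -/
lemma integrableOn_of_lintegral_moment {f : ℝ → ℝ} (hf0 : ∀ x, 0 ≤ f x) (hfm : Measurable f)
    {S : Set ℝ} (hS : MeasurableSet S) {p ε : ℝ} (hε : 0 < ε) (hSp : ∀ x ∈ S, ε ≤ |x - p|) {n : ℕ}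
    (h : ∫⁻ x in S, weight f x * ENNReal.ofReal (|x - p| ^ n) ≠ ∞) {d : ℕ} (hd : d ≤ n + 1)
    (k : Fin d) : IntegrableOn (fun x => momentCurve f d x k) S := by
  have h1 : IntegrableOn (fun x => f x * |x - p| ^ n) S := by
    refine ⟨(by fun_prop : Measurable fun x => f x * |x - p| ^ n).aestronglyMeasurable, ?_⟩
    rw [hasFiniteIntegral_iff_ofReal (Filter.Eventually.of_forall fun x =>
      mul_nonneg (hf0 x) (by positivity))]
    refine lt_of_le_of_lt (le_of_eq ?_) h.lt_top
    refine lintegral_congr fun x => ?_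
    rw [ENNReal.ofReal_mul (hf0 x)]
    rfl
  set C : ℝ := (1 + |p|) / ε + 1 with hC
  refine (h1.const_mul (C ^ n)).mono'
    (by unfold momentCurve; fun_prop : Measurable fun x => momentCurve f d x k).aestronglyMeasurable
    ((ae_restrict_iff' hS).2 (Filter.Eventually.of_forall fun x hx => ?_))
  have h2 : 1 + |x| ≤ C * |x - p| := by
    have h3 : |x| ≤ |p| + |x - p| := by
      calc |x| = |p + (x - p)| := by ring_nf
        _ ≤ _ := abs_add_le _ _
    have h4 : 1 + |p| ≤ (1 + |p|) / ε * |x - p| := by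
      rw [div_mul_eq_mul_div, le_div_iff₀ hε]
      exact mul_le_mul_of_nonneg_left (hSp x hx) (by positivity)
    rw [hC, add_mul]
    linarith
  rw [momentCurve, Real.norm_eq_abs, abs_mul, abs_of_nonneg (hf0 x), abs_pow]
  calc f x * |x| ^ (k : ℕ) ≤ f x * (C * |x - p|) ^ n := by
        refine mul_le_mul_of_nonneg_left ?_ (hf0 x)
        calc |x| ^ (k : ℕ) ≤ (1 + |x|) ^ (k : ℕ) :=
              pow_le_pow_left₀ (abs_nonneg x) (by linarith) _
          _ ≤ (1 + |x|) ^ n := pow_le_pow_right₀ (by linarith [abs_nonneg x]) (by omega)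
          _ ≤ _ := pow_le_pow_left₀ (by positivity) h2 _
    _ = C ^ n * (f x * |x - p| ^ n) := by rw [mul_pow]; ring

section Interval

variable {I : Set ℝ} (hI : IsOpen I) (hI' : I.OrdConnected) {f : ℝ → ℝ} (hfc : ContinuousOn f I)
  (hfI : ∀ x, x ∉ I → f x = 0)

include hfc in
lemma continuousOn_momentCurve (d : ℕ) : ContinuousOn (momentCurve f d) I :=
  continuousOn_pi.2 fun _ => hfc.mul (continuous_pow _).continuousOn

include hI hfc in
lemma isOpen_pos (hfI : ∀ x, x ∉ I → f x = 0) : IsOpen {x | 0 < f x} := by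
  have : {x | 0 < f x} = I ∩ f ⁻¹' Set.Ioi 0 := by
    ext x
    refine ⟨fun h => ⟨?_, h⟩, fun h => h.2⟩
    by_contra hx
    exact (h : 0 < f x).ne' (hfI x hx)
  rw [this]
  exact hfc.isOpen_inter_preimage hI isOpen_Ioi

include hI hfc in
lemma measurable_of_continuousOn (hfI : ∀ x, x ∉ I → f x = 0) : Measurable f := by
  classical
  have : f = I.piecewise f fun _ => 0 := by
    funext x
    by_cases hx : x ∈ I
    · rw [Set.piecewise_eq_of_mem _ _ _ hx]
    · rw [Set.piecewise_eq_of_notMem _ _ _ hx, hfI x hx]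
  rw [this]
  exact hfc.measurable_piecewise continuousOn_const hI.measurableSet

include hfI in
lemma mem_of_pos {x : ℝ} (hx : 0 < f x) : x ∈ I := by
  by_contra h
  exact hx.ne' (hfI x h)

include hI' hfc in
lemma integrableOn_Icc_momentCurve {a b : ℝ} (ha : a ∈ I) (hb : b ∈ I) (d : ℕ) (k : Fin d) :
    IntegrableOn (fun x => momentCurve f d x k) (Set.Icc a b) :=
  (((continuousOn_apply k _).comp (continuousOn_momentCurve hfc d) fun _ _ => Set.mem_univ _).mono
    (hI'.out ha hb)).integrableOn_Icc

include hI' hfc in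
lemma intervalIntegrable_momentCurve {a b : ℝ} (ha : a ∈ I) (hb : b ∈ I) (d : ℕ) (k : Fin d) :
    IntervalIntegrable (fun x => momentCurve f d x k) volume a b := by
  refine ContinuousOn.intervalIntegrable ?_
  exact ((continuousOn_pi.1 (continuousOn_momentCurve hfc d)) k).mono (hI'.uIcc_subset ha hb)

include hI hI' hfc in
lemma hasDerivAt_momentPrimitive {b x : ℝ} (hb : b ∈ I) (hx : x ∈ I) (d : ℕ) :
    HasDerivAt (momentPrimitive f d b) (momentCurve f d x) x := by
  refine hasDerivAt_pi.2 fun k => ?_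
  have hk := (continuousOn_pi.1 (continuousOn_momentCurve hfc d)) k
  exact intervalIntegral.integral_hasDerivAt_right
    (intervalIntegrable_momentCurve hI' hfc hb hx d k)
    (hk.stronglyMeasurableAtFilter hI x hx) (hk.continuousAt (hI.mem_nhds hx))

variable {m : ℕ} {y : Fin m → ℝ}

lemma slot_zero (hy : StrictAnti y) (hm : 0 < m) : slot y 0 = Set.Ioi (y ⟨0, hm⟩) := by
  ext x
  refine ⟨fun h => (h ⟨0, hm⟩).2 le_rfl, fun h j => ⟨fun h' => absurd h' (by omega), fun _ => ?_⟩⟩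
  exact lt_of_le_of_lt (hy.antitone (Fin.le_def.2 (by simp))) h

lemma slot_succ (hy : StrictAnti y) {s : ℕ} (hs : s + 1 < m) :
    slot y (s + 1) = Set.Ioo (y ⟨s + 1, hs⟩) (y ⟨s, by omega⟩) := by
  ext x
  refine ⟨fun h => ⟨(h ⟨s + 1, hs⟩).2 le_rfl, (h ⟨s, by omega⟩).1 (by simp)⟩,
    fun h j => ⟨fun h' => ?_, fun h' => ?_⟩⟩
  · exact lt_of_lt_of_le h.2 (hy.antitone (Fin.le_def.2 (by simp only; omega)))
  · exact lt_of_le_of_lt (hy.antitone (Fin.le_def.2 (by simp only; omega))) h.1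

lemma slot_last (hy : StrictAnti y) {l : ℕ} (hl : l + 1 = m) :
    slot y m = Set.Iio (y ⟨l, by omega⟩) := by
  ext x
  refine ⟨fun h => (h ⟨l, by omega⟩).1 (by simp only; omega),
    fun h j => ⟨fun h' => ?_, fun h' => absurd j.isLt (by omega)⟩⟩
  exact lt_of_lt_of_le h (hy.antitone (Fin.le_def.2 (by simp only; omega)))

lemma slotMoment_last {b : ℝ} (hb : 0 < f b) {d : ℕ} (hM : LowerMoments f d) (hy : StrictAnti y)
    (hyO : ∀ i, 0 < f (y i)) {l : ℕ} (hl : l + 1 = m) :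
    slotMoment f d y m = momentPrimitive f d b (y ⟨l, by omega⟩) - lowerLimit f d b := by
  funext k
  rw [slotMoment, slot_last hy hl]
  have := intervalIntegral.integral_Iio_sub_Iio' (hM _ (hyO ⟨l, by omega⟩) k) (hM _ hb k)
  simp only [Pi.sub_apply, lowerLimit, momentPrimitive]
  linarith

include hI' hfc hfI

lemma slotMoment_zero {b : ℝ} (hb : 0 < f b) {d : ℕ} (hM : UpperMoments f d) (hy : StrictAnti y)
    (hyO : ∀ i, 0 < f (y i)) (hm : 0 < m) :
    slotMoment f d y 0 = upperLimit f d b - momentPrimitive f d b (y ⟨0, hm⟩) := by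
  funext k
  rw [slotMoment, slot_zero hy hm]
  have := intervalIntegral.integral_interval_add_Ioi'
    (intervalIntegrable_momentCurve hI' hfc (mem_of_pos hfI hb) (mem_of_pos hfI (hyO ⟨0, hm⟩)) d k)
    (hM _ (hyO ⟨0, hm⟩) k)
  simp only [Pi.sub_apply, upperLimit, momentPrimitive]
  linarith

lemma slotMoment_succ {b : ℝ} (hb : 0 < f b) (d : ℕ) (hy : StrictAnti y)
    (hyO : ∀ i, 0 < f (y i)) {s : ℕ} (hs : s + 1 < m) :
    slotMoment f d y (s + 1) = momentPrimitive f d b (y ⟨s, by omega⟩) -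
      momentPrimitive f d b (y ⟨s + 1, hs⟩) := by
  have hI1 := fun i => mem_of_pos hfI (hyO i)
  have hlt : y ⟨s + 1, hs⟩ ≤ y ⟨s, by omega⟩ := hy.antitone (Fin.le_def.2 (by simp))
  funext k
  rw [slotMoment, slot_succ hy hs, Pi.sub_apply, momentPrimitive, momentPrimitive,
    intervalIntegral.integral_interval_sub_left
      (intervalIntegrable_momentCurve hI' hfc (mem_of_pos hfI hb) (hI1 _) d k)
      (intervalIntegrable_momentCurve hI' hfc (mem_of_pos hfI hb) (hI1 _) d k),
    intervalIntegral.integral_of_le hlt, integral_Ioc_eq_integral_Ioo]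

lemma integrableOn_slot {d τ r : ℕ} (hu : τ = 0 → 0 < r → UpperMoments f d)
    (hl : r + τ = m + 1 → LowerMoments f d) (hr : r + τ ≤ m + 1) (hm : 0 < m)
    (hy : StrictAnti y) (hyO : ∀ i, 0 < f (y i)) (i : Fin r) (k : Fin d) :
    IntegrableOn (fun x => momentCurve f d x k) (slot y (i.val + τ)) := by
  obtain ⟨s, hs⟩ : ∃ s, s = i.val + τ := ⟨_, rfl⟩
  rw [← hs]
  rcases s with _ | s
  · rw [slot_zero hy hm]
    exact hu (by omega) i.pos _ (hyO _) k
  · rcases lt_or_ge (s + 1) m with h | h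
    · rw [slot_succ hy h]
      exact (integrableOn_Icc_momentCurve hI' hfc (mem_of_pos hfI (hyO _))
        (mem_of_pos hfI (hyO _)) d k).mono_set Set.Ioo_subset_Icc_self
    · obtain rfl : s + 1 = m := by omega
      rw [slot_last hy rfl]
      exact hl (by omega) _ (hyO _) k

include hI

lemma upperMoments_of_lintegral (hf0 : ∀ x, 0 ≤ f x) {p : ℝ} (hp : 0 < f p) {n : ℕ}
    (h : ∫⁻ x in Set.Ioi p, weight f x * ENNReal.ofReal (|x - p| ^ n) ≠ ∞) {d : ℕ}
    (hd : d ≤ n + 1) : UpperMoments f d := by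
  intro b hb k
  have hpI := mem_of_pos hfI hp
  have hbI := mem_of_pos hfI hb
  obtain ⟨c, hpc, hcI⟩ : ∃ c > p, c ∈ I :=
    Filter.nonempty_of_mem (f := nhdsWithin p (Set.Ioi p)) (Filter.inter_mem self_mem_nhdsWithin
      (nhdsWithin_le_nhds (hI.mem_nhds hpI)))
  have h1 : IntegrableOn (fun x => momentCurve f d x k) (Set.Ioi c) := by
    refine integrableOn_of_lintegral_moment hf0 (measurable_of_continuousOn hI hfc hfI)
      measurableSet_Ioi (sub_pos.2 hpc) (fun x hx => ?_) (n := n) (p := p) ?_ hd k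
    · have : c < x := hx
      rw [abs_of_pos (by linarith)]
      linarith
    · exact ne_top_of_le_ne_top h (lintegral_mono_set (Set.Ioi_subset_Ioi hpc.le))
  refine (h1.union (integrableOn_Icc_momentCurve hI' hfc hbI hcI d k)).mono_set fun x hx => ?_
  rcases le_or_gt x c with hxc | hxc
  · exact Or.inr ⟨le_of_lt hx, hxc⟩
  · exact Or.inl hxc

lemma lowerMoments_of_lintegral (hf0 : ∀ x, 0 ≤ f x) {p : ℝ} (hp : 0 < f p) {n : ℕ}
    (h : ∫⁻ x in Set.Iio p, weight f x * ENNReal.ofReal (|x - p| ^ n) ≠ ∞) {d : ℕ}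
    (hd : d ≤ n + 1) : LowerMoments f d := by
  intro b hb k
  have hpI := mem_of_pos hfI hp
  have hbI := mem_of_pos hfI hb
  obtain ⟨c, hpc, hcI⟩ : ∃ c < p, c ∈ I :=
    Filter.nonempty_of_mem (f := nhdsWithin p (Set.Iio p)) (Filter.inter_mem self_mem_nhdsWithin
      (nhdsWithin_le_nhds (hI.mem_nhds hpI)))
  have h1 : IntegrableOn (fun x => momentCurve f d x k) (Set.Iio c) := by
    refine integrableOn_of_lintegral_moment hf0 (measurable_of_continuousOn hI hfc hfI)
      measurableSet_Iio (sub_pos.2 hpc) (fun x hx => ?_) (n := n) (p := p) ?_ hd k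
    · have : x < c := hx
      rw [abs_of_neg (by linarith)]
      linarith
    · exact ne_top_of_le_ne_top h (lintegral_mono_set (Set.Iio_subset_Iio hpc.le))
  refine (h1.union (integrableOn_Icc_momentCurve hI' hfc hcI hbI d k)).mono_set fun x hx => ?_
  rcases lt_or_ge x c with hxc | hxc
  · exact Or.inl hxc
  · exact Or.inr ⟨hxc, le_of_lt hx⟩

end Interval

/-! ### Row operations -/

/-- The indicator of the index `k`, as a coefficient vector. -/
def indexCoeff (N k : ℕ) : Fin N → ℝ := fun j => if j.val = k then 1 else 0

lemma linearCombination_indexCoeff {E : Type*} [AddCommGroup E] [Module ℝ E] {N k : ℕ}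
    (X : Fin N → E) (hk : k < N) :
    Fintype.linearCombination ℝ X (indexCoeff N k) = X ⟨k, hk⟩ := by
  rw [Fintype.linearCombination_apply, Finset.sum_eq_single (⟨k, hk⟩ : Fin N)]
  · simp [indexCoeff]
  · intro b _ hb
    have : b.val ≠ k := fun h => hb (Fin.ext h)
    simp [indexCoeff, this]
  · simp

/-- Constant row operations multiply the determinant by a constant. -/
lemma rowDet_linearCombination {k : ℕ} (φ X : Fin k → Fin k → ℝ) :
    rowDet (fun i => Fintype.linearCombination ℝ X (φ i)) =
      Matrix.det (Matrix.of φ) * rowDet X := by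
  rw [rowDet, rowDet, ← Matrix.det_mul]
  congr 1
  ext i j
  simp [Fintype.linearCombination_apply, Matrix.mul_apply]

lemma linearCombination_cons {E : Type*} [AddCommGroup E] [Module ℝ E] {N : ℕ} (u : E)
    (X : Fin N → E) (a : ℝ) (c : Fin N → ℝ) :
    Fintype.linearCombination ℝ (Fin.cons u X : Fin (N + 1) → E) (Fin.cons a c : Fin (N + 1) → ℝ) =
      a • u + Fintype.linearCombination ℝ X c := by
  simp [Fintype.linearCombination_apply, Fin.sum_univ_succ]

section RowOperations

variable {k : ℕ} {ρ : ℕ → Fin (k + 1) → ℝ} {l : Fin (k + 1) → ℝ}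

/-- Constant row operations for a primitive that vanishes at `+∞`, if there is no slot at `-∞`. The
rows `X` are values of the primitive, the rows `W` its increments over the slots; `κ` depends on the
coefficients `ρ` only. -/
lemma exists_rowDet_upper (ρ : ℕ → Fin (k + 1) → ℝ) : ∃ κ : ℝ,
    ∀ (X : Fin (k + 1) → Fin (k + 1) → ℝ) (W : ℕ → Fin (k + 1) → ℝ), W 0 = -X 0 →
      (∀ i < k, W (i + 1) = Fintype.linearCombination ℝ X (ρ i)) →
      rowDet (fun i : Fin (k + 1) => W i.val) = κ * rowDet X := by
  refine ⟨Matrix.det (Matrix.of (Fin.cons (-indexCoeff (k + 1) 0) fun i : Fin k => ρ i)),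
    fun X W h0 h1 => ?_⟩
  rw [← rowDet_linearCombination]
  congr 1
  funext i
  induction i using Fin.cases with
  | zero => simp [map_neg, linearCombination_indexCoeff, h0]
  | succ i => simp [h1 i i.isLt]

/-- Row operations for a primitive that vanishes at `-∞`, if there is no slot at `+∞`. -/
lemma exists_rowDet_lower (ρ : ℕ → Fin (k + 1) → ℝ) (l : Fin (k + 1) → ℝ) : ∃ κ : ℝ,
    ∀ (X : Fin (k + 1) → Fin (k + 1) → ℝ) (W : ℕ → Fin (k + 1) → ℝ),
      W (k + 1) = Fintype.linearCombination ℝ X l →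
      (∀ i < k, W (i + 1) = Fintype.linearCombination ℝ X (ρ i)) →
      rowDet (fun i : Fin (k + 1) => W (i.val + 1)) = κ * rowDet X := by
  refine ⟨Matrix.det (Matrix.of (Fin.snoc (fun i : Fin k => ρ i) l)), fun X W h0 h1 => ?_⟩
  rw [← rowDet_linearCombination]
  congr 1
  funext i
  induction i using Fin.lastCases with
  | last => simp [h0]
  | cast i => simp [h1 i i.isLt]

/-- Row operations for a primitive that vanishes at `-∞` and has the limit `u` at `+∞`. -/
lemma exists_rowDet_both (ρ : ℕ → Fin (k + 1) → ℝ) (l : Fin (k + 1) → ℝ) : ∃ κ : ℝ,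
    ∀ (u : Fin (k + 2) → ℝ) (X : Fin (k + 1) → Fin (k + 2) → ℝ) (W : ℕ → Fin (k + 2) → ℝ),
      W 0 = u - X 0 → W (k + 1) = Fintype.linearCombination ℝ X l →
      (∀ i < k, W (i + 1) = Fintype.linearCombination ℝ X (ρ i)) →
      rowDet (fun i : Fin (k + 2) => W i.val) =
        κ * rowDet (Fin.cons u X : Fin (k + 1 + 1) → Fin (k + 2) → ℝ) := by
  refine ⟨Matrix.det (Matrix.of (Fin.cons (Fin.cons 1 (-indexCoeff (k + 1) 0))
    (Fin.snoc (fun i : Fin k => Fin.cons 0 (ρ i)) (Fin.cons 0 l) :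
      Fin (k + 1) → Fin (k + 1 + 1) → ℝ) : Fin (k + 1 + 1) → Fin (k + 1 + 1) → ℝ)),
    fun u X W h0 h1 h2 => ?_⟩
  rw [← rowDet_linearCombination]
  congr 1
  funext i
  induction i using Fin.cases with
  | zero =>
    rw [Fin.cons_zero, linearCombination_cons, map_neg, linearCombination_indexCoeff X (by omega)]
    simp [h0, sub_eq_add_neg]
  | succ i =>
    induction i using Fin.lastCases with
    | last => simp [h1, linearCombination_cons]
    | cast i => simp [h2 i i.isLt, linearCombination_cons]

lemma rowDet_cons_zero {k : ℕ} (x : Fin (k + 1) → ℝ) (hx : x 0 = 1) (v : Fin k → Fin k → ℝ) :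
    rowDet (Fin.cons x (fun i => Fin.cons 0 (v i)) : Fin (k + 1) → Fin (k + 1) → ℝ) = rowDet v := by
  rw [rowDet, Matrix.det_succ_column_zero, Fin.sum_univ_succ]
  simp [hx]
  rfl

/-- Row operations without slots at `±∞`. The missing row is supplied by a coordinate in which the
rows `W` vanish. -/
lemma exists_rowDet_neither (ρ : ℕ → Fin (k + 1) → ℝ) : ∃ κ : ℝ,
    ∀ (X : Fin (k + 1) → Fin (k + 1) → ℝ) (W : ℕ → Fin k → ℝ), X 0 0 = 1 →
      (∀ i < k, (Fin.cons 0 (W (i + 1)) : Fin (k + 1) → ℝ) =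
        Fintype.linearCombination ℝ X (ρ i)) →
      rowDet (fun i : Fin k => W (i.val + 1)) = κ * rowDet X := by
  refine ⟨Matrix.det (Matrix.of (Fin.cons (indexCoeff (k + 1) 0) fun i : Fin k => ρ i)),
    fun X W h0 h1 => ?_⟩
  rw [← rowDet_linearCombination, ← rowDet_cons_zero (X 0) h0]
  congr 1
  funext i
  induction i using Fin.cases with
  | zero => simp [linearCombination_indexCoeff]
  | succ i => simp [h1 i i.isLt]

lemma rowDet_cons_sub {k : ℕ} (a b : Fin (k + 1) → ℝ) (v : Fin k → Fin (k + 1) → ℝ) :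
    rowDet (Fin.cons (a - b) v : Fin (k + 1) → Fin (k + 1) → ℝ) =
      rowDet (Fin.cons a v : Fin (k + 1) → Fin (k + 1) → ℝ) -
        rowDet (Fin.cons b v : Fin (k + 1) → Fin (k + 1) → ℝ) := by
  have h := (Matrix.detRowAlternating (R := ℝ) (n := Fin (k + 1))).toMultilinearMap.cons_add
    v (a - b) b
  rw [sub_add_cancel] at h
  exact eq_sub_of_add_eq h.symm

/-- Row operations for a primitive that has the limits `u` at `+∞` and `-u` at `-∞`. In even
dimension the two determinants that omit the last and the first of `k + 2` rows combine into one: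
moving the last row to the front changes the sign, and `u` cancels in `W 0 - W (k + 1)`. -/
lemma exists_rowDet_add (hk : Odd k) (ρ : ℕ → Fin (k + 1) → ℝ) (l : Fin (k + 1) → ℝ) : ∃ κ : ℝ,
    ∀ (u : Fin (k + 1) → ℝ) (X : Fin (k + 1) → Fin (k + 1) → ℝ) (W : ℕ → Fin (k + 1) → ℝ),
      W 0 = u - X 0 → W (k + 1) = Fintype.linearCombination ℝ X l + u →
      (∀ i < k, W (i + 1) = Fintype.linearCombination ℝ X (ρ i)) →
      rowDet (fun i : Fin (k + 1) => W i.val) + rowDet (fun i : Fin (k + 1) => W (i.val + 1)) =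
        κ * rowDet X := by
  refine ⟨Matrix.det (Matrix.of (Fin.cons (-indexCoeff (k + 1) 0 - l) fun i : Fin k => ρ i)),
    fun u X W h0 h1 h2 => ?_⟩
  have hrot : rowDet (fun i : Fin (k + 1) => W (i.val + 1)) =
      -rowDet (Fin.cons (W (k + 1)) fun i : Fin k => W (i.val + 1) : Fin (k + 1) → _) := by
    have h3 := rowDet_perm (Fin.cons (W (k + 1)) fun i : Fin k => W (i.val + 1) : Fin (k + 1) → _)
      (finRotate (k + 1))
    rw [sign_finRotate, Nat.add_sub_cancel, hk.neg_one_pow] at h3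
    simp only [Units.val_neg, Units.val_one, Int.cast_neg, Int.cast_one, neg_mul, one_mul] at h3
    rw [← h3]
    congr 1
    funext i
    induction i using Fin.lastCases with
    | last => simp
    | cast i => simp [Fin.coeSucc_eq_succ]
  have hcons : (fun i : Fin (k + 1) => W i.val) =
      Fin.cons (W 0) fun i : Fin k => W (i.val + 1) := by
    funext i
    induction i using Fin.cases <;> simp
  rw [hrot, hcons, ← sub_eq_add_neg, ← rowDet_cons_sub, ← rowDet_linearCombination]
  congr 1
  funext i
  induction i using Fin.cases with
  | zero =>
    rw [Fin.cons_zero, Fin.cons_zero, map_sub, map_neg,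
      linearCombination_indexCoeff X (by omega), h0, h1, Fin.zero_eta]
    abel
  | succ i => simp [h2 i i.isLt]

end RowOperations

/-! ### The rows of the two determinants -/

/-- The rows of the determinant of the merged integral at `t`: the moment curve at a point of `t`
at odd places, the moments over a slot of `t` at even places. -/
noncomputable def mergedRow (f : ℝ → ℝ) (d : ℕ) {n : ℕ} (t : Fin n → ℝ) (g : ℕ) : Fin d → ℝ :=
  if g % 2 = 1 then (if h : g / 2 < n then momentCurve f d (t ⟨g / 2, h⟩) else 0)
  else slotMoment f d t (g / 2)

/-- The coefficients of the difference of two consecutive rows, which is the integral of the moment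
curve over the slot between two consecutive points. -/
def slotCoeff (N i : ℕ) : Fin N → ℝ := indexCoeff N i - indexCoeff N (i + 1)

/-- The coefficients of the inner rows of the merged determinant in terms of the rows
`F(t₀), F'(t₀), F(t₁), F'(t₁), …`: they are alternately `F'(t_j)` and `F(t_j) - F(t_{j+1})`. -/
def mergedCoeff (N i : ℕ) : Fin N → ℝ :=
  if i % 2 = 0 then indexCoeff N (i + 1) else indexCoeff N (i - 1) - indexCoeff N (i + 1)

lemma doubled_even {E : Type*} {n : ℕ} (F F' : ℝ → E) (t : Fin n → ℝ) {j : ℕ} (hj : 2 * j < 2 * n) :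
    doubled F F' t ⟨2 * j, hj⟩ = F (t ⟨j, by omega⟩) := by
  simp [doubled]

lemma doubled_odd {E : Type*} {n : ℕ} (F F' : ℝ → E) (t : Fin n → ℝ) {j : ℕ}
    (hj : 2 * j + 1 < 2 * n) : doubled F F' t ⟨2 * j + 1, hj⟩ = F' (t ⟨j, by omega⟩) := by
  have h1 : (2 * j + 1) / 2 = j := by omega
  simp [doubled, h1, Nat.add_mod]

section Rows

variable {I : Set ℝ} (hI : IsOpen I) (hI' : I.OrdConnected) {f : ℝ → ℝ} (hfc : ContinuousOn f I)
  (hfI : ∀ x, x ∉ I → f x = 0) {d m n : ℕ} {y : Fin m → ℝ} {t : Fin n → ℝ} {b : ℝ} (hb : 0 < f b)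
  {F : ℝ → Fin d → ℝ} {c : Fin d → ℝ} (hFG : ∀ x, F x = momentPrimitive f d b x - c)

include hI' hfc hfI hb hFG

lemma slotMoment_zero_shift (hM : UpperMoments f d) (hy : StrictAnti y) (hyO : ∀ i, 0 < f (y i))
    (hm : 0 < m) : slotMoment f d y 0 = (upperLimit f d b - c) - F (y ⟨0, hm⟩) := by
  rw [slotMoment_zero hI' hfc hfI hb hM hy hyO hm, hFG]
  abel

lemma slotMoment_succ_shift (hy : StrictAnti y) (hyO : ∀ i, 0 < f (y i)) {i : ℕ} (hi : i + 1 < m) :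
    slotMoment f d y (i + 1) =
      Fintype.linearCombination ℝ (fun j => F (y j)) (slotCoeff m i) := by
  rw [slotMoment_succ hI' hfc hfI hb d hy hyO hi, slotCoeff, map_sub,
    linearCombination_indexCoeff _ (by omega), linearCombination_indexCoeff _ hi, hFG, hFG]
  abel

omit hI' hfc hfI in
lemma slotMoment_last_shift (hM : LowerMoments f d) (hy : StrictAnti y) (hyO : ∀ i, 0 < f (y i))
    {l : ℕ} (hl : l + 1 = m) : slotMoment f d y m =
      Fintype.linearCombination ℝ (fun j => F (y j)) (indexCoeff m l) - (lowerLimit f d b - c) := by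
  rw [slotMoment_last hb hM hy hyO hl, linearCombination_indexCoeff _ (by omega), hFG]
  abel

lemma mergedRow_zero (hM : UpperMoments f d) (ht : StrictAnti t) (htO : ∀ i, 0 < f (t i))
    (hn : 0 < 2 * n) : mergedRow f d t 0 = (upperLimit f d b - c) -
      doubled F (momentCurve f d) t ⟨0, hn⟩ := by
  have h1 := slotMoment_zero_shift hI' hfc hfI hb hFG hM ht htO (by omega)
  have h2 := doubled_even F (momentCurve f d) t (j := 0) hn
  rw [mergedRow, if_neg (by omega)]
  exact h1.trans (by rw [← h2])

lemma mergedRow_succ (ht : StrictAnti t) (htO : ∀ i, 0 < f (t i)) {i : ℕ} (hi : i + 1 < 2 * n) :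
    mergedRow f d t (i + 1) = Fintype.linearCombination ℝ (doubled F (momentCurve f d) t)
      (mergedCoeff (2 * n) i) := by
  obtain ⟨j, rfl | rfl⟩ := Nat.even_or_odd' i
  · have h1 : (2 * j + 1) / 2 = j := by omega
    rw [mergedRow, if_pos (by omega), mergedCoeff, if_pos (by omega),
      linearCombination_indexCoeff _ hi, doubled_odd, dif_pos (by omega)]
    simp only [h1]
  · have h1 : (2 * j + 1 + 1) / 2 = j + 1 := by omega
    have h2 := slotMoment_succ_shift hI' hfc hfI hb hFG ht htO (i := j) (by omega)
    rw [mergedRow, if_neg (by omega), mergedCoeff, if_neg (by omega), map_sub, Nat.add_sub_cancel,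
      linearCombination_indexCoeff _ hi, linearCombination_indexCoeff _ (by omega), h1, h2,
      doubled_even, slotCoeff, map_sub, linearCombination_indexCoeff _ (by omega),
      linearCombination_indexCoeff _ (by omega)]
    congr 1
    exact (doubled_even F (momentCurve f d) t (j := j + 1) (by omega)).symm

omit hI' hfc hfI in
lemma mergedRow_last (hM : LowerMoments f d) (ht : StrictAnti t) (htO : ∀ i, 0 < f (t i))
    (hn : 0 < n) : mergedRow f d t (2 * n) =
      Fintype.linearCombination ℝ (doubled F (momentCurve f d) t)
        (indexCoeff (2 * n) (2 * (n - 1))) - (lowerLimit f d b - c) := by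
  have h1 : 2 * n / 2 = n := by omega
  rw [mergedRow, if_neg (by omega), h1,
    slotMoment_last_shift hb hFG hM ht htO (l := n - 1) (by omega),
    linearCombination_indexCoeff _ (by omega), linearCombination_indexCoeff _ (by omega),
    doubled_even]

end Rows

section Formulas

variable {I : Set ℝ} (hI' : I.OrdConnected) {f : ℝ → ℝ} (hf0 : ∀ x, 0 ≤ f x)
  (hfc : ContinuousOn f I) (hfI : ∀ x, x ∉ I → f x = 0) {n d r τ : ℕ} (hn : 0 < n)
  {s : ℝ} (hs : ∀ x : Fin d → ℝ, StrictAnti x → s * vdm x = |vdm x|)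
  (hu : τ = 0 → UpperMoments f d) (hl : d + τ = 2 * n + 1 → LowerMoments f d)
  (hd : d + τ ≤ 2 * n + 1)

include hI' hf0 hfc hfI hn hs hu hl hd

lemma interlacingIntegral_eq {y : Fin (2 * n) → ℝ} (hy : StrictAnti y) (hyO : ∀ i, 0 < f (y i)) :
    interlacingIntegral τ d (weight f) y =
      ENNReal.ofReal (s * rowDet fun i : Fin d => slotMoment f d y (i.val + τ)) :=
  interlacingIntegral_eq_ofReal_rowDet hf0 hs hd fun i k =>
    integrableOn_slot hI' hfc hfI (fun h _ => hu h) hl hd (by omega) hy hyO i k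

lemma prod_mul_mergedIntegral_eq (E : Interlacing τ n r d) {t : Fin n → ℝ} (ht : StrictAnti t)
    (htO : ∀ i, 0 < f (t i)) : (∏ j, weight f (t j)) * mergedIntegral E (weight f) t =
      ENNReal.ofReal (s * rowDet fun i : Fin d => mergedRow f d t (i.val + τ)) := by
  have hc := E.card_eq
  have hτ := E.le_one
  rw [prod_mul_mergedIntegral_eq_ofReal_rowDet hf0 E hs ht fun i k =>
    integrableOn_slot hI' hfc hfI (fun h _ => hu h) (fun h => hl (by omega)) (by omega) hn ht htO
      i k]
  congr 3
  funext a
  obtain ⟨a, rfl⟩ := E.equiv.surjective a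
  rw [Equiv.symm_apply_apply]
  rcases a with j | i
  · have h1 : 2 * j.val + 1 - τ + τ = 2 * j.val + 1 := by omega
    have h2 : (2 * j.val + 1) / 2 = j.val := by omega
    rw [Sum.elim_inl, E.inl, h1, mergedRow, if_pos (by omega), dif_pos (by omega)]
    simp only [h2]
  · have h1 : (2 * i.val + τ + τ) / 2 = i.val + τ := by omega
    rw [Sum.elim_inr, E.inr, mergedRow, if_neg (by omega), h1]

end Formulas

/-! ### Moments from a finite value of an integral -/

section Moments

variable {I : Set ℝ} (hI : IsOpen I) (hI' : I.OrdConnected) {f : ℝ → ℝ} (hf0 : ∀ x, 0 ≤ f x)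
  (hfc : ContinuousOn f I) (hfI : ∀ x, x ∉ I → f x = 0) {m d r τ : ℕ} {y : Fin m → ℝ}
  (hm : 0 < m) (hy : StrictAnti y) (hyO : ∀ i, 0 < f (y i))

lemma measurable_weight {f : ℝ → ℝ} (hf : Measurable f) : Measurable (weight f) := hf.ennreal_ofReal

lemma measurable_weight_mul (hf : Measurable f) (y : Fin m → ℝ) :
    Measurable fun x => weight f x * ENNReal.ofReal (∏ j, |x - y j|) :=
  (measurable_weight hf).mul
    (by fun_prop : Measurable fun x : ℝ => ∏ j, |x - y j|).ennreal_ofReal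

lemma weight_mul_ne_zero {x : ℝ} (hx : 0 < f x) (hxy : ∀ j, x ≠ y j) :
    weight f x * ENNReal.ofReal (∏ j, |x - y j|) ≠ 0 := by
  refine mul_ne_zero (by simpa [weight] using hx) ?_
  have : 0 < ∏ j, |x - y j| := Finset.prod_pos fun j _ => abs_pos.2 (sub_ne_zero.2 (hxy j))
  simpa using this

lemma weight_mul_pow_le {x p : ℝ} (hp : ∀ j, |x - p| ≤ |x - y j|) (k : ℕ) :
    weight f x * ENNReal.ofReal (|x - p| ^ (m + k)) ≤
      weight f x * ENNReal.ofReal (∏ j, |x - y j|) * ENNReal.ofReal (|x - p| ^ k) := by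
  rw [mul_assoc, ← ENNReal.ofReal_mul (Finset.prod_nonneg fun _ _ => abs_nonneg _), pow_add]
  gcongr
  calc |x - p| ^ m = ∏ _j : Fin m, |x - p| := by simp
    _ ≤ _ := Finset.prod_le_prod (fun _ _ => abs_nonneg _) fun j _ => hp j

include hy in
lemma interlacingIntegral_ne_top_of_merged (E : Interlacing τ m r d)
    (h : mergedIntegral E (weight f) y ≠ ∞) :
    interlacingIntegral τ r (fun x => weight f x * ENNReal.ofReal (∏ j, |x - y j|)) y ≠ ∞ := by
  intro htop
  rw [mergedIntegral_eq, htop, ENNReal.mul_top] at h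
  · exact h rfl
  · simpa using (vdm_ne_zero_iff y).2 hy.injective

include hI hI' hf0 hfc hfI hm hy hyO

lemma upperMoments_of_interlacingIntegral (hd : 0 < d) (hdm : d ≤ m + 1)
    (h : interlacingIntegral 0 d (weight f) y ≠ ∞) : UpperMoments f d := by
  obtain ⟨k, rfl⟩ : ∃ k, d = k + 1 := ⟨d - 1, by omega⟩
  exact upperMoments_of_lintegral hI hI' hfc hfI hf0 (hyO _) (upper_moment_ne_top hm hy
    (isOpen_pos hI hfc hfI) hyO (measurable_weight (measurable_of_continuousOn hI hfc hfI))
    (fun x hx _ => by simpa [weight] using hx) (by omega) h) le_rfl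

lemma lowerMoments_of_interlacingIntegral (hd : 0 < d) (hdm : d + τ = m + 1)
    (h : interlacingIntegral τ d (weight f) y ≠ ∞) : LowerMoments f d := by
  obtain ⟨k, rfl⟩ : ∃ k, d = k + 1 := ⟨d - 1, by omega⟩
  exact lowerMoments_of_lintegral hI hI' hfc hfI hf0 (hyO _) (lower_moment_ne_top hm hy
    (isOpen_pos hI hfc hfI) hyO (measurable_weight (measurable_of_continuousOn hI hfc hfI))
    (fun x hx _ => by simpa [weight] using hx) (by omega) h) le_rfl

/-- The factors `∏ |x - y j|` of the merged integral grow like the power `m`, which adds `m` to the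
order of the moments. -/
lemma upperMoments_of_mergedIntegral (E : Interlacing 0 m r d) (hr : 0 < r) (hrm : r ≤ m + 1)
    (h : mergedIntegral E (weight f) y ≠ ∞) : UpperMoments f d := by
  have hd := E.card_eq
  obtain ⟨k, rfl⟩ : ∃ k, r = k + 1 := ⟨r - 1, by omega⟩
  have h1 := upper_moment_ne_top hm hy (isOpen_pos hI hfc hfI) hyO
    (measurable_weight_mul (measurable_of_continuousOn hI hfc hfI) y)
    (fun x hx hxy => weight_mul_ne_zero hx hxy) (by omega)
    (interlacingIntegral_ne_top_of_merged hy E h)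
  refine upperMoments_of_lintegral hI hI' hfc hfI hf0 (hyO ⟨0, hm⟩) (n := m + k)
    (ne_top_of_le_ne_top h1 (setLIntegral_mono' measurableSet_Ioi fun x hx =>
      weight_mul_pow_le (fun j => ?_) k)) (by omega)
  have h2 : y j ≤ y ⟨0, hm⟩ := hy.antitone (Fin.le_def.2 (by simp))
  have h3 : y ⟨0, hm⟩ < x := hx
  rw [abs_of_pos (by linarith), abs_of_pos (by linarith)]
  linarith

lemma lowerMoments_of_mergedIntegral (E : Interlacing τ m r d) (hr : 0 < r) (hrm : r + τ = m + 1)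
    (h : mergedIntegral E (weight f) y ≠ ∞) : LowerMoments f d := by
  have hd := E.card_eq
  obtain ⟨k, rfl⟩ : ∃ k, r = k + 1 := ⟨r - 1, by omega⟩
  have h1 := lower_moment_ne_top (k := k) (τ := τ) hm hy (isOpen_pos hI hfc hfI) hyO
    (measurable_weight_mul (measurable_of_continuousOn hI hfc hfI) y)
    (fun x hx hxy => weight_mul_ne_zero hx hxy) (by omega)
    (interlacingIntegral_ne_top_of_merged hy E h)
  refine lowerMoments_of_lintegral hI hI' hfc hfI hf0 (hyO ⟨m - 1, by omega⟩) (n := m + k)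
    (ne_top_of_le_ne_top h1 (setLIntegral_mono' measurableSet_Iio fun x hx =>
      weight_mul_pow_le (fun j => ?_) k)) (by omega)
  have h2 : y ⟨m - 1, by omega⟩ ≤ y j := hy.antitone (Fin.le_def.2 (by simp only; omega))
  have h3 : x < y ⟨m - 1, by omega⟩ := hx
  rw [abs_of_neg (by linarith), abs_of_neg (by linarith)]
  linarith

omit hI' hf0 in
lemma interlacingIntegral_weight_ne_zero (hd : d + τ ≤ m + 1) :
    interlacingIntegral τ d (weight f) y ≠ 0 :=
  interlacingIntegral_ne_zero hm hy (isOpen_pos hI hfc hfI) hyO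
    (measurable_weight (measurable_of_continuousOn hI hfc hfI))
    (fun x hx _ => by simpa [weight] using hx) hd

omit hI' hf0 in
lemma mergedIntegral_weight_ne_zero (E : Interlacing τ m r d) (hr : r + τ ≤ m + 1) :
    mergedIntegral E (weight f) y ≠ 0 := by
  rw [mergedIntegral_eq]
  refine mul_ne_zero (by simpa using (vdm_ne_zero_iff y).2 hy.injective) ?_
  exact interlacingIntegral_ne_zero hm hy (isOpen_pos hI hfc hfI) hyO
    (measurable_weight_mul (measurable_of_continuousOn hI hfc hfI) y)
    (fun x hx hxy => weight_mul_ne_zero hx hxy) hr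

end Moments

/-! ### Determinantal forms of the kernels -/

section Forms

variable {I : Set ℝ} (hI : IsOpen I) (hI' : I.OrdConnected) {f : ℝ → ℝ} (hf0 : ∀ x, 0 ≤ f x)
  (hfc : ContinuousOn f I) (hfI : ∀ x, x ∉ I → f x = 0) {b : ℝ} (hb : 0 < f b)

include hI hI' hfc hfI hb in
lemma hasDerivAt_of_eq_primitive {d : ℕ} {F : ℝ → Fin d → ℝ} {c : Fin d → ℝ}
    (hFG : ∀ x, F x = momentPrimitive f d b x - c) {t : ℝ} (ht : 0 < f t) :
    HasDerivAt F (momentCurve f d t) t := by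
  rw [funext hFG]
  exact (hasDerivAt_momentPrimitive hI hI' hfc (mem_of_pos hfI hb) (mem_of_pos hfI ht) d).sub_const
    c

include hfc hfI in
lemma continuousOn_momentCurve_pos (d : ℕ) : ContinuousOn (momentCurve f d) {x | 0 < f x} :=
  (continuousOn_momentCurve hfc d).mono fun _ hx => mem_of_pos hfI hx

include hI hI' hf0 hfc hfI hb

/-- Ensembles with one unbounded slot, the one at `+∞`; the primitive is made to vanish there. -/
lemma hasDeterminantalForm_upper {k r : ℕ} (E : Interlacing 0 (k + 1) r (2 * (k + 1)))
    (hM : UpperMoments f (2 * (k + 1))) :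
    HasDeterminantalForm (n := k + 1) f (interlacingIntegral 0 (2 * (k + 1)) (weight f))
      (mergedIntegral E (weight f)) := by
  obtain ⟨s, -, hs⟩ := exists_sign_vdm (2 * (k + 1))
  obtain ⟨κ₁, h1⟩ := exists_rowDet_upper (k := 2 * k + 1) (slotCoeff (2 * (k + 1)))
  obtain ⟨κ₂, h2⟩ := exists_rowDet_upper (k := 2 * k + 1) (mergedCoeff (2 * (k + 1)))
  set F : ℝ → Fin (2 * (k + 1)) → ℝ := fun x =>
    momentPrimitive f (2 * (k + 1)) b x - upperLimit f (2 * (k + 1)) b with hF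
  have hFG : ∀ x, F x = momentPrimitive f _ b x - upperLimit f _ b := fun _ => rfl
  refine ⟨F, momentCurve f (2 * (k + 1)), s * κ₁, s * κ₂,
    fun t ht => hasDerivAt_of_eq_primitive hI hI' hfc hfI hb hFG ht,
    continuousOn_momentCurve_pos hfc hfI _, fun y hy hyO => ?_, fun t ht htO => ?_⟩
  · rw [interlacingIntegral_eq hI' hf0 hfc hfI (by omega) hs (fun _ => hM)
      (fun h => absurd h (by omega)) (by omega) hy hyO, mul_assoc]
    congr 2
    refine h1 (fun i => F (y i)) (slotMoment f _ y) ?_ fun i hi =>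
      slotMoment_succ_shift hI' hfc hfI hb hFG hy hyO (by omega)
    exact (slotMoment_zero_shift hI' hfc hfI hb hFG hM hy hyO (by omega)).trans
      (by rw [sub_self, zero_sub]; rfl)
  · rw [prod_mul_mergedIntegral_eq hI' hf0 hfc hfI (by omega) hs (fun _ => hM)
      (fun h => absurd h (by omega)) (by omega) E ht htO, mul_assoc]
    congr 2
    refine h2 (doubled F _ t) (mergedRow f _ t) ?_ fun i hi =>
      mergedRow_succ hI' hfc hfI hb hFG ht htO (by omega)
    exact (mergedRow_zero hI' hfc hfI hb hFG hM ht htO (by omega)).trans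
      (by rw [sub_self, zero_sub]; rfl)

/-- Ensembles with one unbounded slot, the one at `-∞`; the primitive is made to vanish there. -/
lemma hasDeterminantalForm_lower {k r : ℕ} (E : Interlacing 1 (k + 1) r (2 * (k + 1)))
    (hM : LowerMoments f (2 * (k + 1))) :
    HasDeterminantalForm (n := k + 1) f (interlacingIntegral 1 (2 * (k + 1)) (weight f))
      (mergedIntegral E (weight f)) := by
  obtain ⟨s, -, hs⟩ := exists_sign_vdm (2 * (k + 1))
  obtain ⟨κ₁, h1⟩ := exists_rowDet_lower (k := 2 * k + 1) (slotCoeff (2 * (k + 1)))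
    (indexCoeff (2 * (k + 1)) (2 * k + 1))
  obtain ⟨κ₂, h2⟩ := exists_rowDet_lower (k := 2 * k + 1) (mergedCoeff (2 * (k + 1)))
    (indexCoeff (2 * (k + 1)) (2 * k))
  set F : ℝ → Fin (2 * (k + 1)) → ℝ := fun x =>
    momentPrimitive f (2 * (k + 1)) b x - lowerLimit f (2 * (k + 1)) b with hF
  have hFG : ∀ x, F x = momentPrimitive f _ b x - lowerLimit f _ b := fun _ => rfl
  refine ⟨F, momentCurve f (2 * (k + 1)), s * κ₁, s * κ₂,
    fun t ht => hasDerivAt_of_eq_primitive hI hI' hfc hfI hb hFG ht,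
    continuousOn_momentCurve_pos hfc hfI _, fun y hy hyO => ?_, fun t ht htO => ?_⟩
  · rw [interlacingIntegral_eq hI' hf0 hfc hfI (by omega) hs (fun h => absurd h (by omega))
      (fun _ => hM) (by omega) hy hyO, mul_assoc]
    congr 2
    refine h1 (fun i => F (y i)) (slotMoment f _ y) ?_ fun i hi =>
      slotMoment_succ_shift hI' hfc hfI hb hFG hy hyO (by omega)
    exact (slotMoment_last_shift hb hFG hM hy hyO (l := 2 * k + 1) (by omega)).trans
      (by rw [sub_self, sub_zero]; rfl)
  · rw [prod_mul_mergedIntegral_eq hI' hf0 hfc hfI (by omega) hs (fun h => absurd h (by omega))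
      (fun _ => hM) (by omega) E ht htO, mul_assoc]
    congr 2
    refine h2 (doubled F _ t) (mergedRow f _ t) ?_ fun i hi =>
      mergedRow_succ hI' hfc hfI hb hFG ht htO (by omega)
    exact (mergedRow_last hb hFG hM ht htO (by omega)).trans (by rw [sub_self, sub_zero]; rfl)

/-- Ensembles with both unbounded slots. The primitives live in one dimension more, and the
direction joining their two limits is projected away. -/
lemma hasDeterminantalForm_both {k r : ℕ} (E : Interlacing 0 (k + 1) r (2 * (k + 1) + 1))
    (hM : UpperMoments f (2 * (k + 1) + 1)) (hM' : LowerMoments f (2 * (k + 1) + 1)) :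
    HasDeterminantalForm (n := k + 1) f (interlacingIntegral 0 (2 * (k + 1) + 1) (weight f))
      (mergedIntegral E (weight f)) := by
  obtain ⟨s, -, hs⟩ := exists_sign_vdm (2 * (k + 1) + 1)
  obtain ⟨κ₁, h1⟩ := exists_rowDet_both (k := 2 * k + 1) (slotCoeff (2 * (k + 1)))
    (indexCoeff (2 * (k + 1)) (2 * k + 1))
  obtain ⟨κ₂, h2⟩ := exists_rowDet_both (k := 2 * k + 1) (mergedCoeff (2 * (k + 1)))
    (indexCoeff (2 * (k + 1)) (2 * k))
  set G : ℝ → Fin (2 * (k + 1) + 1) → ℝ := fun x =>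
    momentPrimitive f (2 * (k + 1) + 1) b x - lowerLimit f (2 * (k + 1) + 1) b with hG
  have hGG : ∀ x, G x = momentPrimitive f _ b x - lowerLimit f _ b := fun _ => rfl
  set u : Fin (2 * (k + 1) + 1) → ℝ :=
    upperLimit f (2 * (k + 1) + 1) b - lowerLimit f (2 * (k + 1) + 1) b with hu
  have hA : ∀ y : Fin (2 * (k + 1)) → ℝ, StrictAnti y → (∀ i, 0 < f (y i)) →
      interlacingIntegral 0 (2 * (k + 1) + 1) (weight f) y = ENNReal.ofReal (s * (κ₁ *
        rowDet (Fin.cons u (fun i => G (y i)) : Fin (2 * (k + 1) + 1) → _))) := by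
    intro y hy hyO
    rw [interlacingIntegral_eq hI' hf0 hfc hfI (by omega) hs (fun _ => hM)
      (fun _ => hM') (by omega) hy hyO]
    congr 2
    exact h1 u (fun i => G (y i)) (slotMoment f _ y)
      (slotMoment_zero_shift hI' hfc hfI hb hGG hM hy hyO (by omega))
      ((slotMoment_last_shift hb hGG hM' hy hyO (l := 2 * k + 1) (by omega)).trans
        (by rw [sub_self, sub_zero]; rfl))
      fun i hi => slotMoment_succ_shift hI' hfc hfI hb hGG hy hyO (by omega)
  have hB : ∀ t : Fin (k + 1) → ℝ, StrictAnti t → (∀ i, 0 < f (t i)) →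
      (∏ i, weight f (t i)) * mergedIntegral E (weight f) t = ENNReal.ofReal (s * (κ₂ *
        rowDet (Fin.cons u (doubled G (momentCurve f _) t) : Fin (2 * (k + 1) + 1) → _))) := by
    intro t ht htO
    rw [prod_mul_mergedIntegral_eq hI' hf0 hfc hfI (by omega) hs (fun _ => hM)
      (fun _ => hM') (by omega) E ht htO]
    congr 2
    exact h2 u (doubled G _ t) (mergedRow f _ t)
      (mergedRow_zero hI' hfc hfI hb hGG hM ht htO (by omega))
      ((mergedRow_last hb hGG hM' ht htO (by omega)).trans (by rw [sub_self, sub_zero]; rfl))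
      fun i hi => mergedRow_succ hI' hfc hfI hb hGG ht htO (by omega)
  -- Otherwise the integral in `hA` would vanish.
  have hu0 : u ≠ 0 := by
    intro h0
    obtain ⟨y, hy, hyO⟩ := exists_strictAnti_mem
      ((isOpen_pos hI hfc hfI).infinite_of_mem hb) (2 * (k + 1))
    refine interlacingIntegral_weight_ne_zero hI hfc hfI (by omega) hy hyO (τ := 0) (by omega)
      (hA y hy hyO |>.trans ?_)
    rw [h0, rowDet, Matrix.det_eq_zero_of_row_eq_zero (0 : Fin (2 * (k + 1) + 1)) (fun j => rfl)]
    simp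
  obtain ⟨L, κ, -, -, hdet, -⟩ := exists_reduction u hu0
  refine ⟨fun x => L (G x), fun x => L (momentCurve f _ x), s * (κ₁ * κ), s * (κ₂ * κ),
    fun t ht => (hasDerivAt_of_eq_primitive hI hI' hfc hfI hb hGG ht).linearMap_comp L,
    (LinearMap.continuous_of_finiteDimensional L).comp_continuousOn
      (continuousOn_momentCurve_pos hfc hfI _), fun y hy hyO => ?_, fun t ht htO => ?_⟩
  · rw [hA y hy hyO, hdet]
    congr 1
    ring
  · rw [hB t ht htO, hdet, linearMap_doubled]
    congr 1
    ring

/-- Ensembles without unbounded slots. The primitives live in one dimension less, and a constant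
coordinate is added. -/
lemma hasDeterminantalForm_neither {k r : ℕ} (E : Interlacing 1 (k + 1) r (2 * k + 1)) :
    HasDeterminantalForm (n := k + 1) f (interlacingIntegral 1 (2 * k + 1) (weight f))
      (mergedIntegral E (weight f)) := by
  obtain ⟨s, -, hs⟩ := exists_sign_vdm (2 * k + 1)
  obtain ⟨κ₁, h1⟩ := exists_rowDet_neither (k := 2 * k + 1) (slotCoeff (2 * (k + 1)))
  obtain ⟨κ₂, h2⟩ := exists_rowDet_neither (k := 2 * k + 1) (mergedCoeff (2 * (k + 1)))
  set G : ℝ → Fin (2 * k + 1) → ℝ := momentPrimitive f (2 * k + 1) b with hG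
  have hGG : ∀ x, G x = momentPrimitive f (2 * k + 1) b x - 0 := fun x => (sub_zero _).symm
  set F : ℝ → Fin (2 * (k + 1)) → ℝ := fun x =>
    (Fin.cons 1 (G x) : Fin (2 * k + 1 + 1) → ℝ) with hF
  set F' : ℝ → Fin (2 * (k + 1)) → ℝ := fun x =>
    (Fin.cons 0 (momentCurve f (2 * k + 1) x) : Fin (2 * k + 1 + 1) → ℝ) with hF'
  -- The added coordinate cancels in the differences of values of `F` and vanishes in `F'`.
  have hcons : ∀ {N : ℕ} (χ : Fin N → ℝ) (X : Fin N → Fin (2 * k + 1) → ℝ) (φ : Fin N → ℝ),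
      ∑ j, φ j * χ j = 0 →
      Fintype.linearCombination ℝ (fun j => (Fin.cons (χ j) (X j) : Fin (2 * k + 1 + 1) → ℝ)) φ =
        Fin.cons 0 (Fintype.linearCombination ℝ X φ) := by
    intro N χ X φ h0
    funext a
    induction a using Fin.cases with
    | zero => simpa [Fintype.linearCombination_apply, Finset.sum_apply] using h0
    | succ a => simp [Fintype.linearCombination_apply, Finset.sum_apply]
  have hsum : ∀ {N i : ℕ} (hi : i < N) (χ : Fin N → ℝ),
      ∑ j, indexCoeff N i j * χ j = χ ⟨i, hi⟩ := by
    intro N i hi χ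
    simpa [Fintype.linearCombination_apply] using linearCombination_indexCoeff χ hi
  refine ⟨F, F', s * κ₁, s * κ₂, fun t ht => ?_, ?_, fun y hy hyO => ?_, fun t ht htO => ?_⟩
  · refine hasDerivAt_pi.2 fun a => ?_
    have h3 := hasDerivAt_pi.1 (hasDerivAt_of_eq_primitive hI hI' hfc hfI hb hGG ht)
    refine Fin.cases (motive := fun a : Fin (2 * k + 1 + 1) =>
      HasDerivAt (fun x => F x a) (F' t a) t) ?_ (fun a => ?_) a
    · simpa [hF, hF'] using hasDerivAt_const t (1 : ℝ)
    · simpa [hF, hF'] using h3 a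
  · refine continuousOn_pi.2 fun a => ?_
    have h3 := continuousOn_pi.1 (continuousOn_momentCurve_pos hfc hfI (2 * k + 1))
    refine Fin.cases (motive := fun a : Fin (2 * k + 1 + 1) =>
      ContinuousOn (fun x => F' x a) {x | 0 < f x}) ?_ (fun a => ?_) a
    · simpa [hF'] using continuousOn_const
    · simpa [hF'] using h3 a
  · rw [interlacingIntegral_eq hI' hf0 hfc hfI (by omega) hs (fun h => absurd h (by omega))
      (fun h => absurd h (by omega)) (by omega) hy hyO, mul_assoc]
    congr 2
    refine h1 (fun i => F (y i)) (slotMoment f _ y) rfl fun i hi => ?_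
    rw [slotMoment_succ_shift hI' hfc hfI hb hGG hy hyO (by omega)]
    refine (hcons (fun _ => 1) (fun j => G (y j)) _ ?_).symm
    simp only [slotCoeff, Pi.sub_apply, sub_mul, Finset.sum_sub_distrib]
    rw [hsum (by omega), hsum (by omega), sub_self]
  · rw [prod_mul_mergedIntegral_eq hI' hf0 hfc hfI (by omega) hs (fun h => absurd h (by omega))
      (fun h => absurd h (by omega)) (by omega) E ht htO, mul_assoc]
    congr 2
    have hX : doubled F F' t = fun j : Fin (2 * (k + 1)) =>
        (Fin.cons (if j.val % 2 = 0 then 1 else 0) (doubled G (momentCurve f (2 * k + 1)) t j) :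
          Fin (2 * k + 1 + 1) → ℝ) := by
      funext j
      unfold doubled
      split_ifs <;> rfl
    refine h2 (doubled F F' t) (mergedRow f _ t) rfl fun i hi => ?_
    rw [mergedRow_succ hI' hfc hfI hb hGG ht htO (by omega), hX]
    refine (hcons (fun j => if j.val % 2 = 0 then 1 else 0) _ _ ?_).symm
    rw [mergedCoeff]
    split_ifs with hi2
    · rw [hsum (by omega), if_neg (by simp only; omega)]
    · simp only [Pi.sub_apply, sub_mul, Finset.sum_sub_distrib]
      rw [hsum (by omega), hsum (by omega), if_pos (by simp only; omega),
        if_pos (by simp only; omega), sub_self]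

/-- The sum of the kernels with one unbounded slot at either end. -/
lemma hasDeterminantalForm_add {k r r' : ℕ} (E : Interlacing 0 (k + 1) r (2 * (k + 1)))
    (E' : Interlacing 1 (k + 1) r' (2 * (k + 1)))
    (hM : UpperMoments f (2 * (k + 1))) (hM' : LowerMoments f (2 * (k + 1))) :
    HasDeterminantalForm (n := k + 1) f
      (fun y => interlacingIntegral 0 (2 * (k + 1)) (weight f) y +
        interlacingIntegral 1 (2 * (k + 1)) (weight f) y)
      (fun t => mergedIntegral E (weight f) t + mergedIntegral E' (weight f) t) := by
  have hr := E.card_eq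
  have hr' := E'.card_eq
  obtain ⟨s, -, hs⟩ := exists_sign_vdm (2 * (k + 1))
  have hodd : Odd (2 * k + 1) := odd_two_mul_add_one k
  obtain ⟨κ₁, h1⟩ := exists_rowDet_add hodd (slotCoeff (2 * (k + 1)))
    (indexCoeff (2 * (k + 1)) (2 * k + 1))
  obtain ⟨κ₂, h2⟩ := exists_rowDet_add hodd (mergedCoeff (2 * (k + 1)))
    (indexCoeff (2 * (k + 1)) (2 * k))
  -- The primitive is centred at the midpoint of its two limits.
  set c : Fin (2 * (k + 1)) → ℝ :=
    (2⁻¹ : ℝ) • (upperLimit f (2 * (k + 1)) b + lowerLimit f (2 * (k + 1)) b) with hc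
  set u : Fin (2 * (k + 1)) → ℝ := upperLimit f (2 * (k + 1)) b - c with hu
  have hlow : lowerLimit f (2 * (k + 1)) b - c = -u := by
    rw [hu, hc]
    module
  set F : ℝ → Fin (2 * (k + 1)) → ℝ := fun x => momentPrimitive f (2 * (k + 1)) b x - c with hF
  have hFG : ∀ x, F x = momentPrimitive f _ b x - c := fun _ => rfl
  have hadd : ∀ {a b : ℝ}, ENNReal.ofReal a ≠ 0 → ENNReal.ofReal b ≠ 0 →
      ENNReal.ofReal a + ENNReal.ofReal b = ENNReal.ofReal (a + b) := fun ha hb =>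
    (ENNReal.ofReal_add (ENNReal.ofReal_pos.1 (pos_iff_ne_zero.2 ha)).le
      (ENNReal.ofReal_pos.1 (pos_iff_ne_zero.2 hb)).le).symm
  refine ⟨F, momentCurve f (2 * (k + 1)), s * κ₁, s * κ₂,
    fun t ht => hasDerivAt_of_eq_primitive hI hI' hfc hfI hb hFG ht,
    continuousOn_momentCurve_pos hfc hfI _, fun y hy hyO => ?_, fun t ht htO => ?_⟩
  · have e1 := interlacingIntegral_eq hI' hf0 hfc hfI (τ := 0) (n := k + 1) (by omega) hs
      (fun _ => hM) (fun h => absurd h (by omega)) (by omega) hy hyO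
    have e2 := interlacingIntegral_eq hI' hf0 hfc hfI (τ := 1) (n := k + 1) (by omega) hs
      (fun h => absurd h (by omega)) (fun _ => hM') (by omega) hy hyO
    beta_reduce
    rw [e1, e2, hadd, ← mul_add, mul_assoc]
    · congr 2
      refine h1 u (fun i => F (y i)) (slotMoment f _ y)
        (slotMoment_zero_shift hI' hfc hfI hb hFG hM hy hyO (by omega)) ?_ fun i hi =>
        slotMoment_succ_shift hI' hfc hfI hb hFG hy hyO (by omega)
      exact (slotMoment_last_shift hb hFG hM' hy hyO (l := 2 * k + 1) (by omega)).trans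
        (by rw [hlow, sub_neg_eq_add]; rfl)
    · rw [← e1]
      exact interlacingIntegral_weight_ne_zero hI hfc hfI (by omega) hy hyO (by omega)
    · rw [← e2]
      exact interlacingIntegral_weight_ne_zero hI hfc hfI (by omega) hy hyO (by omega)
  · have hprod : ∏ i, weight f (t i) ≠ 0 :=
      Finset.prod_ne_zero_iff.2 fun i _ => by simpa [weight] using htO i
    have e1 := prod_mul_mergedIntegral_eq hI' hf0 hfc hfI (n := k + 1) (by omega) hs
      (fun _ => hM) (fun h => absurd h (by omega)) (by omega) E ht htO
    have e2 := prod_mul_mergedIntegral_eq hI' hf0 hfc hfI (n := k + 1) (by omega) hs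
      (fun h => absurd h (by omega)) (fun _ => hM') (by omega) E' ht htO
    beta_reduce
    rw [mul_add, e1, e2, hadd, ← mul_add, mul_assoc]
    · congr 2
      refine h2 u (doubled F _ t) (mergedRow f _ t)
        (mergedRow_zero hI' hfc hfI hb hFG hM ht htO (by omega)) ?_ fun i hi =>
        mergedRow_succ hI' hfc hfI hb hFG ht htO (by omega)
      exact (mergedRow_last hb hFG hM' ht htO (by omega)).trans
        (by rw [hlow, sub_neg_eq_add]; rfl)
    · rw [← e1]
      exact mul_ne_zero hprod
        (mergedIntegral_weight_ne_zero hI hfc hfI (by omega) ht htO E (by omega))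
    · rw [← e2]
      exact mul_ne_zero hprod
        (mergedIntegral_weight_ne_zero hI hfc hfI (by omega) ht htO E' (by omega))

end Forms

/-! ### The five equivalences -/

lemma evenPart_eq {N m r : ℕ} (h : m = N / 2) (E : Interlacing 0 m r N)
    (μ : Measure (Fin N → ℝ)) :
    evenPart h μ = μ.map fun x i => descending x (E.equiv (Sum.inl i)) := by
  rw [evenPart]
  congr 1
  funext x i
  exact congrArg (descending x) (Fin.ext (by rw [E.inl]; rfl))

lemma oddPart_eq {N m r : ℕ} (h : m = (N + 1) / 2) (E : Interlacing 1 m r N)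
    (μ : Measure (Fin N → ℝ)) :
    oddPart h μ = μ.map fun x i => descending x (E.equiv (Sum.inl i)) := by
  rw [oddPart]
  congr 1
  funext x i
  exact congrArg (descending x) (Fin.ext (by rw [E.inl]; rfl))

lemma HasOrderedDensity.altPart {N m r r' : ℕ} (h : N = 2 * m) (E : Interlacing 0 m r N)
    (E' : Interlacing 1 m r' N) {μ : Measure (Fin N → ℝ)} {δ η : (Fin m → ℝ) → ℝ≥0∞}
    (hδ : HasOrderedDensity (μ.map fun x i => descending x (E.equiv (Sum.inl i))) δ)
    (hη : HasOrderedDensity (μ.map fun x i => descending x (E'.equiv (Sum.inl i))) η) :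
    HasOrderedDensity (altPart h μ) fun x => 2⁻¹ * δ x + 2⁻¹ * η x := by
  rw [_root_.altPart, evenPart_eq _ E, oddPart_eq _ E']
  exact (hδ.smul _).add (hη.smul _)

lemma ofReal_factorial_ne_zero (p q : ℕ) :
    ENNReal.ofReal (p.factorial * q.factorial * 2 ^ p) ≠ 0 := by
  have : (0 : ℝ) < p.factorial * q.factorial * 2 ^ p := by positivity
  simpa using this

lemma natCast_factorial_ne_zero (N : ℕ) : (N.factorial : ℝ≥0∞) ≠ 0 := by
  exact_mod_cast N.factorial_ne_zero

section Equivalences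

variable {n : ℕ} (hn : 2 ≤ n) {I : Set ℝ} (hI : IsOpen I) (hI' : I.OrdConnected) {f g : ℝ → ℝ}
  (hf0 : ∀ x, 0 ≤ f x) (hg0 : ∀ x, 0 ≤ g x) (hg : Measurable g) (hfc : ContinuousOn f I)
  (hfI : ∀ x, x ∉ I → f x = 0)

include hn hI hf0 hg0 hg hfc hfI

/-- The equivalence for any pair of laws whose ordered densities are given by a pair of kernels
with a determinantal form. -/
lemma sameEnsemble_unitary_iff_symplectic {μ : Measure (Fin (2 * n) → ℝ)} {ν : Measure (Fin n → ℝ)}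
    {δ KA : (Fin (2 * n) → ℝ) → ℝ≥0∞} {η KB : (Fin n → ℝ) → ℝ≥0∞} {C C' : ℝ≥0∞}
    (hμ : HasOrderedDensity μ δ) (hν : HasOrderedDensity ν η)
    (hC : C ≠ 0) (hCtop : C ≠ ∞) (hC' : C' ≠ 0) (hCtop' : C' ≠ ∞)
    (hδ : ∀ y, StrictAnti y →
      δ y = C * ((∏ i, weight f (y i)) * ENNReal.ofReal |vdm y| * KA y))
    (hη : ∀ t, StrictAnti t → η t = C' * ((∏ i, weight f (t i)) * KB t))
    (hposA : ∀ y, StrictAnti y → (∀ i, 0 < f (y i)) → KA y ≠ 0)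
    (hposB : ∀ t, StrictAnti t → (∀ i, 0 < f (t i)) → KB t ≠ 0)
    (hA : ∀ y, StrictAnti y → (∀ i, 0 < f (y i)) → KA y ≠ ∞ → HasDeterminantalForm f KA KB)
    (hB : ∀ t, StrictAnti t → (∀ i, 0 < f (t i)) → KB t ≠ ∞ → HasDeterminantalForm f KA KB) :
    SameEnsemble μ (unitaryEnsemble (2 * n) (weight g)) ↔
      SameEnsemble ν (symplecticEnsemble n (quotientSqWeight g f)) := by
  have hwg := measurable_weight hg
  have hwf := measurable_weight (measurable_of_continuousOn hI hfc hfI)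
  have hwq : Measurable (quotientSqWeight g f) := (hwg.div hwf).pow_const 2
  rw [unitaryEnsemble, symplecticEnsemble,
    sameEnsemble_betaEnsemble_iff 2 hμ hC hCtop hδ hwg,
    sameEnsemble_betaEnsemble_iff 4 hν hC' hCtop' hη hwq]
  refine ae_density_iff hn hf0 hg0 (isOpen_pos hI hfc hfI) hposA hposB ?_
  rintro (⟨y, hy, hyO, h⟩ | ⟨t, ht, htO, h⟩)
  · exact hA y hy hyO h
  · exact hB t ht htO h

include hI'

lemma even_union_succ_iff (h₁ : 2 * n = (2 * n + (2 * n + 1)) / 2)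
    (h₂ : n = (2 * n + 1) / 2) :
    SameEnsemble (evenPart h₁ (ensembleUnion (orthogonalEnsemble (2 * n) (weight f))
          (orthogonalEnsemble (2 * n + 1) (weight f)))) (unitaryEnsemble (2 * n) (weight g)) ↔
      SameEnsemble (evenPart h₂ (orthogonalEnsemble (2 * n + 1) (weight f)))
        (symplecticEnsemble n (quotientSqWeight g f)) := by
  have hw := measurable_weight (measurable_of_continuousOn hI hfc hfI)
  obtain ⟨k, rfl⟩ : ∃ k, n = k + 1 := ⟨n - 1, by omega⟩
  obtain ⟨E₁⟩ : Nonempty (Interlacing 0 (2 * (k + 1)) (2 * (k + 1) + 1)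
    (2 * (k + 1) + (2 * (k + 1) + 1))) :=
    Interlacing.nonempty (by omega) (by omega) (by omega) (by omega)
  obtain ⟨E₂⟩ : Nonempty (Interlacing 0 (k + 1) (k + 1 + 1) (2 * (k + 1) + 1)) :=
    Interlacing.nonempty (by omega) (by omega) (by omega) (by omega)
  obtain ⟨δ, hδ, hδ'⟩ := E₁.hasOrderedDensity_union_left (by omega) hw
  obtain ⟨η, hη, hη'⟩ := E₂.hasOrderedDensity_orthogonal hw
  rw [evenPart_eq _ E₁, evenPart_eq _ E₂]
  refine sameEnsemble_unitary_iff_symplectic hn hI hf0 hg0 hg hfc hfI hδ hη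
    (ofReal_factorial_ne_zero _ _) ENNReal.ofReal_ne_top (natCast_factorial_ne_zero _)
    (ENNReal.natCast_ne_top _) hδ' (fun t _ => hη' t)
    (fun y hy hyO => interlacingIntegral_weight_ne_zero hI hfc hfI (by omega) hy hyO (by omega))
    (fun t ht htO => mergedIntegral_weight_ne_zero hI hfc hfI (by omega) ht htO E₂ (by omega))
    (fun y hy hyO h => ?_) fun t ht htO h => ?_
  · exact hasDeterminantalForm_both hI hI' hf0 hfc hfI (hyO 0) E₂
      (upperMoments_of_interlacingIntegral hI hI' hf0 hfc hfI (by omega) hy hyO (by omega)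
        (by omega) h)
      (lowerMoments_of_interlacingIntegral hI hI' hf0 hfc hfI (by omega) hy hyO (by omega)
        (by omega) h)
  · exact hasDeterminantalForm_both hI hI' hf0 hfc hfI (htO 0) E₂
      (upperMoments_of_mergedIntegral hI hI' hf0 hfc hfI (by omega) ht htO E₂ (by omega)
        (by omega) h)
      (lowerMoments_of_mergedIntegral hI hI' hf0 hfc hfI (by omega) ht htO E₂ (by omega)
        (by omega) h)

lemma even_union_iff (h₁ : 2 * n = (2 * n + 2 * n) / 2)
    (h₂ : n = 2 * n / 2) :
    SameEnsemble (evenPart h₁ (ensembleUnion (orthogonalEnsemble (2 * n) (weight f))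
          (orthogonalEnsemble (2 * n) (weight f)))) (unitaryEnsemble (2 * n) (weight g)) ↔
      SameEnsemble (evenPart h₂ (orthogonalEnsemble (2 * n) (weight f)))
        (symplecticEnsemble n (quotientSqWeight g f)) := by
  have hw := measurable_weight (measurable_of_continuousOn hI hfc hfI)
  obtain ⟨k, rfl⟩ : ∃ k, n = k + 1 := ⟨n - 1, by omega⟩
  obtain ⟨E₁⟩ : Nonempty (Interlacing 0 (2 * (k + 1)) (2 * (k + 1))
    (2 * (k + 1) + 2 * (k + 1))) :=
    Interlacing.nonempty (by omega) (by omega) (by omega) (by omega)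
  obtain ⟨E₂⟩ : Nonempty (Interlacing 0 (k + 1) (k + 1) (2 * (k + 1))) :=
    Interlacing.nonempty (by omega) (by omega) (by omega) (by omega)
  obtain ⟨δ, hδ, hδ'⟩ := E₁.hasOrderedDensity_union_left le_rfl hw
  obtain ⟨η, hη, hη'⟩ := E₂.hasOrderedDensity_orthogonal hw
  rw [evenPart_eq _ E₁, evenPart_eq _ E₂]
  refine sameEnsemble_unitary_iff_symplectic hn hI hf0 hg0 hg hfc hfI hδ hη
    (ofReal_factorial_ne_zero _ _) ENNReal.ofReal_ne_top (natCast_factorial_ne_zero _)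
    (ENNReal.natCast_ne_top _) hδ' (fun t _ => hη' t)
    (fun y hy hyO => interlacingIntegral_weight_ne_zero hI hfc hfI (by omega) hy hyO (by omega))
    (fun t ht htO => mergedIntegral_weight_ne_zero hI hfc hfI (by omega) ht htO E₂ (by omega))
    (fun y hy hyO h => ?_) fun t ht htO h => ?_
  · exact hasDeterminantalForm_upper hI hI' hf0 hfc hfI (hyO 0) E₂
      (upperMoments_of_interlacingIntegral hI hI' hf0 hfc hfI (by omega) hy hyO (by omega)
        (by omega) h)
  · exact hasDeterminantalForm_upper hI hI' hf0 hfc hfI (htO 0) E₂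
      (upperMoments_of_mergedIntegral hI hI' hf0 hfc hfI (by omega) ht htO E₂ (by omega)
        (by omega) h)

lemma odd_union_iff (h₁ : 2 * n = (2 * n + 2 * n + 1) / 2)
    (h₂ : n = (2 * n + 1) / 2) :
    SameEnsemble (oddPart h₁ (ensembleUnion (orthogonalEnsemble (2 * n) (weight f))
          (orthogonalEnsemble (2 * n) (weight f)))) (unitaryEnsemble (2 * n) (weight g)) ↔
      SameEnsemble (oddPart h₂ (orthogonalEnsemble (2 * n) (weight f)))
        (symplecticEnsemble n (quotientSqWeight g f)) := by
  have hw := measurable_weight (measurable_of_continuousOn hI hfc hfI)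
  obtain ⟨k, rfl⟩ : ∃ k, n = k + 1 := ⟨n - 1, by omega⟩
  obtain ⟨E₁⟩ : Nonempty (Interlacing 1 (2 * (k + 1)) (2 * (k + 1))
    (2 * (k + 1) + 2 * (k + 1))) :=
    Interlacing.nonempty (by omega) (by omega) (by omega) (by omega)
  obtain ⟨E₂⟩ : Nonempty (Interlacing 1 (k + 1) (k + 1) (2 * (k + 1))) :=
    Interlacing.nonempty (by omega) (by omega) (by omega) (by omega)
  obtain ⟨δ, hδ, hδ'⟩ := E₁.hasOrderedDensity_union_left le_rfl hw
  obtain ⟨η, hη, hη'⟩ := E₂.hasOrderedDensity_orthogonal hw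
  rw [oddPart_eq _ E₁, oddPart_eq _ E₂]
  refine sameEnsemble_unitary_iff_symplectic hn hI hf0 hg0 hg hfc hfI hδ hη
    (ofReal_factorial_ne_zero _ _) ENNReal.ofReal_ne_top (natCast_factorial_ne_zero _)
    (ENNReal.natCast_ne_top _) hδ' (fun t _ => hη' t)
    (fun y hy hyO => interlacingIntegral_weight_ne_zero hI hfc hfI (by omega) hy hyO (by omega))
    (fun t ht htO => mergedIntegral_weight_ne_zero hI hfc hfI (by omega) ht htO E₂ (by omega))
    (fun y hy hyO h => ?_) fun t ht htO h => ?_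
  · exact hasDeterminantalForm_lower hI hI' hf0 hfc hfI (hyO 0) E₂
      (lowerMoments_of_interlacingIntegral hI hI' hf0 hfc hfI (by omega) hy hyO (by omega)
        (by omega) h)
  · exact hasDeterminantalForm_lower hI hI' hf0 hfc hfI (htO 0) E₂
      (lowerMoments_of_mergedIntegral hI hI' hf0 hfc hfI (by omega) ht htO E₂ (by omega)
        (by omega) h)

lemma odd_union_pred_iff {p : ℕ} (hp : p + 1 = 2 * n) (h₁ : 2 * n = (p + 2 * n + 1) / 2)
    (h₂ : n = (p + 1) / 2) :
    SameEnsemble (oddPart h₁ (ensembleUnion (orthogonalEnsemble p (weight f))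
          (orthogonalEnsemble (2 * n) (weight f)))) (unitaryEnsemble (2 * n) (weight g)) ↔
      SameEnsemble (oddPart h₂ (orthogonalEnsemble p (weight f)))
        (symplecticEnsemble n (quotientSqWeight g f)) := by
  have hw := measurable_weight (measurable_of_continuousOn hI hfc hfI)
  obtain ⟨k, rfl⟩ : ∃ k, n = k + 1 := ⟨n - 1, by omega⟩
  obtain rfl : p = 2 * k + 1 := by omega
  obtain ⟨E₁⟩ : Nonempty (Interlacing 1 (2 * (k + 1)) (2 * k + 1)
    (2 * k + 1 + 2 * (k + 1))) :=
    Interlacing.nonempty (by omega) (by omega) (by omega) (by omega)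
  obtain ⟨E₂⟩ : Nonempty (Interlacing 1 (k + 1) k (2 * k + 1)) :=
    Interlacing.nonempty (by omega) (by omega) (by omega) (by omega)
  obtain ⟨δ, hδ, hδ'⟩ := E₁.hasOrderedDensity_union_right (by omega) hw
  obtain ⟨η, hη, hη'⟩ := E₂.hasOrderedDensity_orthogonal hw
  rw [oddPart_eq _ E₁, oddPart_eq _ E₂]
  exact sameEnsemble_unitary_iff_symplectic hn hI hf0 hg0 hg hfc hfI hδ hη
    (ofReal_factorial_ne_zero _ _) ENNReal.ofReal_ne_top (natCast_factorial_ne_zero _)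
    (ENNReal.natCast_ne_top _) hδ' (fun t _ => hη' t)
    (fun y hy hyO => interlacingIntegral_weight_ne_zero hI hfc hfI (by omega) hy hyO (by omega))
    (fun t ht htO => mergedIntegral_weight_ne_zero hI hfc hfI (by omega) ht htO E₂ (by omega))
    (fun y _ hyO _ => hasDeterminantalForm_neither hI hI' hf0 hfc hfI (hyO 0) E₂)
    fun t _ htO _ => hasDeterminantalForm_neither hI hI' hf0 hfc hfI (htO 0) E₂

lemma alt_union_iff (h₁ : 2 * n + 2 * n = 2 * (2 * n))
    (h₂ : 2 * n = 2 * n) :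
    SameEnsemble (altPart h₁ (ensembleUnion (orthogonalEnsemble (2 * n) (weight f))
          (orthogonalEnsemble (2 * n) (weight f)))) (unitaryEnsemble (2 * n) (weight g)) ↔
      SameEnsemble (altPart h₂ (orthogonalEnsemble (2 * n) (weight f)))
        (symplecticEnsemble n (quotientSqWeight g f)) := by
  have hw := measurable_weight (measurable_of_continuousOn hI hfc hfI)
  obtain ⟨k, rfl⟩ : ∃ k, n = k + 1 := ⟨n - 1, by omega⟩
  obtain ⟨E₁⟩ : Nonempty (Interlacing 0 (2 * (k + 1)) (2 * (k + 1))
    (2 * (k + 1) + 2 * (k + 1))) :=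
    Interlacing.nonempty (by omega) (by omega) (by omega) (by omega)
  obtain ⟨E₁'⟩ : Nonempty (Interlacing 1 (2 * (k + 1)) (2 * (k + 1))
    (2 * (k + 1) + 2 * (k + 1))) :=
    Interlacing.nonempty (by omega) (by omega) (by omega) (by omega)
  obtain ⟨E₂⟩ : Nonempty (Interlacing 0 (k + 1) (k + 1) (2 * (k + 1))) :=
    Interlacing.nonempty (by omega) (by omega) (by omega) (by omega)
  obtain ⟨E₂'⟩ : Nonempty (Interlacing 1 (k + 1) (k + 1) (2 * (k + 1))) :=
    Interlacing.nonempty (by omega) (by omega) (by omega) (by omega)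
  obtain ⟨δ, hδ, hδ'⟩ := E₁.hasOrderedDensity_union_left le_rfl hw
  obtain ⟨ε, hε, hε'⟩ := E₁'.hasOrderedDensity_union_left le_rfl hw
  obtain ⟨η, hη, hη'⟩ := E₂.hasOrderedDensity_orthogonal hw
  obtain ⟨θ, hθ, hθ'⟩ := E₂'.hasOrderedDensity_orthogonal hw
  have h2 : (2⁻¹ : ℝ≥0∞) ≠ 0 := by simp
  have h2' : (2⁻¹ : ℝ≥0∞) ≠ ∞ := by simp
  refine sameEnsemble_unitary_iff_symplectic hn hI hf0 hg0 hg hfc hfI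
    (KA := fun y => interlacingIntegral 0 (2 * (k + 1)) (weight f) y +
      interlacingIntegral 1 (2 * (k + 1)) (weight f) y)
    (KB := fun t => mergedIntegral E₂ (weight f) t + mergedIntegral E₂' (weight f) t)
    (hδ.altPart h₁ E₁ E₁' hε) (hη.altPart h₂ E₂ E₂' hθ)
    (mul_ne_zero h2 (ofReal_factorial_ne_zero (2 * (k + 1)) (2 * (k + 1))))
    (ENNReal.mul_ne_top h2' ENNReal.ofReal_ne_top)
    (mul_ne_zero h2 (natCast_factorial_ne_zero (2 * (k + 1))))
    (ENNReal.mul_ne_top h2' (ENNReal.natCast_ne_top _))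
    (fun y hy => by rw [hδ' y hy, hε' y hy]; ring) (fun t _ => by rw [hη' t, hθ' t]; ring)
    (fun y hy hyO h0 =>
      interlacingIntegral_weight_ne_zero hI hfc hfI (by omega) hy hyO (by omega)
        (add_eq_zero.1 h0).1)
    (fun t ht htO h0 =>
      mergedIntegral_weight_ne_zero hI hfc hfI (by omega) ht htO E₂ (by omega)
        (add_eq_zero.1 h0).1)
    (fun y hy hyO h => ?_) fun t ht htO h => ?_
  · exact hasDeterminantalForm_add hI hI' hf0 hfc hfI (hyO 0) E₂ E₂'
      (upperMoments_of_interlacingIntegral hI hI' hf0 hfc hfI (by omega) hy hyO (by omega)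
        (by omega) (ENNReal.add_ne_top.1 h).1)
      (lowerMoments_of_interlacingIntegral hI hI' hf0 hfc hfI (by omega) hy hyO (by omega)
        (by omega) (ENNReal.add_ne_top.1 h).2)
  · exact hasDeterminantalForm_add hI hI' hf0 hfc hfI (htO 0) E₂ E₂'
      (upperMoments_of_mergedIntegral hI hI' hf0 hfc hfI (by omega) ht htO E₂ (by omega)
        (by omega) (ENNReal.add_ne_top.1 h).1)
      (lowerMoments_of_mergedIntegral hI hI' hf0 hfc hfI (by omega) ht htO E₂' (by omega)
        (by omega) (ENNReal.add_ne_top.1 h).2)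

end Equivalences

theorem mainTheorem2 (n : ℕ) (hn : 2 ≤ n) (I : Set ℝ) (hI : IsOpen I) (hI' : I.OrdConnected)
    (f g : ℝ → ℝ) (hf0 : ∀ x, 0 ≤ f x) (hg0 : ∀ x, 0 ≤ g x) (hg : Measurable g)
    (hfd : DifferentiableOn ℝ f I) (hfI : ∀ x, x ∉ I → f x = 0) :
    (SameEnsemble
        (evenPart (by omega) (ensembleUnion (orthogonalEnsemble (2 * n) (weight f))
          (orthogonalEnsemble (2 * n + 1) (weight f))))
        (unitaryEnsemble (2 * n) (weight g)) ↔
      SameEnsemble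
        (evenPart (by omega) (orthogonalEnsemble (2 * n + 1) (weight f)))
        (symplecticEnsemble n (quotientSqWeight g f))) ∧
    (SameEnsemble
        (evenPart (by omega) (ensembleUnion (orthogonalEnsemble (2 * n) (weight f))
          (orthogonalEnsemble (2 * n) (weight f))))
        (unitaryEnsemble (2 * n) (weight g)) ↔
      SameEnsemble
        (evenPart (by omega) (orthogonalEnsemble (2 * n) (weight f)))
        (symplecticEnsemble n (quotientSqWeight g f))) ∧
    (SameEnsemble
        (oddPart (by omega) (ensembleUnion (orthogonalEnsemble (2 * n) (weight f))
          (orthogonalEnsemble (2 * n) (weight f))))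
        (unitaryEnsemble (2 * n) (weight g)) ↔
      SameEnsemble
        (oddPart (by omega) (orthogonalEnsemble (2 * n) (weight f)))
        (symplecticEnsemble n (quotientSqWeight g f))) ∧
    (SameEnsemble
        (oddPart (by omega) (ensembleUnion (orthogonalEnsemble (2 * n - 1) (weight f))
          (orthogonalEnsemble (2 * n) (weight f))))
        (unitaryEnsemble (2 * n) (weight g)) ↔
      SameEnsemble
        (oddPart (by omega) (orthogonalEnsemble (2 * n - 1) (weight f)))
        (symplecticEnsemble n (quotientSqWeight g f))) ∧
    (SameEnsemble
        (altPart (by omega) (ensembleUnion (orthogonalEnsemble (2 * n) (weight f))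
          (orthogonalEnsemble (2 * n) (weight f))))
        (unitaryEnsemble (2 * n) (weight g)) ↔
      SameEnsemble
        (altPart (by omega) (orthogonalEnsemble (2 * n) (weight f)))
        (symplecticEnsemble n (quotientSqWeight g f))) := by
  have hfc := hfd.continuousOn
  exact ⟨even_union_succ_iff hn hI hI' hf0 hg0 hg hfc hfI _ _,
    even_union_iff hn hI hI' hf0 hg0 hg hfc hfI _ _,
    odd_union_iff hn hI hI' hf0 hg0 hg hfc hfI _ _,
    odd_union_pred_iff hn hI hI' hf0 hg0 hg hfc hfI (by omega) _ _,
    alt_union_iff hn hI hI' hf0 hg0 hg hfc hfI _ _⟩
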